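/- **Lemma (Interval surgery).** All vector spaces are over $\mathbb{Q}$; CDGAs are cohomologically graded in degrees $\geq 0$; a persistent object is a functor from the poset $[0,\infty)$. *Conventions.* For a vector space $V$, $S^k(V)$ is $V$ in degree $k$ and $D^k(V)$ is $V$ in degrees $k-1,k$ with identity differential; $\Lambda$ is the free CDGA functor on cochain complexes. A Hirsch extension of degree $j$ is a pushout of $\Lambda S^{j+1}(V)\to\Lambda D^{j+1}(V)$ for some vector space $V$. A $k$-minimal algebra is a CDGA $\mathcal M$ with a sequence $\mathbb{Q}=\mathcal M_0\to\mathcal M_1\to\cdots\to\mathcal M_k=\mathcal M$ in which $\mathcal M_{j-1}\to\mathcal M_j$ is a Hirsch extension of degree $j$; a $k$-minimal model $\mathcal M\to\mathcal A$ is a CDGA map from a $k$-minimal algebra that is an isomorphism on $H^j$ for $j\le k$ and injective on $H^{k+1}$. A homotopy from $f$ to $g:\mathcal A\to\mathcal B$ is a CDGA map $H:\mathcal A\to\mathcal B\otimes\Lambda(t,dt)$ with $H|_{t=0}=f$, $H|_{t=1}=g$; $\int_0^1 H$ is its fibre integral, a cochain homotopy with $d\int_0^1H+\int_0^1H\,d=g-f$.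 The cone of $m:\mathcal M\to\mathcal A$ has $C_m^n=\mathcal M^{n+1}\oplus\mathcal A^n$ and $d(v,a)=(dv,\,m(v)-da)$. Let $\mathbb{A}$ be a persistent CDGA and $t_0<\dots<t_n$ in $[0,\infty)$ a discretization of it, i.e. $\mathbb{A}(s\le s')$ is an isomorphism unless $s<t_i\le s'$ for some $i$. Assume that every $\mathbb{A}(x)$ is simply-connected ($H^0=\mathbb{Q}$ via the unit, and $H^1=0$). A *tame $k$-minimal model* $m:\mathbb{M}\to_2\mathbb{A}$ consists of CDGA maps $\mathbb{M}(0)\to\cdots\to\mathbb{M}(n)$, $k$-minimal models $m(r):\mathbb{M}(r)\to\mathbb{A}(t_r)$ for $0\le r\le n$, and homotopies $H(r)$ from $\mathbb{A}(t_r\le t_{r+1})\,m(r)$ to $m(r+1)\,\mathbb{M}(r<r+1)$ for $0\le r<n$; the associated persistent CDGA, also written $\mathbb{M}$, is the left Kan extension of the sequence along $\{t_0<\dots<t_n\}\subset[0,\infty)$. Its *tame cone* $\mathbb{C}_m$ is the left Kan extension along the same inclusion of $C_{m(0)}\to\cdots\to C_{m(n)}$, with maps $$(v,a)\mapsto\Big(\mathbb{M}(r<r+1)v,\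 \mathbb{A}(t_r\le t_{r+1})a+\int_0^1H(r)(v)\Big).$$ For $0\le p<q\le\infty$, the interval sphere $\mathbb{S}^{k}_{[p,q)}$ is the persistent complex equal to $0$ before $p$, $S^{k}(\mathbb{Q})$ on $[p,q)$ and $D^{k}(\mathbb{Q})$ from $q$ on, and $\mathbb{D}^{k}_p\supseteq\mathbb{S}^k_{[p,q)}$ is $0$ before $p$ and $D^{k}(\mathbb{Q})$ from $p$ on. Let $k\ge1$ and let $m:\mathbb{M}\to_2\mathbb{A}$ be a tame $(k-1)$-minimal model with maps and homotopies $\{m(r),H(r)\}$. Then the persistence module $H^k\mathbb{C}_m$ is isomorphic to a direct sum of interval modules, and for every such decomposition $H^k\mathbb{C}_m\cong\bigoplus_\gamma\mathbb{I}_{[p_\gamma,q_\gamma)}$ (with $p_\gamma<q_\gamma\leq\infty$) there is a tame $k$-minimal model $\overline m:\overline{\mathbb{M}}\to_2\mathbb{A}$ for the same discretization, with maps and homotopies $\{\overline m(r),\overline H(r)\}$, together with a map $\iota:\mathbb{M}\to\overline{\mathbb{M}}$ of sequences, such that: 1. $\overline m(r)\circ\iota(r)=m(r)$ for all $r$, and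 $\overline H(r)\circ\iota(r)=H(r)$ for all $r<n$, i.e. the new maps and homotopies extend the old ones; 2. $\iota$ is a persistent Hirsch extension of degree $k$ along $H^k\mathbb{C}_m$: there is a pushout square of persistent CDGAs $$\begin{array}{ccc}\Lambda\Big(\bigoplus_\gamma\mathbb{S}^{k+1}_{[p_\gamma,q_\gamma)}\Big)&\longrightarrow&\mathbb{M}\\ \downarrow&&\downarrow{\scriptstyle\iota}\\ \Lambda\Big(\bigoplus_\gamma\mathbb{D}^{k+1}_{p_\gamma}\Big)&\longrightarrow&\overline{\mathbb{M}}\end{array}$$ whose left vertical map is induced by the inclusions of interval spheres into disks. -/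

import Mathlib

open CategoryTheory CategoryTheory.Limits TensorProduct
open scoped NNReal Polynomial

universe u

noncomputable section

/-- The submodule of `V` which is all of `V` if `P` holds and is `0` otherwise. -/
def gate (V : Type u) [AddCommGroup V] [Module ℚ V] (P : Prop) : Submodule ℚ V where
  carrier := {x | P ∨ x = 0}
  add_mem' := by
    rintro a b (h | rfl) (h' | rfl)
    · exact Or.inl h
    · exact Or.inl h
    · exact Or.inl h'
    · exact Or.inr (add_zero 0)
  zero_mem' := Or.inr rfl
  smul_mem' := by
    rintro c a (h | rfl)
    · exact Or.inl h
    · exact Or.inr (smul_zero c)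

theorem gate_mono (V : Type u) [AddCommGroup V] [Module ℚ V] {P Q : Prop} (h : P → Q) :
    gate V P ≤ gate V Q := fun _ hx => hx.imp_left h

/-- A commutative differential graded algebra over `ℚ`, cohomologically graded and concentrated in
non-negative degrees. The degree equations are arguments of `mul` and `d`, so that no transport
between graded pieces is needed to state the axioms. -/
structure CDGA where
  /-- the graded pieces -/
  X : ℤ → Type u
  [grp : ∀ n, AddCommGroup (X n)]
  [mod : ∀ n, Module ℚ (X n)]
  /-- the unit -/
  one : X 0
  /-- the product -/
  mul : ∀ {p q n : ℤ}, p + q = n → X p →ₗ[ℚ] X q →ₗ[ℚ] X n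
  /-- the differential -/
  d : ∀ {p q : ℤ}, p + 1 = q → X p →ₗ[ℚ] X q
  eq_zero_of_neg : ∀ {n : ℤ}, n < 0 → ∀ a : X n, a = 0
  one_mul : ∀ {p : ℤ} (a : X p), mul (zero_add p) one a = a
  mul_assoc : ∀ {p q r pq qr n : ℤ} (h₁ : p + q = pq) (h₂ : pq + r = n) (h₃ : q + r = qr)
    (h₄ : p + qr = n) (a : X p) (b : X q) (c : X r),
    mul h₂ (mul h₁ a b) c = mul h₄ a (mul h₃ b c)
  mul_comm : ∀ {p q n : ℤ} (h : p + q = n) (h' : q + p = n) (a : X p) (b : X q),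
    mul h a b = (-1 : ℚ) ^ (p * q) • mul h' b a
  d_d : ∀ {p q r : ℤ} (h : p + 1 = q) (h' : q + 1 = r) (a : X p), d h' (d h a) = 0
  leibniz : ∀ {p q n p' q' n' : ℤ} (h : p + q = n) (hp : p + 1 = p') (hq : q + 1 = q')
    (hn : n + 1 = n') (h₁ : p' + q = n') (h₂ : p + q' = n') (a : X p) (b : X q),
    d hn (mul h a b) = mul h₁ (d hp a) b + (-1 : ℚ) ^ p • mul h₂ a (d hq b)

namespace CDGA

attribute [instance] CDGA.grp CDGA.mod

/-- Homomorphisms of CDGAs: degree-preserving linear maps compatible with `1`, products and `d`. -/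
@[ext]
structure Hom (A B : CDGA.{u}) where
  /-- the components -/
  f : ∀ n : ℤ, A.X n →ₗ[ℚ] B.X n
  map_one : f 0 A.one = B.one
  map_mul : ∀ {p q n : ℤ} (h : p + q = n) (a : A.X p) (b : A.X q),
    f n (A.mul h a b) = B.mul h (f p a) (f q b)
  map_d : ∀ {p q : ℤ} (h : p + 1 = q) (a : A.X p), f q (A.d h a) = B.d h (f p a)

instance : Category CDGA.{u} where
  Hom := Hom
  id A := ⟨fun _ => LinearMap.id, rfl, fun _ _ _ => rfl, fun _ _ => rfl⟩
  comp F G := ⟨fun n => G.f n ∘ₗ F.f n, by simp [F.map_one, G.map_one],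
    fun h a b => by simp [F.map_mul, G.map_mul], fun h a => by simp [F.map_d, G.map_d]⟩

@[simp] theorem id_f (A : CDGA.{u}) (n : ℤ) : Hom.f (𝟙 A) n = LinearMap.id := rfl

@[simp] theorem comp_f {A B C : CDGA.{u}} (F : A ⟶ B) (G : B ⟶ C) (n : ℤ) :
    Hom.f (F ≫ G) n = Hom.f G n ∘ₗ Hom.f F n := rfl

theorem hom_ext {A B : CDGA.{u}} {F G : A ⟶ B} (h : ∀ n a, Hom.f F n a = Hom.f G n a) : F = G :=
  Hom.ext (funext fun n => LinearMap.ext (h n))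

/-- The underlying cochain complex. -/
def toComplex : CDGA.{u} ⥤ CochainComplex (ModuleCat.{u} ℚ) ℤ where
  obj A := CochainComplex.of (fun n => ModuleCat.of ℚ (A.X n)) (fun n => ModuleCat.ofHom (A.d rfl))
    (fun n => by ext a; exact A.d_d _ _ a)
  map {A B} F := CochainComplex.ofHom (fun n => ModuleCat.ofHom (Hom.f F n))
    (fun n => by
      dsimp only [CochainComplex.of]
      rw [CochainComplex.of_d, CochainComplex.of_d]
      ext a
      exact (Hom.map_d F rfl a).symm)
  map_id A := by ext n a; rfl
  map_comp F G := by ext n a; rfl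

/-- The ground field `ℚ` as a CDGA concentrated in degree `0`. -/
def rat : CDGA.{u} where
  X n := gate (ULift.{u} ℚ) (n = 0)
  one := ⟨1, Or.inl rfl⟩
  mul {p q n} h := LinearMap.mk₂ ℚ
    (fun a b => ⟨a.1 * b.1, by
      rcases a.2 with ha | ha
      · rcases b.2 with hb | hb
        · exact Or.inl (by omega)
        · exact Or.inr (by rw [hb, mul_zero])
      · exact Or.inr (by rw [ha, zero_mul])⟩)
    (fun a a' b => Subtype.ext (add_mul _ _ _))
    (fun c a b => Subtype.ext (smul_mul_assoc c _ _))
    (fun a b b' => Subtype.ext (mul_add _ _ _))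
    (fun c a b => Subtype.ext (mul_smul_comm c _ _))
  d _ := 0
  eq_zero_of_neg h a := Subtype.ext (a.2.resolve_left (by omega))
  one_mul a := Subtype.ext (_root_.one_mul _)
  mul_assoc h₁ h₂ h₃ h₄ a b c := Subtype.ext (_root_.mul_assoc _ _ _)
  mul_comm {p q n} h h' a b := by
    apply Subtype.ext
    rcases a.2 with rfl | ha
    · simp [_root_.mul_comm]
    · simp [ha]
  d_d _ _ _ := rfl
  leibniz _ _ _ _ _ _ a b := by simp; rfl

/-- Transport along an equality of degrees. -/
def cast (A : CDGA.{u}) {p q : ℤ} (h : p = q) : A.X p →ₗ[ℚ] A.X q := h ▸ LinearMap.id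

@[simp] theorem cast_rfl (A : CDGA.{u}) {p : ℤ} (h : p = p) (a : A.X p) : A.cast h a = a := rfl

@[simp] theorem cast_cast (A : CDGA.{u}) {p q r : ℤ} (h : p = q) (h' : q = r) (a : A.X p) :
    A.cast h' (A.cast h a) = A.cast (h.trans h') a := by
  subst h h'; rfl

theorem mul_one (A : CDGA.{u}) {p : ℤ} (a : A.X p) : A.mul (add_zero p) a A.one = a := by
  rw [A.mul_comm _ (zero_add p), A.one_mul]; simp

theorem d_one (A : CDGA.{u}) {p : ℤ} (h : 0 + 1 = p) : A.d h A.one = 0 := by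
  have := A.leibniz (zero_add 0) h h h (by omega) (by omega) A.one A.one
  rw [A.one_mul] at this
  subst h
  have h1 : A.mul (zero_add (0 + 1)) A.one (A.d rfl A.one) = A.d rfl A.one := A.one_mul _
  have h2 : A.mul (add_zero (0 + 1)) (A.d rfl A.one) A.one = A.d rfl A.one := A.mul_one _
  rw [h2, h1] at this
  simpa using this

/-- The rational number underlying an element of `rat`. -/
def ratVal (n : ℤ) : rat.{u}.X n →ₗ[ℚ] ℚ :=
  ULift.moduleEquiv.toLinearMap ∘ₗ (gate (ULift.{u} ℚ) (n = 0)).subtype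

theorem ratVal_injective (n : ℤ) : Function.Injective (ratVal.{u} n) := fun _ _ h =>
  Subtype.ext (ULift.down_injective h)

theorem ratVal_eq_zero {n : ℤ} (hn : n ≠ 0) (a : rat.{u}.X n) : a = 0 :=
  Subtype.ext (a.2.resolve_left hn)

theorem ratVal_one : ratVal.{u} 0 rat.one = 1 := rfl

theorem ratVal_mul {p q n : ℤ} (h : p + q = n) (a : rat.{u}.X p) (b : rat.{u}.X q) :
    ratVal n (rat.mul h a b) = ratVal p a * ratVal q b := rfl

/-- The unit map `ℚ → A`. -/
def unit (A : CDGA.{u}) : rat.{u} ⟶ A where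
  f n := (if h : n = 0 then LinearMap.toSpanSingleton ℚ _ (A.cast h.symm A.one) else 0) ∘ₗ ratVal n
  map_one := by simp [ratVal_one]
  map_mul {p q n} h a b := by
    by_cases hp : p = 0
    · by_cases hq : q = 0
      · subst hp hq
        obtain rfl : n = 0 := by omega
        have := A.one_mul A.one
        simp [ratVal_mul, mul_smul, this]
        exact smul_comm _ _ _
      · simp [ratVal_eq_zero hq b]
    · simp [ratVal_eq_zero hp a]
  map_d {p q} h a := by
    have h0 : rat.d h a = 0 := rfl
    rw [h0, map_zero]
    by_cases hp : p = 0
    · subst hp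
      simp [A.d_one h]
    · simp [ratVal_eq_zero hp a]

/-- `ℚ` is the initial CDGA. -/
def isInitialRat : IsInitial rat.{u} :=
  IsInitial.ofUniqueHom unit fun A F => by
    apply hom_ext
    intro n a
    by_cases hn : n = 0
    · subst hn
      have h : a = ratVal 0 a • rat.one := ratVal_injective 0 (by simp [ratVal_one])
      rw [h, map_smul, map_smul, Hom.map_one F, Hom.map_one (unit A)]
    · simp [ratVal_eq_zero hn a]


section Transport

variable (A : CDGA.{u})

theorem cast_mul_left {p p' q n n' : ℤ} (e : p = p') (h' : p' + q = n') (h : p + q = n)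
    (e' : n = n') (a : A.X p) (b : A.X q) :
    A.mul h' (A.cast e a) b = A.cast e' (A.mul h a b) := by
  subst e e'; rfl

theorem cast_mul_right {p q q' n n' : ℤ} (e : q = q') (h' : p + q' = n') (h : p + q = n)
    (e' : n = n') (a : A.X p) (b : A.X q) :
    A.mul h' a (A.cast e b) = A.cast e' (A.mul h a b) := by
  subst e e'; rfl

theorem d_cast {p p' q q' : ℤ} (e : p = p') (h' : p' + 1 = q') (h : p + 1 = q) (e' : q = q')
    (a : A.X p) : A.d h' (A.cast e a) = A.cast e' (A.d h a) := by
  subst e e'; rfl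

end Transport

theorem Hom.map_cast {A B : CDGA.{u}} (F : Hom A B) {p q : ℤ} (e : p = q) (a : A.X p) :
    F.f q (A.cast e a) = B.cast e (F.f p a) := by
  subst e; rfl

/-- The CDGA `A ⊗ ℚ[t]`, with `t` in degree `0` and the differential of `A` extended
`ℚ[t]`-linearly. -/
def poly (A : CDGA.{u}) : CDGA.{u} where
  X n := A.X n ⊗[ℚ] ℚ[X]
  one := A.one ⊗ₜ 1
  mul h := TensorProduct.map₂ (A.mul h) (LinearMap.mul ℚ ℚ[X])
  d h := (A.d h).rTensor ℚ[X]
  eq_zero_of_neg h a := by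
    induction a with
    | zero => rfl
    | tmul a f => rw [A.eq_zero_of_neg h a, TensorProduct.zero_tmul]
    | add a b ha hb => rw [ha, hb, add_zero]
  one_mul a := by
    induction a with
    | zero => simp
    | tmul a f => simp [A.one_mul]
    | add a b ha hb => rw [map_add, ha, hb]
  mul_assoc h₁ h₂ h₃ h₄ a b c := by
    induction a with
    | zero => simp
    | add a a' ha ha' => simp only [map_add, LinearMap.add_apply, ha, ha']
    | tmul a f =>
      induction b with
      | zero => simp
      | add b b' hb hb' => simp only [map_add, LinearMap.add_apply, hb, hb']
      | tmul b g =>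
        induction c with
        | zero => simp
        | add c c' hc hc' => simp only [map_add, hc, hc']
        | tmul c k => simp [A.mul_assoc h₁ h₂ h₃ h₄, _root_.mul_assoc]
  mul_comm {p q n} h h' a b := by
    induction a with
    | zero => simp
    | add a a' ha ha' => simp only [map_add, LinearMap.add_apply, ha, ha', smul_add]
    | tmul a f =>
      induction b with
      | zero => simp
      | add b b' hb hb' => simp only [map_add, LinearMap.add_apply, hb, hb', smul_add]
      | tmul b g =>
        simp [A.mul_comm h h' a b, _root_.mul_comm f g, TensorProduct.smul_tmul']
  d_d h h' a := by
    induction a with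
    | zero => simp
    | tmul a f => simp [A.d_d]
    | add a b ha hb => rw [map_add, map_add, ha, hb, add_zero]
  leibniz {p q n p' q' n'} h hp hq hn h₁ h₂ a b := by
    induction a with
    | zero => simp
    | add a a' ha ha' =>
      simp only [map_add, LinearMap.add_apply, ha, ha', smul_add]; abel
    | tmul a f =>
      induction b with
      | zero => simp
      | add b b' hb hb' => simp only [map_add, hb, hb', smul_add]; abel
      | tmul b g =>
        simp [A.leibniz h hp hq hn h₁ h₂ a b, TensorProduct.smul_tmul', TensorProduct.add_tmul]

/-- The derivation `∂/∂t` of `A ⊗ ℚ[t]`. -/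
def polyDeriv (A : CDGA.{u}) (n : ℤ) : A.poly.X n →ₗ[ℚ] A.poly.X n :=
  (Polynomial.derivative (R := ℚ)).lTensor (A.X n)

theorem polyDeriv_tmul (A : CDGA.{u}) {n : ℤ} (a : A.X n) (f : ℚ[X]) :
    A.polyDeriv n (a ⊗ₜ[ℚ] f : A.X n ⊗[ℚ] ℚ[X]) =
      (a ⊗ₜ[ℚ] Polynomial.derivative f : A.X n ⊗[ℚ] ℚ[X]) := rfl

theorem poly_mul_tmul (A : CDGA.{u}) {p q n : ℤ} (h : p + q = n) (a : A.X p) (b : A.X q)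
    (f g : ℚ[X]) : A.poly.mul h (a ⊗ₜ[ℚ] f : A.X p ⊗[ℚ] ℚ[X]) (b ⊗ₜ[ℚ] g : A.X q ⊗[ℚ] ℚ[X]) =
      (A.mul h a b ⊗ₜ[ℚ] (f * g) : A.X n ⊗[ℚ] ℚ[X]) := rfl

theorem poly_d_tmul (A : CDGA.{u}) {p q : ℤ} (h : p + 1 = q) (a : A.X p) (f : ℚ[X]) :
    A.poly.d h (a ⊗ₜ[ℚ] f : A.X p ⊗[ℚ] ℚ[X]) = (A.d h a ⊗ₜ[ℚ] f : A.X q ⊗[ℚ] ℚ[X]) := rfl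

theorem poly_induction (A : CDGA.{u}) {n : ℤ} {C : A.poly.X n → Prop} (zero : C 0)
    (tmul : ∀ (a : A.X n) (f : ℚ[X]), C (a ⊗ₜ[ℚ] f : A.X n ⊗[ℚ] ℚ[X]))
    (add : ∀ a b, C a → C b → C (a + b)) (a : A.poly.X n) : C a :=
  TensorProduct.induction_on a zero tmul add

theorem polyDeriv_mul (A : CDGA.{u}) {p q n : ℤ} (h : p + q = n) (a : A.poly.X p)
    (b : A.poly.X q) : A.polyDeriv n (A.poly.mul h a b) =
      A.poly.mul h (A.polyDeriv p a) b + A.poly.mul h a (A.polyDeriv q b) := by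
  induction a using poly_induction with
  | zero => simp
  | add a a' ha ha' => simp only [map_add, LinearMap.add_apply, ha, ha']; abel
  | tmul a f =>
    induction b using poly_induction with
    | zero => simp
    | add b b' hb hb' => simp only [map_add, hb, hb']; abel
    | tmul b g =>
      rw [poly_mul_tmul, polyDeriv_tmul, polyDeriv_tmul, polyDeriv_tmul, poly_mul_tmul,
        poly_mul_tmul, Polynomial.derivative_mul]
      exact TensorProduct.tmul_add _ _ _

theorem polyDeriv_d (A : CDGA.{u}) {p q : ℤ} (h : p + 1 = q) (a : A.poly.X p) :
    A.polyDeriv q (A.poly.d h a) = A.poly.d h (A.polyDeriv p a) := by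
  induction a using poly_induction with
  | zero => simp
  | add a a' ha ha' => simp only [map_add, ha, ha']
  | tmul a f => rw [poly_d_tmul, polyDeriv_tmul, polyDeriv_tmul, poly_d_tmul]

theorem polyDeriv_one (A : CDGA.{u}) : A.polyDeriv 0 A.poly.one = 0 :=
  (A.polyDeriv_tmul A.one 1).trans (by rw [Polynomial.derivative_one, TensorProduct.tmul_zero]; rfl)

theorem neg_one_zpow_add (p q : ℤ) : (-1 : ℚ) ^ (p + q) = (-1) ^ p * (-1) ^ q :=
  zpow_add₀ (by norm_num) p q

theorem neg_one_zpow_sub_one (p : ℤ) : (-1 : ℚ) ^ (p - 1) = -(-1) ^ p := by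
  rw [zpow_sub₀ (by norm_num)]; simp [div_neg]

theorem neg_one_zpow_mul_self (p : ℤ) : (-1 : ℚ) ^ p * (-1) ^ p = 1 := by
  rw [← mul_zpow]; simp

/-- The CDGA `A ⊗ Λ(t, dt)` of polynomial differential forms on the interval with coefficients
in `A`. The algebra `Λ(t, dt)` is `ℚ[t]` in degree `0`, `ℚ[t] dt` in degree `1` and zero elsewhere,
and the pair `(x, y)` stands for the element `x + y dt`. -/
def path (A : CDGA.{u}) : CDGA.{u} where
  X n := A.poly.X n × A.poly.X (n - 1)
  one := (A.poly.one, 0)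
  mul {p q n} h := LinearMap.mk₂ ℚ
    (fun x y => (A.poly.mul h x.1 y.1, A.poly.mul (by omega) x.1 y.2 +
      (-1 : ℚ) ^ q • A.poly.mul (by omega) x.2 y.1))
    (fun x x' y => by ext <;> simp; abel)
    (fun c x y => by ext <;> simp [smul_comm c])
    (fun x y y' => by ext <;> simp; abel)
    (fun c x y => by ext <;> simp [smul_comm c])
  d {p q} h :=
    { toFun := fun x => (A.poly.d h x.1, A.poly.d (by omega) x.2 +
        (-1 : ℚ) ^ p • A.poly.cast (show p = q - 1 by omega) (A.polyDeriv p x.1))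
      map_add' := fun x y => by ext <;> simp; abel
      map_smul' := fun c x => by ext <;> simp [smul_comm c] }
  eq_zero_of_neg h a := Prod.ext (A.poly.eq_zero_of_neg h _) (A.poly.eq_zero_of_neg (by omega) _)
  one_mul {p} a := by
    refine Prod.ext (A.poly.one_mul a.1) ?_
    have : A.poly.mul (by omega) (0 : A.poly.X (0 - 1)) a.1 = (0 : A.poly.X (p - 1)) := by simp
    simp only [LinearMap.mk₂_apply]
    rw [this, smul_zero, add_zero]
    exact A.poly.one_mul a.2
  mul_assoc {p q r pq qr n} h₁ h₂ h₃ h₄ a b c := by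
    refine Prod.ext (A.poly.mul_assoc _ _ _ _ _ _ _) ?_
    simp only [LinearMap.mk₂_apply, map_add, LinearMap.add_apply, map_smul, LinearMap.smul_apply]
    rw [A.poly.mul_assoc h₁ _ (show q + (r - 1) = qr - 1 by omega) (by omega) a.1 b.1 c.2,
      A.poly.mul_assoc _ _ (show (q - 1) + r = qr - 1 by omega) (by omega) a.1 b.2 c.1,
      A.poly.mul_assoc _ _ h₃ (show (p - 1) + qr = n - 1 by omega) a.2 b.1 c.1]
    subst h₃
    rw [neg_one_zpow_add, smul_add, smul_smul, _root_.mul_comm ((-1 : ℚ) ^ r), add_assoc]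
  mul_comm {p q n} h h' a b := by
    refine Prod.ext (A.poly.mul_comm _ _ _ _) ?_
    simp only [LinearMap.mk₂_apply, Prod.smul_snd]
    rw [A.poly.mul_comm _ (show q - 1 + p = n - 1 by omega) a.1 b.2,
      A.poly.mul_comm _ (show q + (p - 1) = n - 1 by omega) a.2 b.1, smul_add, smul_smul, smul_smul,
      add_comm]
    have e1 : (-1 : ℚ) ^ q * (-1) ^ ((p - 1) * q) = (-1) ^ (p * q) := by
      rw [← neg_one_zpow_add]; congr 1; ring
    have e2 : (-1 : ℚ) ^ (p * (q - 1)) = (-1) ^ (p * q) * (-1) ^ p := by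
      rw [show p * q = p * (q - 1) + p by ring, neg_one_zpow_add, _root_.mul_assoc,
        neg_one_zpow_mul_self, _root_.mul_one]
    rw [e1, e2]
  d_d {p q r} h h' a := by
    refine Prod.ext (A.poly.d_d _ _ _) ?_
    simp only [LinearMap.coe_mk, AddHom.coe_mk, map_add, map_smul]
    rw [A.poly.d_d, A.poly.d_cast _ _ h (by omega), polyDeriv_d,
      show (-1 : ℚ) ^ q = -(-1) ^ p by rw [← h, neg_one_zpow_add]; simp]
    simp
  leibniz {p q n p' q' n'} h hp hq hn h₁ h₂ a b := by
    refine Prod.ext (A.poly.leibniz _ _ _ _ _ _ _ _) ?_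
    simp only [LinearMap.coe_mk, AddHom.coe_mk, LinearMap.mk₂_apply, map_add, map_smul,
      Prod.snd_add, Prod.smul_snd, LinearMap.add_apply, LinearMap.smul_apply, smul_add]
    rw [A.poly.leibniz _ hp (show q - 1 + 1 = q' - 1 by omega) _ (show p' + (q - 1) = n' - 1 by omega)
        (show p + (q' - 1) = n' - 1 by omega) a.1 b.2,
      A.poly.leibniz _ (show p - 1 + 1 = p' - 1 by omega) hq _ (show p' - 1 + q = n' - 1 by omega)
        (show (p - 1) + q' = n' - 1 by omega) a.2 b.1, polyDeriv_mul, map_add,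
      A.poly.cast_mul_left _ _ h (show n = n' - 1 by omega),
      A.poly.cast_mul_right _ _ h (show n = n' - 1 by omega),
      neg_one_zpow_sub_one, show (-1 : ℚ) ^ n = (-1) ^ p * (-1) ^ q by rw [← h, neg_one_zpow_add],
      show (-1 : ℚ) ^ q' = -(-1) ^ q by rw [← hq, neg_one_zpow_add]; simp]
    simp only [smul_add, smul_smul]
    module

/-- Evaluation of `t` at `c : ℚ` as a linear map `A ⊗ ℚ[t] → A`. -/
def polyEval (A : CDGA.{u}) (c : ℚ) (n : ℤ) : A.poly.X n →ₗ[ℚ] A.X n :=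
  TensorProduct.rid ℚ (A.X n) ∘ₗ (Polynomial.leval c).lTensor (A.X n)

theorem polyEval_tmul (A : CDGA.{u}) (c : ℚ) {n : ℤ} (a : A.X n) (f : ℚ[X]) :
    A.polyEval c n (a ⊗ₜ[ℚ] f : A.X n ⊗[ℚ] ℚ[X]) = f.eval c • a :=
  TensorProduct.rid_tmul _ _

/-- The augmentation `id ⊗ ε_c : A ⊗ Λ(t, dt) → A` with `t ↦ c` and `dt ↦ 0`. -/
def pathEval (A : CDGA.{u}) (c : ℚ) : A.path ⟶ A where
  f n := A.polyEval c n ∘ₗ LinearMap.fst ℚ _ _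
  map_one := (A.polyEval_tmul c A.one 1).trans (by simp)
  map_mul {p q n} h a b := by
    change A.polyEval c n (A.poly.mul h a.1 b.1) =
      A.mul h (A.polyEval c p a.1) (A.polyEval c q b.1)
    induction a.1 using poly_induction with
    | zero => simp
    | add a a' ha ha' => simp only [map_add, LinearMap.add_apply, ha, ha']
    | tmul a f =>
      induction b.1 using poly_induction with
      | zero => simp
      | add b b' hb hb' => simp only [map_add, hb, hb']
      | tmul b g =>
        rw [poly_mul_tmul, polyEval_tmul, polyEval_tmul, polyEval_tmul]
        simp [smul_smul, _root_.mul_comm]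
  map_d {p q} h a := by
    change A.polyEval c q (A.poly.d h a.1) = A.d h (A.polyEval c p a.1)
    induction a.1 using poly_induction with
    | zero => simp
    | add a a' ha ha' => simp only [map_add, ha, ha']
    | tmul a f => rw [poly_d_tmul, polyEval_tmul, polyEval_tmul, map_smul]

/-- The functional `∫₀¹ : ℚ[t] → ℚ`, `t ^ k ↦ 1 / (k + 1)`. -/
def integral : ℚ[X] →ₗ[ℚ] ℚ :=
  Polynomial.lsum fun k => (1 / ((k : ℚ) + 1)) • LinearMap.id

theorem integral_derivative (f : ℚ[X]) :
    integral (Polynomial.derivative f) = f.eval 1 - f.eval 0 := by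
  induction f using Polynomial.induction_on' with
  | add f g hf hg => simp only [map_add, hf, hg, Polynomial.eval_add]; ring
  | monomial k a =>
    rcases k with _ | k
    · simp
    · rw [Polynomial.derivative_monomial]
      simp [integral]
      field_simp

/-- The linear map `id ⊗ ∫₀¹ : A ⊗ ℚ[t] → A`. -/
def polyIntegral (A : CDGA.{u}) (n : ℤ) : A.poly.X n →ₗ[ℚ] A.X n :=
  TensorProduct.rid ℚ (A.X n) ∘ₗ integral.lTensor (A.X n)

theorem polyIntegral_tmul (A : CDGA.{u}) {n : ℤ} (a : A.X n) (f : ℚ[X]) :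
    A.polyIntegral n (a ⊗ₜ[ℚ] f : A.X n ⊗[ℚ] ℚ[X]) = integral f • a :=
  TensorProduct.rid_tmul _ _

theorem polyIntegral_deriv (A : CDGA.{u}) {n : ℤ} (a : A.poly.X n) :
    A.polyIntegral n (A.polyDeriv n a) = A.polyEval 1 n a - A.polyEval 0 n a := by
  induction a using poly_induction with
  | zero => simp
  | add a a' ha ha' => simp only [map_add, ha, ha']; abel
  | tmul a f =>
    rw [polyDeriv_tmul, polyIntegral_tmul, polyEval_tmul, polyEval_tmul, integral_derivative,
      sub_smul]

theorem polyIntegral_cast (A : CDGA.{u}) {p q : ℤ} (e : p = q) (a : A.poly.X p) :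
    A.polyIntegral q (A.poly.cast e a) = A.cast e (A.polyIntegral p a) := by
  subst e; rfl

theorem polyIntegral_d (A : CDGA.{u}) {p q : ℤ} (h : p + 1 = q) (a : A.poly.X p) :
    A.polyIntegral q (A.poly.d h a) = A.d h (A.polyIntegral p a) := by
  induction a using poly_induction with
  | zero => simp
  | add a a' ha ha' => simp only [map_add, ha, ha']
  | tmul a f => rw [poly_d_tmul, polyIntegral_tmul, polyIntegral_tmul, map_smul]

/-- Fibre integration `id ⊗ ∫₀¹ : A ⊗ Λ(t, dt) → A`, of degree `-1`, with the Koszul sign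
`(id ⊗ ∫₀¹)(a ⊗ t ^ k dt) = (-1) ^ |a| a / (k + 1)`; forms without `dt` integrate to `0`. -/
def pathIntegral (A : CDGA.{u}) {p q : ℤ} (h : p + 1 = q) : A.path.X q →ₗ[ℚ] A.X p :=
  (-1 : ℚ) ^ p • (A.cast (show q - 1 = p by omega) ∘ₗ A.polyIntegral (q - 1) ∘ₗ
    LinearMap.snd ℚ (A.poly.X q) (A.poly.X (q - 1)))

/-- Stokes' formula for fibre integration. -/
theorem pathIntegral_d (A : CDGA.{u}) {p q r : ℤ} (h : p + 1 = q) (h' : q + 1 = r)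
    (x : A.path.X q) :
    A.d h (A.pathIntegral h x) + A.pathIntegral h' (A.path.d h' x) =
      Hom.f (A.pathEval 1) q x - Hom.f (A.pathEval 0) q x := by
  change A.d h ((-1 : ℚ) ^ p • A.cast _ (A.polyIntegral (q - 1) x.2)) +
    (-1 : ℚ) ^ q • A.cast _ (A.polyIntegral (r - 1) (A.poly.d (by omega) x.2 +
      (-1 : ℚ) ^ q • A.poly.cast _ (A.polyDeriv q x.1))) =
    A.polyEval 1 q x.1 - A.polyEval 0 q x.1
  rw [map_smul, map_add, map_smul, polyIntegral_cast, polyIntegral_deriv, polyIntegral_d,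
    A.d_cast _ h (show q - 1 + 1 = r - 1 by omega) (by omega), map_add, map_smul, cast_cast,
    show (-1 : ℚ) ^ q = -(-1) ^ p by rw [← h, neg_one_zpow_add]; simp]
  rw [cast_rfl, smul_add, smul_smul, neg_mul_neg, neg_one_zpow_mul_self, one_smul, neg_smul,
    add_neg_cancel_left]

/-- A homotopy between CDGA maps `F, G : A ⟶ B`: a CDGA map `A ⟶ B ⊗ Λ(t, dt)` which restricts to
`F` at `t = 0` and to `G` at `t = 1`. -/
structure Homotopy {A B : CDGA.{u}} (F G : A ⟶ B) where
  /-- the map to the path object -/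
  map : A ⟶ B.path
  map_zero : map ≫ B.pathEval 0 = F
  map_one : map ≫ B.pathEval 1 = G

end CDGA
namespace FreeCDGA

/-- Formal CDGA expressions of degree `n` in the elements of a cochain complex. -/
inductive Expr (C : CochainComplex (ModuleCat.{u} ℚ) ℤ) : ℤ → Type u
  | of {n : ℤ} (x : C.X n) : Expr C n
  | zero (n : ℤ) : Expr C n
  | one : Expr C 0
  | add {n : ℤ} (a b : Expr C n) : Expr C n
  | smul {n : ℤ} (c : ℚ) (a : Expr C n) : Expr C n
  | mul {p q n : ℤ} (h : p + q = n) (a : Expr C p) (b : Expr C q) : Expr C n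
  | d {p q : ℤ} (h : p + 1 = q) (a : Expr C p) : Expr C q

/-- The smallest congruence on formal expressions which imposes the axioms of a CDGA and makes
`Expr.of` a cochain map. -/
inductive Rel (C : CochainComplex (ModuleCat.{u} ℚ) ℤ) : ∀ {n : ℤ}, Expr C n → Expr C n → Prop
  | refl {n : ℤ} (a : Expr C n) : Rel C a a
  | symm {n : ℤ} {a b : Expr C n} (h : Rel C a b) : Rel C b a
  | trans {n : ℤ} {a b c : Expr C n} (h : Rel C a b) (h' : Rel C b c) : Rel C a c
  | add_congr {n : ℤ} {a a' b b' : Expr C n} (h : Rel C a a') (h' : Rel C b b') :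
      Rel C (.add a b) (.add a' b')
  | smul_congr {n : ℤ} (c : ℚ) {a a' : Expr C n} (h : Rel C a a') :
      Rel C (.smul c a) (.smul c a')
  | mul_congr {p q n : ℤ} (e : p + q = n) {a a' : Expr C p} {b b' : Expr C q} (h : Rel C a a')
      (h' : Rel C b b') : Rel C (.mul e a b) (.mul e a' b')
  | d_congr {p q : ℤ} (e : p + 1 = q) {a a' : Expr C p} (h : Rel C a a') :
      Rel C (.d e a) (.d e a')
  | add_assoc {n : ℤ} (a b c : Expr C n) : Rel C (.add (.add a b) c) (.add a (.add b c))
  | add_comm {n : ℤ} (a b : Expr C n) : Rel C (.add a b) (.add b a)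
  | zero_add {n : ℤ} (a : Expr C n) : Rel C (.add (.zero n) a) a
  | neg_add {n : ℤ} (a : Expr C n) : Rel C (.add (.smul (-1) a) a) (.zero n)
  | one_smul {n : ℤ} (a : Expr C n) : Rel C (.smul 1 a) a
  | smul_smul {n : ℤ} (c c' : ℚ) (a : Expr C n) :
      Rel C (.smul (c * c') a) (.smul c (.smul c' a))
  | smul_add {n : ℤ} (c : ℚ) (a b : Expr C n) :
      Rel C (.smul c (.add a b)) (.add (.smul c a) (.smul c b))
  | add_smul {n : ℤ} (c c' : ℚ) (a : Expr C n) :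
      Rel C (.smul (c + c') a) (.add (.smul c a) (.smul c' a))
  | add_mul {p q n : ℤ} (h : p + q = n) (a a' : Expr C p) (b : Expr C q) :
      Rel C (.mul h (.add a a') b) (.add (.mul h a b) (.mul h a' b))
  | mul_add {p q n : ℤ} (h : p + q = n) (a : Expr C p) (b b' : Expr C q) :
      Rel C (.mul h a (.add b b')) (.add (.mul h a b) (.mul h a b'))
  | smul_mul {p q n : ℤ} (h : p + q = n) (c : ℚ) (a : Expr C p) (b : Expr C q) :
      Rel C (.mul h (.smul c a) b) (.smul c (.mul h a b))
  | mul_smul {p q n : ℤ} (h : p + q = n) (c : ℚ) (a : Expr C p) (b : Expr C q) :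
      Rel C (.mul h a (.smul c b)) (.smul c (.mul h a b))
  | d_add {p q : ℤ} (h : p + 1 = q) (a b : Expr C p) :
      Rel C (.d h (.add a b)) (.add (.d h a) (.d h b))
  | d_smul {p q : ℤ} (h : p + 1 = q) (c : ℚ) (a : Expr C p) :
      Rel C (.d h (.smul c a)) (.smul c (.d h a))
  | eq_zero_of_neg {n : ℤ} (h : n < 0) (a : Expr C n) : Rel C a (.zero n)
  | one_mul {p : ℤ} (h : 0 + p = p) (a : Expr C p) : Rel C (.mul h .one a) a
  | mul_assoc {p q r pq qr n : ℤ} (h₁ : p + q = pq) (h₂ : pq + r = n) (h₃ : q + r = qr)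
      (h₄ : p + qr = n) (a : Expr C p) (b : Expr C q) (c : Expr C r) :
      Rel C (.mul h₂ (.mul h₁ a b) c) (.mul h₄ a (.mul h₃ b c))
  | mul_comm {p q n : ℤ} (h : p + q = n) (h' : q + p = n) (a : Expr C p) (b : Expr C q) :
      Rel C (.mul h a b) (.smul ((-1 : ℚ) ^ (p * q)) (.mul h' b a))
  | d_d {p q r : ℤ} (h : p + 1 = q) (h' : q + 1 = r) (a : Expr C p) :
      Rel C (.d h' (.d h a)) (.zero r)
  | leibniz {p q n p' q' n' : ℤ} (h : p + q = n) (hp : p + 1 = p') (hq : q + 1 = q')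
      (hn : n + 1 = n') (h₁ : p' + q = n') (h₂ : p + q' = n') (a : Expr C p) (b : Expr C q) :
      Rel C (.d hn (.mul h a b))
        (.add (.mul h₁ (.d hp a) b) (.smul ((-1 : ℚ) ^ p) (.mul h₂ a (.d hq b))))
  | of_add {n : ℤ} (x y : C.X n) : Rel C (.of (x + y)) (.add (.of x) (.of y))
  | of_smul {n : ℤ} (c : ℚ) (x : C.X n) : Rel C (.of (c • x)) (.smul c (.of x))
  | of_d {p q : ℤ} (h : p + 1 = q) (x : C.X p) : Rel C (.of ((C.d p q).hom x)) (.d h (.of x))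

variable (C : CochainComplex (ModuleCat.{u} ℚ) ℤ)

instance setoid (n : ℤ) : Setoid (Expr C n) := ⟨Rel C, .refl, .symm, .trans⟩

/-- The degree `n` part of the free CDGA. -/
def Piece (n : ℤ) : Type u := Quotient (setoid C n)

instance (n : ℤ) : Add (Piece C n) := ⟨Quotient.map₂ .add fun _ _ h _ _ h' => .add_congr h h'⟩

instance (n : ℤ) : Zero (Piece C n) := ⟨(⟦.zero n⟧ : Quotient (setoid C n))⟩

instance (n : ℤ) : Neg (Piece C n) := ⟨Quotient.map (.smul (-1)) fun _ _ h => .smul_congr _ h⟩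

instance (n : ℤ) : SMul ℚ (Piece C n) :=
  ⟨fun c => Quotient.map (.smul c) fun _ _ h => .smul_congr c h⟩

instance (n : ℤ) : AddCommGroup (Piece C n) where
  add_assoc := by rintro ⟨a⟩ ⟨b⟩ ⟨c⟩; exact Quotient.sound (Rel.add_assoc a b c)
  add_comm := by rintro ⟨a⟩ ⟨b⟩; exact Quotient.sound (Rel.add_comm a b)
  zero_add := by rintro ⟨a⟩; exact Quotient.sound (Rel.zero_add a)
  add_zero := by rintro ⟨a⟩; exact Quotient.sound (Rel.trans (Rel.add_comm _ _) (Rel.zero_add a))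
  neg_add_cancel := by rintro ⟨a⟩; exact Quotient.sound (Rel.neg_add a)
  nsmul := nsmulRec
  zsmul := zsmulRec

instance (n : ℤ) : Module ℚ (Piece C n) :=
  Module.ofMinimalAxioms
    (by rintro c ⟨a⟩ ⟨b⟩; exact Quotient.sound (Rel.smul_add c a b))
    (by rintro c c' ⟨a⟩; exact Quotient.sound (Rel.add_smul c c' a))
    (by rintro c c' ⟨a⟩; exact Quotient.sound (Rel.smul_smul c c' a))
    (by rintro ⟨a⟩; exact Quotient.sound (Rel.one_smul a))

end FreeCDGA

/-- The free CDGA `Λ C` on a cochain complex `C`. -/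
def freeCDGA (C : CochainComplex (ModuleCat.{u} ℚ) ℤ) : CDGA.{u} where
  X := FreeCDGA.Piece C
  one := ⟦.one⟧
  mul h := LinearMap.mk₂ ℚ (Quotient.map₂ (.mul h) fun _ _ e _ _ e' => .mul_congr h e e')
    (by rintro ⟨a⟩ ⟨a'⟩ ⟨b⟩; exact Quotient.sound (FreeCDGA.Rel.add_mul h a a' b))
    (by rintro c ⟨a⟩ ⟨b⟩; exact Quotient.sound (FreeCDGA.Rel.smul_mul h c a b))
    (by rintro ⟨a⟩ ⟨b⟩ ⟨b'⟩; exact Quotient.sound (FreeCDGA.Rel.mul_add h a b b'))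
    (by rintro c ⟨a⟩ ⟨b⟩; exact Quotient.sound (FreeCDGA.Rel.mul_smul h c a b))
  d h :=
    { toFun := Quotient.map (.d h) fun _ _ e => .d_congr h e
      map_add' := by rintro ⟨a⟩ ⟨b⟩; exact Quotient.sound (FreeCDGA.Rel.d_add h a b)
      map_smul' := by rintro c ⟨a⟩; exact Quotient.sound (FreeCDGA.Rel.d_smul h c a) }
  eq_zero_of_neg h := by rintro ⟨a⟩; exact Quotient.sound (FreeCDGA.Rel.eq_zero_of_neg h a)
  one_mul := by rintro p ⟨a⟩; exact Quotient.sound (FreeCDGA.Rel.one_mul _ a)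
  mul_assoc h₁ h₂ h₃ h₄ := by
    rintro ⟨a⟩ ⟨b⟩ ⟨c⟩; exact Quotient.sound (FreeCDGA.Rel.mul_assoc h₁ h₂ h₃ h₄ a b c)
  mul_comm h h' := by rintro ⟨a⟩ ⟨b⟩; exact Quotient.sound (FreeCDGA.Rel.mul_comm h h' a b)
  d_d h h' := by rintro ⟨a⟩; exact Quotient.sound (FreeCDGA.Rel.d_d h h' a)
  leibniz h hp hq hn h₁ h₂ := by
    rintro ⟨a⟩ ⟨b⟩; exact Quotient.sound (FreeCDGA.Rel.leibniz h hp hq hn h₁ h₂ a b)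

namespace FreeCDGA

variable {C : CochainComplex (ModuleCat.{u} ℚ) ℤ} {A : CDGA.{u}}

/-- The universal cochain map `C ⟶ Λ C`. -/
def incl (C : CochainComplex (ModuleCat.{u} ℚ) ℤ) : C ⟶ CDGA.toComplex.obj (freeCDGA C) where
  f n := ModuleCat.ofHom (Y := FreeCDGA.Piece C n)
    { toFun := fun x => ⟦.of x⟧
      map_add' := fun x y => Quotient.sound (FreeCDGA.Rel.of_add x y)
      map_smul' := fun c x => Quotient.sound (FreeCDGA.Rel.of_smul c x) }
  comm' p q h := by
    obtain rfl : p + 1 = q := h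
    dsimp only [CDGA.toComplex, CochainComplex.of]
    rw [CochainComplex.of_d]
    ext x
    exact (Quotient.sound (FreeCDGA.Rel.of_d rfl x)).symm

/-- Evaluation of formal expressions in a CDGA. -/
def eval (φ : C ⟶ CDGA.toComplex.obj A) : ∀ {n : ℤ}, Expr C n → A.X n
  | n, .of x => (φ.f n).hom x
  | _, .zero _ => 0
  | _, .one => A.one
  | _, .add a b => eval φ a + eval φ b
  | _, .smul c a => c • eval φ a
  | _, .mul h a b => A.mul h (eval φ a) (eval φ b)
  | _, .d h a => A.d h (eval φ a)

theorem eval_eq (φ : C ⟶ CDGA.toComplex.obj A) {n : ℤ} {a b : Expr C n} (h : Rel C a b) :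
    eval φ a = eval φ b := by
  induction h with
  | refl => rfl
  | symm _ ih => exact ih.symm
  | trans _ _ ih ih' => exact ih.trans ih'
  | add_congr _ _ ih ih' => simp only [eval, ih, ih']
  | smul_congr _ _ ih => simp only [eval, ih]
  | mul_congr _ _ _ ih ih' => simp only [eval, ih, ih']
  | d_congr _ _ ih => simp only [eval, ih]
  | add_assoc => exact add_assoc _ _ _
  | add_comm => exact add_comm _ _
  | zero_add => exact zero_add _
  | neg_add => simp [eval]
  | one_smul => exact one_smul _ _
  | smul_smul => exact mul_smul _ _ _
  | smul_add => exact smul_add _ _ _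
  | add_smul => exact add_smul _ _ _
  | add_mul => simp [eval]
  | mul_add => simp [eval]
  | smul_mul => simp [eval]
  | mul_smul => simp [eval]
  | d_add => simp [eval]
  | d_smul => simp [eval]
  | eq_zero_of_neg h => exact A.eq_zero_of_neg h _
  | one_mul => exact A.one_mul _
  | mul_assoc h₁ h₂ h₃ h₄ => exact A.mul_assoc h₁ h₂ h₃ h₄ _ _ _
  | mul_comm h h' => exact A.mul_comm h h' _ _
  | d_d h h' => exact A.d_d h h' _
  | leibniz h hp hq hn h₁ h₂ => exact A.leibniz h hp hq hn h₁ h₂ _ _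
  | of_add => exact map_add _ _ _
  | of_smul => exact map_smul _ _ _
  | @of_d p q h x =>
    subst h
    have := φ.comm p (p + 1)
    dsimp only [CDGA.toComplex, CochainComplex.of] at this
    rw [CochainComplex.of_d] at this
    exact (LinearMap.congr_fun (congrArg ModuleCat.Hom.hom this) x).symm

/-- The CDGA map `Λ C ⟶ A` extending a cochain map `C ⟶ A`. -/
def lift (φ : C ⟶ CDGA.toComplex.obj A) : freeCDGA C ⟶ A where
  f n :=
    { toFun := Quotient.lift (eval φ) fun _ _ h => eval_eq φ h
      map_add' := by rintro ⟨a⟩ ⟨b⟩; rfl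
      map_smul' := by rintro c ⟨a⟩; rfl }
  map_one := rfl
  map_mul h := by rintro ⟨a⟩ ⟨b⟩; rfl
  map_d h := by rintro ⟨a⟩; rfl

theorem incl_lift (φ : C ⟶ CDGA.toComplex.obj A) :
    incl C ≫ CDGA.toComplex.map (lift φ) = φ := by
  ext n x; rfl

theorem hom_ext {F G : freeCDGA C ⟶ A}
    (h : incl C ≫ CDGA.toComplex.map F = incl C ≫ CDGA.toComplex.map G) : F = G := by
  apply CDGA.hom_ext
  intro n a
  obtain ⟨a, rfl⟩ := Quotient.exists_rep a
  induction a with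
  | @of n x =>
    exact LinearMap.congr_fun (congrArg (fun ψ => ModuleCat.Hom.hom (HomologicalComplex.Hom.f ψ n)) h) x
  | zero n => exact ((F.f n).map_zero).trans ((G.f n).map_zero).symm
  | one => exact F.map_one.trans G.map_one.symm
  | @add n a b ha hb =>
    have e1 := (F.f n).map_add ⟦a⟧ ⟦b⟧
    have e2 := (G.f n).map_add ⟦a⟧ ⟦b⟧
    rw [ha, hb] at e1
    exact e1.trans e2.symm
  | @smul n c a ha =>
    have e1 := (F.f n).map_smul c ⟦a⟧
    have e2 := (G.f n).map_smul c ⟦a⟧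
    rw [ha] at e1
    exact e1.trans e2.symm
  | mul h a b ha hb =>
    have e1 := F.map_mul h ⟦a⟧ ⟦b⟧
    have e2 := G.map_mul h ⟦a⟧ ⟦b⟧
    rw [ha, hb] at e1
    exact e1.trans e2.symm
  | d h a ha =>
    have e1 := F.map_d h ⟦a⟧
    have e2 := G.map_d h ⟦a⟧
    rw [ha] at e1
    exact e1.trans e2.symm

/-- The universal property of `Λ C`. -/
def homEquiv (C : CochainComplex (ModuleCat.{u} ℚ) ℤ) (A : CDGA.{u}) :
    (freeCDGA C ⟶ A) ≃ (C ⟶ CDGA.toComplex.obj A) where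
  toFun F := incl C ≫ CDGA.toComplex.map F
  invFun := lift
  left_inv _ := hom_ext (incl_lift _)
  right_inv := incl_lift

end FreeCDGA

/-- The free CDGA functor `Λ`. -/
def Lam : CochainComplex (ModuleCat.{u} ℚ) ℤ ⥤ CDGA.{u} :=
  Adjunction.leftAdjointOfEquiv FreeCDGA.homEquiv fun C A B G F =>
    show FreeCDGA.incl C ≫ CDGA.toComplex.map (F ≫ G) =
        (FreeCDGA.incl C ≫ CDGA.toComplex.map F) ≫ CDGA.toComplex.map G by
      rw [Functor.map_comp, Category.assoc]

/-- `Λ` is left adjoint to the forgetful functor to cochain complexes. -/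
def lamAdj : Lam.{u} ⊣ CDGA.toComplex.{u} := Adjunction.adjunctionOfEquivLeft _ _

/-- Cochain complexes of rational vector spaces. -/
abbrev Cplx := CochainComplex (ModuleCat.{u} ℚ) ℤ

/-- The complex with a copy of `V` in degree `k` if `P` holds, a copy of `V` in degree `k - 1` if
`Q` holds, zeros elsewhere, and the identity of `V` as differential from degree `k - 1` to `k`. -/
def cell (V : Type u) [AddCommGroup V] [Module ℚ V] (k : ℤ) (P Q : Prop) (h : Q → P) :
    Cplx.{u} :=
  CochainComplex.of (fun n => ModuleCat.of ℚ (gate V ((n = k ∧ P) ∨ (n + 1 = k ∧ Q))))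
    (fun n => if hn : n + 1 = k then
        ModuleCat.ofHom (Submodule.inclusion (gate_mono V fun hx => Or.inl ⟨hn, by
          rcases hx with hx | hx
          · exact hx.2
          · exact h hx.2⟩))
      else 0)
    (fun n => by
      by_cases hn : n + 1 = k
      · rw [dif_neg (show ¬ (n + 1 + 1 = k) by omega), comp_zero]
      · rw [dif_neg hn, zero_comp])

/-- The inclusion of cells induced by implications between the gating conditions. -/
def cellMap (V : Type u) [AddCommGroup V] [Module ℚ V] (k : ℤ) {P Q P' Q' : Prop} (h : Q → P)
    (h' : Q' → P') (hP : P → P') (hQ : Q → Q') : cell V k P Q h ⟶ cell V k P' Q' h' :=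
  CochainComplex.ofHom
    (fun n => ModuleCat.ofHom (Submodule.inclusion (gate_mono V (Or.imp (And.imp_right hP)
      (And.imp_right hQ)))))
    (fun n => by
      dsimp only [cell, CochainComplex.of]
      rw [CochainComplex.of_d, CochainComplex.of_d]
      by_cases hn : n + 1 = k
      · rw [dif_pos hn, dif_pos hn]; rfl
      · rw [dif_neg hn, dif_neg hn, zero_comp, comp_zero])

/-- The sphere `S^k(V)`: a copy of `V` in degree `k`. -/
def sphere (V : Type u) [AddCommGroup V] [Module ℚ V] (k : ℤ) : Cplx.{u} :=
  cell V k True False False.elim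

/-- The disk `D^k(V)`: copies of `V` in degrees `k - 1` and `k`, with the identity between them. -/
def disk (V : Type u) [AddCommGroup V] [Module ℚ V] (k : ℤ) : Cplx.{u} :=
  cell V k True True id

/-- The inclusion `S^k(V) ⊆ D^k(V)`. -/
def sphereToDisk (V : Type u) [AddCommGroup V] [Module ℚ V] (k : ℤ) : sphere V k ⟶ disk V k :=
  cellMap V k _ _ id False.elim

/-- A nonempty half-open interval `[birth, death)` in `[0, ∞)`, where `death` may be `∞`. -/
structure PInterval where
  /-- the left end point -/
  birth : ℝ≥0
  /-- the right end point -/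
  death : WithTop ℝ≥0
  lt : (birth : WithTop ℝ≥0) < death

namespace PInterval

variable (I : PInterval)

/-- The interval module: `ℚ` at the times in the interval, with identities as structure maps, and
zero elsewhere. -/
def intervalModule : ℝ≥0 ⥤ ModuleCat.{u} ℚ where
  obj i := ModuleCat.of ℚ (gate (ULift.{u} ℚ) (I.birth ≤ i ∧ (i : WithTop ℝ≥0) < I.death))
  map {i j} f := if h : (j : WithTop ℝ≥0) < I.death then
      ModuleCat.ofHom (Submodule.inclusion
        (gate_mono _ fun hx => ⟨hx.1.trans (leOfHom f), h⟩))
    else 0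
  map_id i := by
    by_cases h : (i : WithTop ℝ≥0) < I.death
    · rw [dif_pos h]; rfl
    · rw [dif_neg h]
      ext x
      exact (congrArg ULift.down (x.2.resolve_left fun hx => h hx.2)).symm
  map_comp {i j l} f g := by
    by_cases h : (l : WithTop ℝ≥0) < I.death
    · have h' : (j : WithTop ℝ≥0) < I.death :=
        lt_of_le_of_lt (WithTop.coe_le_coe.2 (leOfHom g)) h
      rw [dif_pos h, dif_pos h, dif_pos h']; rfl
    · rw [dif_neg h, dif_neg h, comp_zero]

/-- The interval sphere `𝕊^k_I`: it is `0` before the birth of `I`, the sphere `S^k` at the times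
in `I`, and the disk `D^k` from the death of `I` on. -/
def sphere (k : ℤ) : ℝ≥0 ⥤ Cplx.{u} where
  obj i := cell (ULift.{u} ℚ) k (I.birth ≤ i) (I.death ≤ i)
    fun h => WithTop.coe_le_coe.1 (I.lt.le.trans h)
  map f := cellMap _ _ _ _ (fun h => h.trans (leOfHom f))
    (fun h => h.trans (WithTop.coe_le_coe.2 (leOfHom f)))

/-- The persistent disk `𝔻^k` born at the birth of `I`: it is `0` before and `D^k` afterwards. -/
def disk (k : ℤ) : ℝ≥0 ⥤ Cplx.{u} where
  obj i := cell (ULift.{u} ℚ) k (I.birth ≤ i) (I.birth ≤ i) id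
  map f := cellMap _ _ _ _ (fun h => h.trans (leOfHom f)) (fun h => h.trans (leOfHom f))

/-- The inclusion of the interval sphere into the persistent disk. -/
def sphereToDisk (k : ℤ) : I.sphere k ⟶ I.disk.{u} k where
  app i := cellMap _ k (fun h => WithTop.coe_le_coe.1 (I.lt.le.trans h)) id id
    fun h => WithTop.coe_le_coe.1 (I.lt.le.trans h)

end PInterval

/-- A decomposition of a persistence module as a direct sum of interval modules. -/
structure IntervalDecomposition (V : ℝ≥0 ⥤ ModuleCat.{u} ℚ) where
  /-- the index set of the summands -/
  Γ : Type u
  /-- the intervals -/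
  I : Γ → PInterval
  /-- the isomorphism with the direct sum -/
  iso : V ≅ ∐ fun γ => (I γ).intervalModule

namespace IntervalDecomposition

variable {V : ℝ≥0 ⥤ ModuleCat.{u} ℚ} (D : IntervalDecomposition V)

/-- The persistent sphere `𝕊^k(V)`, the direct sum of the interval spheres of the summands. -/
def sphere (k : ℤ) : ℝ≥0 ⥤ Cplx.{u} := ∐ fun γ => (D.I γ).sphere k

/-- The persistent disk `𝔻^k(V)`, the direct sum of the persistent disks of the summands. -/
def disk (k : ℤ) : ℝ≥0 ⥤ Cplx.{u} := ∐ fun γ => (D.I γ).disk k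

/-- The inclusion `𝕊^k(V) ⊆ 𝔻^k(V)`. -/
def sphereToDisk (k : ℤ) : D.sphere k ⟶ D.disk k :=
  Limits.Sigma.map fun γ => (D.I γ).sphereToDisk k

end IntervalDecomposition

/-- `F : A ⟶ B` is a Hirsch extension of degree `k`: a pushout of `Λ S(V) ⟶ Λ D(V)` for a
vector space `V` placed in degree `k + 1`. -/
def IsHirschExtension {A B : CDGA.{u}} (F : A ⟶ B) (k : ℕ) : Prop :=
  ∃ (V : ModuleCat.{u} ℚ) (f : Lam.obj (sphere V (k + 1)) ⟶ A) (g : Lam.obj (disk V (k + 1)) ⟶ B),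
    IsPushout f (Lam.map (sphereToDisk V (k + 1))) F g

/-- `F : A ⟶ B` is a persistent Hirsch extension of degree `k` along an interval-decomposed
persistence module `V`: a pushout of `Λ 𝕊^{k+1}(V) ⟶ Λ 𝔻^{k+1}(V)`. -/
def IsPersistentHirschExtension {A B : ℝ≥0 ⥤ CDGA.{u}} (F : A ⟶ B) (k : ℕ)
    {V : ℝ≥0 ⥤ ModuleCat.{u} ℚ} (D : IntervalDecomposition V) : Prop :=
  ∃ (f : D.sphere (k + 1) ⋙ Lam ⟶ A) (g : D.disk (k + 1) ⋙ Lam ⟶ B),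
    IsPushout f (Functor.whiskerRight (D.sphereToDisk (k + 1)) Lam) F g

/-- `M` is a `k`-minimal algebra: there is a sequence `ℚ = M₀ ⟶ M₁ ⟶ ⋯ ⟶ M_k = M` in which
`M_{j-1} ⟶ M_j` is a Hirsch extension of degree `j`. -/
def IsMinimalAlgebra : ℕ → CDGA.{u} → Prop
  | 0, M => Nonempty (M ≅ CDGA.rat)
  | k + 1, M => ∃ (N : CDGA.{u}) (F : N ⟶ M), IsMinimalAlgebra k N ∧ IsHirschExtension F (k + 1)

/-- The map induced by a CDGA map in cohomology of degree `j`. -/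
def cohomologyMap {A B : CDGA.{u}} (F : A ⟶ B) (j : ℤ) :
    (CDGA.toComplex.obj A).homology j ⟶ (CDGA.toComplex.obj B).homology j :=
  HomologicalComplex.homologyMap (CDGA.toComplex.map F) j

/-- `m : M ⟶ A` is a `k`-minimal model: `M` is a `k`-minimal algebra and `m` induces isomorphisms
in cohomology of degrees `≤ k` and an injection in degree `k + 1`. -/
structure IsMinimalModel (k : ℕ) {M A : CDGA.{u}} (m : M ⟶ A) : Prop where
  isMinimalAlgebra : IsMinimalAlgebra k M
  isIso : ∀ j : ℤ, j ≤ k → IsIso (cohomologyMap m j)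
  mono : Mono (cohomologyMap m (k + 1))

/-- `A` is simply-connected: the unit induces `ℚ ≅ H⁰(A)`, and `H¹(A) = 0`. -/
structure CDGA.IsSimplyConnected (A : CDGA.{u}) : Prop where
  isIso_unit : IsIso (cohomologyMap A.unit 0)
  isZero_one : IsZero ((CDGA.toComplex.obj A).homology 1)

/-- The sequence `t` discretizes `X`: structure maps which do not cross any `tᵢ` are
isomorphisms. -/
def Discretizes {C : Type*} [Category C] {n : ℕ} (t : Fin (n + 1) ↪o ℝ≥0) (X : ℝ≥0 ⥤ C) : Prop :=
  ∀ (s s' : ℝ≥0) (h : s ≤ s'), (∀ i, ¬ (s < t i ∧ t i ≤ s')) → IsIso (X.map (homOfLE h))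

namespace StepExtension

variable {C : Type*} [Category C] {n : ℕ}

/-- The last index `r` with `t_r ≤ x`, or `⊥` if `x < t_0`. -/
def index (t : Fin (n + 1) ↪o ℝ≥0) (x : ℝ≥0) : WithBot (Fin (n + 1)) :=
  (Finset.univ.filter fun r => t r ≤ x).max

theorem index_mono (t : Fin (n + 1) ↪o ℝ≥0) : Monotone (index t) := fun _ _ h =>
  Finset.max_mono (Finset.monotone_filter_right _ fun _ _ hr => hr.trans h)

/-- A finite sequence preceded by a given object. -/
def obj (F : ComposableArrows C n) (E : C) : WithBot (Fin (n + 1)) → C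
  | ⊥ => E
  | (r : Fin (n + 1)) => F.obj r

/-- The structure maps of a finite sequence preceded by an initial object. -/
def map (F : ComposableArrows C n) {E : C} (hE : IsInitial E) :
    ∀ {a b : WithBot (Fin (n + 1))}, a ≤ b → (obj F E a ⟶ obj F E b)
  | ⊥, _, _ => hE.to _
  | (r : Fin (n + 1)), (r' : Fin (n + 1)), h => F.map (homOfLE (WithBot.coe_le_coe.1 h))
  | (r : Fin (n + 1)), ⊥, h => absurd h (WithBot.not_coe_le_bot r)

theorem map_self (F : ComposableArrows C n) {E : C} (hE : IsInitial E)
    (a : WithBot (Fin (n + 1))) : map F hE (le_refl a) = 𝟙 _ := by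
  rcases a with _ | r
  · exact hE.hom_ext _ _
  · exact F.map_id r

theorem map_trans (F : ComposableArrows C n) {E : C} (hE : IsInitial E)
    {a b c : WithBot (Fin (n + 1))} (h : a ≤ b) (h' : b ≤ c) :
    map F hE (h.trans h') = map F hE h ≫ map F hE h' := by
  rcases a with _ | r
  · exact hE.hom_ext _ _
  · rcases b with _ | r'
    · exact absurd h (WithBot.not_coe_le_bot r)
    · rcases c with _ | r''
      · exact absurd h' (WithBot.not_coe_le_bot r')
      · exact F.map_comp (homOfLE (WithBot.coe_le_coe.1 h)) (homOfLE (WithBot.coe_le_coe.1 h'))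

/-- The components of the map between step extensions induced by a map of sequences. -/
def homApp {F G : ComposableArrows C n} (φ : F ⟶ G) (E : C) :
    ∀ a : WithBot (Fin (n + 1)), obj F E a ⟶ obj G E a
  | ⊥ => 𝟙 E
  | (r : Fin (n + 1)) => φ.app r

theorem homApp_naturality {F G : ComposableArrows C n} (φ : F ⟶ G) {E : C} (hE : IsInitial E)
    {a b : WithBot (Fin (n + 1))} (h : a ≤ b) :
    map F hE h ≫ homApp φ E b = homApp φ E a ≫ map G hE h := by
  rcases a with _ | r
  · exact hE.hom_ext _ _
  · rcases b with _ | r'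
    · exact absurd h (WithBot.not_coe_le_bot r)
    · exact φ.naturality _

end StepExtension

/-- The left Kan extension of a finite sequence `F₀ ⟶ ⋯ ⟶ F_n` along `t₀ < ⋯ < t_n` in `[0, ∞)`:
its value at `x` is `F_r` for the last `r` with `t_r ≤ x`, and the initial object if `x < t₀`. -/
def stepExtension {C : Type*} [Category C] {n : ℕ} (t : Fin (n + 1) ↪o ℝ≥0)
    (F : ComposableArrows C n) {E : C} (hE : IsInitial E) : ℝ≥0 ⥤ C where
  obj x := StepExtension.obj F E (StepExtension.index t x)
  map f := StepExtension.map F hE (StepExtension.index_mono t (leOfHom f))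
  map_id _ := StepExtension.map_self F hE _
  map_comp _ _ := StepExtension.map_trans F hE _ _

/-- The functoriality of `stepExtension` in the sequence. -/
def stepExtensionMap {C : Type*} [Category C] {n : ℕ} (t : Fin (n + 1) ↪o ℝ≥0)
    {F G : ComposableArrows C n} (φ : F ⟶ G) {E : C} (hE : IsInitial E) :
    stepExtension t F hE ⟶ stepExtension t G hE where
  app x := StepExtension.homApp φ E (StepExtension.index t x)
  naturality _ _ _ := StepExtension.homApp_naturality φ hE _

/-- The mapping cone of (the cochain map underlying) a CDGA map `m : M ⟶ A`, with components
`M^{n+1} × A^n` and differential `d (v, a) = (d v, m v - d a)`. -/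
def cone {M A : CDGA.{u}} (m : M ⟶ A) : Cplx.{u} :=
  CochainComplex.of (fun n => ModuleCat.of ℚ (M.X (n + 1) × A.X n))
    (fun n => ModuleCat.ofHom (((M.d rfl) ∘ₗ LinearMap.fst ℚ _ _).prod
      (CDGA.Hom.f m (n + 1) ∘ₗ LinearMap.fst ℚ _ _ - A.d rfl ∘ₗ LinearMap.snd ℚ _ _)))
    (fun n => by
      refine ModuleCat.hom_ext (LinearMap.ext fun x => Prod.ext ?_ ?_)
      · exact M.d_d _ _ _
      · change CDGA.Hom.f m _ (M.d rfl x.1) - A.d rfl (CDGA.Hom.f m _ x.1 - A.d rfl x.2) = 0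
        rw [map_sub, A.d_d, CDGA.Hom.map_d]
        simp)

/-- The cochain map `(v, a) ↦ (u v, w a + ∫₀¹ H v)` between mapping cones induced by a square of
CDGA maps and a homotopy `H` from `w ∘ m` to `m' ∘ u`. -/
def coneMap {M A M' A' : CDGA.{u}} {m : M ⟶ A} {m' : M' ⟶ A'} (u : M ⟶ M') (w : A ⟶ A')
    (H : CDGA.Homotopy (m ≫ w) (u ≫ m')) : cone m ⟶ cone m' :=
  CochainComplex.ofHom
    (fun n => ModuleCat.ofHom (X := M.X (n + 1) × A.X n) (Y := M'.X (n + 1) × A'.X n)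
      ((CDGA.Hom.f u (n + 1) ∘ₗ LinearMap.fst ℚ _ _).prod
        (CDGA.Hom.f w n ∘ₗ LinearMap.snd ℚ _ _ +
          A'.pathIntegral rfl ∘ₗ CDGA.Hom.f H.map (n + 1) ∘ₗ LinearMap.fst ℚ _ _)))
    (fun n => by
      dsimp only [cone, CochainComplex.of]
      rw [CochainComplex.of_d, CochainComplex.of_d]
      refine ModuleCat.hom_ext (LinearMap.ext fun x => Prod.ext ?_ ?_)
      · exact (CDGA.Hom.map_d u rfl x.1).symm
      · change CDGA.Hom.f m' _ (CDGA.Hom.f u _ x.1) - A'.d rfl (CDGA.Hom.f w n x.2 +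
            A'.pathIntegral rfl (CDGA.Hom.f H.map (n + 1) x.1)) =
          CDGA.Hom.f w (n + 1) (CDGA.Hom.f m _ x.1 - A.d rfl x.2) +
            A'.pathIntegral rfl (CDGA.Hom.f H.map (n + 1 + 1) (M.d rfl x.1))
        have h0 : CDGA.Hom.f (A'.pathEval 0) _ (CDGA.Hom.f H.map (n + 1) x.1) =
            CDGA.Hom.f w _ (CDGA.Hom.f m _ x.1) :=
          LinearMap.congr_fun (congrFun (congrArg CDGA.Hom.f H.map_zero) (n + 1)) x.1
        have h1 : CDGA.Hom.f (A'.pathEval 1) _ (CDGA.Hom.f H.map (n + 1) x.1) =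
            CDGA.Hom.f m' _ (CDGA.Hom.f u _ x.1) :=
          LinearMap.congr_fun (congrFun (congrArg CDGA.Hom.f H.map_one) (n + 1)) x.1
        have := A'.pathIntegral_d (p := n) rfl (r := n + 1 + 1) rfl
          (CDGA.Hom.f H.map (n + 1) x.1)
        rw [h0, h1] at this
        rw [CDGA.Hom.map_d, map_add, map_sub, CDGA.Hom.map_d w, ← sub_add_cancel
          (CDGA.Hom.f m' _ (CDGA.Hom.f u _ x.1)) (CDGA.Hom.f w _ (CDGA.Hom.f m _ x.1)), ← this]
        abel)

/-- A tame `k`-minimal model `m : 𝕄 →₂ 𝔸` of a persistent CDGA, relative to a discretization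
`t₀ < ⋯ < t_n`: a sequence `𝕄(0) ⟶ ⋯ ⟶ 𝕄(n)` of CDGAs with `k`-minimal models
`m(r) : 𝕄(r) ⟶ 𝔸(t_r)` and homotopies `H(r)` filling the squares between neighbouring indices. -/
structure TameMinimalModel {n : ℕ} (t : Fin (n + 1) ↪o ℝ≥0) (A : ℝ≥0 ⥤ CDGA.{u}) (k : ℕ) where
  /-- the sequence of `k`-minimal algebras -/
  M : ComposableArrows CDGA.{u} n
  /-- the maps -/
  m : ∀ r : Fin (n + 1), M.obj r ⟶ A.obj (t r)
  isMinimalModel : ∀ r, IsMinimalModel k (m r)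
  /-- the homotopies between neighbouring indices -/
  H : ∀ r : Fin n, CDGA.Homotopy
    (m r.castSucc ≫ A.map (homOfLE (t.monotone r.castSucc_le_succ)))
    (M.map (homOfLE r.castSucc_le_succ) ≫ m r.succ)

namespace TameMinimalModel

variable {n : ℕ} {t : Fin (n + 1) ↪o ℝ≥0} {A : ℝ≥0 ⥤ CDGA.{u}} {k : ℕ}

/-- The persistent CDGA `𝕄`. -/
def persistent (m : TameMinimalModel t A k) : ℝ≥0 ⥤ CDGA.{u} :=
  stepExtension t m.M CDGA.isInitialRat

/-- The tame cone `ℂ_m`: the left Kan extension of the sequence of mapping cones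
`C_{m(0)} ⟶ ⋯ ⟶ C_{m(n)}` along the discretization. -/
def tameCone (m : TameMinimalModel t A k) : ℝ≥0 ⥤ Cplx.{u} :=
  stepExtension t
    (ComposableArrows.mkOfObjOfMapSucc (fun r => cone (m.m r)) fun r => coneMap _ _ (m.H r))
    (isZero_zero Cplx.{u}).isInitial

/-- The persistence module `H^j ℂ_m`. -/
def coneCohomology (m : TameMinimalModel t A k) (j : ℤ) : ℝ≥0 ⥤ ModuleCat.{u} ℚ :=
  m.tameCone ⋙ HomologicalComplex.homologyFunctor _ _ j

/-- An extension of a tame minimal model `m` to a tame minimal model `m'` (for the same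
discretization): maps `𝕄(r) ⟶ 𝕄'(r)` commuting with the structure maps, such that the maps and
homotopies of `m'` restrict to those of `m`. -/
structure Extension {l : ℕ} (m : TameMinimalModel t A k) (m' : TameMinimalModel t A l) where
  /-- the map of sequences -/
  incl : m.M ⟶ m'.M
  comp_m : ∀ r, incl.app r ≫ m'.m r = m.m r
  comp_H : ∀ r : Fin n, incl.app r.castSucc ≫ (m'.H r).map = (m.H r).map

/-- The map of persistent CDGAs `𝕄 ⟶ 𝕄'` underlying an extension. -/
def Extension.persistent {l : ℕ} {m : TameMinimalModel t A k} {m' : TameMinimalModel t A l}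
    (e : m.Extension m') : m.persistent ⟶ m'.persistent :=
  stepExtensionMap t e.incl CDGA.isInitialRat

end TameMinimalModel

end

/-! Work first at one index `r`. A cocycle of degree `k` in the cone of `m(r) : M → A` is a pair
`(v, a)` with `dv = 0` and `m v = da`, and `H^k` of the cone is an extension of the kernel of
`H^{k+1}(M) → H^{k+1}(A)` by the cokernel of `H^k(M) → H^k(A)`. For a `(k-1)`-minimal `m(r)` these
are the only two defects left to repair. Adjoining to `M`, for each member of a basis of `H^k` of
the cone, a generator of degree `k` with differential `v` and image `a` removes both at once
(`HirschData.isMinimalModel_lift`). This rests on a computation in low degrees: simple connectivity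
of `A` gives `M^0 = ℚ` and `M^1 = 0`, so through degree `k + 1` the extension is just `M` plus the
space of new generators (`mem_range_genIncl`, `genIncl_injective`).

To do this for all `r` at once, take the generator of a summand `[p, q)` of `H^k ℂ_m`. The ends `p`
and `q` are forced to be discretization points (or `q = ∞`). Represent the generator by a cone
cocycle at its birth and push that cocycle forward along the cone maps. At each index the cocycles
of the summands then alive represent a basis. At the death index the class vanishes, so `(v, a) =
(dw, m w - db)` for some `(w, b)`. The structure maps of the new sequence send a generator to itself
while its summand lives and to `w` from its death on.

The homotopies extend because the cone maps contain the fibre integral. On a living generator one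
needs a primitive of the closed element `H(v)` of the path object which equals the image of `a` at
`t = 0`. The antiderivative in `t` provides one, and its value at `t = 1` is the image of `a` plus
`∫₀¹ H(v)`, which is exactly the second component of the transported cocycle. At a death the
prescribed end value is `m w`, which differs by `db`, and adding `d(t b)` corrects this
(`CDGA.exists_path_primitive`, `TameGenerators.exists_homotopy`).

The square is a pushout because it is one at every time `x`: a map out of the extended algebra is a
map `α` out of the old one together with, for each summand already born, an element `y` with `dy = α
v`, subject to `y = α w` if the summand is dead. A map out of the persistent disks compatible with
`α` on the interval spheres is the same data (`TameGenerators.isPersistentHirschExtension`).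

Finally, `H^k ℂ_m` is determined by a finite sequence of vector spaces, of arbitrary dimension. Such
a sequence splits into intervals: for each birth `b` and last living index `d`, choose a complement
in `W_b` of what was born earlier or dies earlier, among the elements dead after `d`
(`FinitePersistence.fresh`). These complements assemble to each `W_r`. -/

noncomputable section

/-! ### Cohomology classes as cocycles modulo coboundaries -/

namespace Cocycle

variable {K L : Cplx.{u}}

/-- The cocycles in the kernel of the differential, as elements of the object of cycles. -/
def toCycles (K : Cplx.{u}) {i j : ℤ} (h : i + 1 = j) :
    LinearMap.ker (K.d i j).hom →ₗ[ℚ] K.cycles i :=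
  (K.liftCycles (ModuleCat.ofHom (LinearMap.ker (K.d i j).hom).subtype) j
    (by simp [← h]) (by ext x; exact x.2)).hom

theorem iCycles_toCycles {i j : ℤ} (h : i + 1 = j) (x : LinearMap.ker (K.d i j).hom) :
    (K.iCycles i).hom (toCycles K h x) = x.1 :=
  congrArg (fun f => f.hom x) (K.liftCycles_i (ModuleCat.ofHom
    (LinearMap.ker (K.d i j).hom).subtype) j (by simp [← h]) (by ext x; exact x.2))

theorem iCycles_injective (K : Cplx.{u}) (i : ℤ) : Function.Injective (K.iCycles i).hom :=
  (ModuleCat.mono_iff_injective (K.iCycles i)).1 inferInstance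

theorem homologyπ_surjective (K : Cplx.{u}) (i : ℤ) : Function.Surjective (K.homologyπ i).hom :=
  (ModuleCat.epi_iff_surjective (K.homologyπ i)).1 inferInstance

/-- The linear map which sends a cocycle to its cohomology class. -/
def cls (K : Cplx.{u}) {i j : ℤ} (h : i + 1 = j) :
    LinearMap.ker (K.d i j).hom →ₗ[ℚ] K.homology i :=
  (K.homologyπ i).hom ∘ₗ toCycles K h

theorem cls_surjective {i j : ℤ} (h : i + 1 = j) : Function.Surjective (cls K h) := by
  intro c
  obtain ⟨z, rfl⟩ := homologyπ_surjective K i c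
  have hz : (K.d i j).hom ((K.iCycles i).hom z) = 0 :=
    congrArg (fun f => f.hom z) (K.iCycles_d i j)
  refine ⟨⟨(K.iCycles i).hom z, hz⟩, ?_⟩
  exact congrArg (K.homologyπ i).hom (iCycles_injective K i (iCycles_toCycles h _))

/-- Homology is the cokernel of the map from degree `p` to the cycles, so the kernel of the
projection is the image of that map. -/
theorem cls_eq_zero_iff {p i j : ℤ} (h : i + 1 = j) (h' : p + 1 = i)
    (x : LinearMap.ker (K.d i j).hom) :
    cls K h x = 0 ↔ ∃ y : K.X p, (K.d p i).hom y = x.1 := by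
  have hp : (ComplexShape.up ℤ).prev i = p := by simp [← h']
  have hex : (ShortComplex.mk (K.toCycles p i) (K.homologyπ i) (by simp)).Exact :=
    ShortComplex.exact_of_g_is_cokernel _ (K.homologyIsCokernel p i hp)
  rw [ShortComplex.moduleCat_exact_iff] at hex
  have hi (y : K.X p) : (K.iCycles i).hom ((K.toCycles p i).hom y) = (K.d p i).hom y :=
    congrArg (fun f => f.hom y) (K.toCycles_i p i)
  constructor
  · intro hx
    obtain ⟨y, hy⟩ := hex (toCycles K h x) hx
    exact ⟨y, ((hi y).symm.trans (congrArg (K.iCycles i).hom hy)).trans (iCycles_toCycles h x)⟩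
  · rintro ⟨y, hy⟩
    have : toCycles K h x = (K.toCycles p i).hom y :=
      iCycles_injective K i ((iCycles_toCycles h x).trans (hy.symm.trans (hi y).symm))
    exact (congrArg (K.homologyπ i).hom this).trans
      (congrArg (fun f => f.hom y) (K.toCycles_comp_homologyπ p i))

theorem map_mem_ker (φ : K ⟶ L) {i j : ℤ} {x : K.X i} (hx : (K.d i j).hom x = 0) :
    (L.d i j).hom ((φ.f i).hom x) = 0 := by
  have : (L.d i j).hom ((φ.f i).hom x) = (φ.f j).hom ((K.d i j).hom x) :=
    congrArg (fun f => f.hom x) (φ.comm i j)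
  rw [this, hx, map_zero]

theorem homologyMap_cls (φ : K ⟶ L) {i j : ℤ} (h : i + 1 = j) (x : LinearMap.ker (K.d i j).hom) :
    (HomologicalComplex.homologyMap φ i).hom (cls K h x) =
      cls L h ⟨(φ.f i).hom x.1, map_mem_ker φ x.2⟩ := by
  have h1 : (HomologicalComplex.homologyMap φ i).hom (cls K h x) =
      (L.homologyπ i).hom ((HomologicalComplex.cyclesMap φ i).hom (toCycles K h x)) :=
    congrArg (fun f => f.hom (toCycles K h x)) (HomologicalComplex.homologyπ_naturality φ i)
  have h2 : (L.iCycles i).hom ((HomologicalComplex.cyclesMap φ i).hom (toCycles K h x)) =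
      (φ.f i).hom ((K.iCycles i).hom (toCycles K h x)) :=
    congrArg (fun f => f.hom (toCycles K h x)) (HomologicalComplex.cyclesMap_i φ i)
  rw [h1]
  refine congrArg (L.homologyπ i).hom (iCycles_injective L i ?_)
  rw [h2, iCycles_toCycles, iCycles_toCycles]

end Cocycle

/-! ### Criteria in terms of elements for maps on cohomology -/

namespace CDGA

theorem toComplex_d_hom (A : CDGA.{u}) {i j : ℤ} (h : i + 1 = j) (x : A.X i) :
    ((toComplex.obj A).d i j).hom x = A.d h x := by
  subst h
  dsimp only [toComplex, CochainComplex.of]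
  rw [CochainComplex.of_d]
  rfl

variable {A B : CDGA.{u}}

/-- Together with the surjective version this turns minimality into statements about elements, with
the neighbouring degrees as free variables. -/
theorem homologyMap_injective_iff (F : A ⟶ B) {p i j : ℤ} (h : p + 1 = i) (h' : i + 1 = j) :
    Mono (cohomologyMap F i) ↔ ∀ (a : A.X i) (b : B.X p), A.d h' a = 0 → Hom.f F i a = B.d h b →
      ∃ c : A.X p, a = A.d h c := by
  rw [ModuleCat.mono_iff_injective]
  constructor
  · intro H a b ha hb
    let x : LinearMap.ker ((toComplex.obj A).d i j).hom := ⟨a, (toComplex_d_hom A h' a).trans ha⟩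
    have h0 : Cocycle.cls (toComplex.obj A) h' x = 0 := by
      apply H
      refine Eq.trans ?_ (map_zero _).symm
      refine (Cocycle.homologyMap_cls _ h' x).trans ?_
      rw [Cocycle.cls_eq_zero_iff h' h]
      exact ⟨b, (toComplex_d_hom B h b).trans hb.symm⟩
    rw [Cocycle.cls_eq_zero_iff h' h] at h0
    obtain ⟨c, hc⟩ := h0
    exact ⟨c, hc.symm.trans (toComplex_d_hom A h c)⟩
  · intro H
    refine (injective_iff_map_eq_zero (cohomologyMap F i).hom).2 ?_
    intro x hx
    obtain ⟨⟨a, ha⟩, rfl⟩ := Cocycle.cls_surjective h' x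
    have h1 := (Cocycle.homologyMap_cls (toComplex.map F) h' ⟨a, ha⟩).symm.trans hx
    rw [Cocycle.cls_eq_zero_iff h' h] at h1 ⊢
    obtain ⟨b, hb⟩ := h1
    obtain ⟨c, hc⟩ := H a b ((toComplex_d_hom A h' a).symm.trans ha)
      (hb.symm.trans (toComplex_d_hom B h b))
    exact ⟨c, (toComplex_d_hom A h c).trans hc.symm⟩

theorem homologyMap_surjective_iff (F : A ⟶ B) {p i j : ℤ} (h : p + 1 = i) (h' : i + 1 = j) :
    Function.Surjective (cohomologyMap F i).hom ↔ ∀ b : B.X i, B.d h' b = 0 →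
      ∃ (a : A.X i) (c : B.X p), A.d h' a = 0 ∧ b = Hom.f F i a + B.d h c := by
  constructor
  · intro H b hb
    let y : LinearMap.ker ((toComplex.obj B).d i j).hom := ⟨b, (toComplex_d_hom B h' b).trans hb⟩
    obtain ⟨x, hx⟩ := H (Cocycle.cls _ h' y)
    obtain ⟨a, rfl⟩ := Cocycle.cls_surjective h' x
    have h1 := (Cocycle.homologyMap_cls (toComplex.map F) h' a).symm.trans hx
    rw [eq_comm, ← sub_eq_zero, ← map_sub, Cocycle.cls_eq_zero_iff h' h] at h1
    obtain ⟨c, hc⟩ := h1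
    obtain ⟨a, ha⟩ := a
    refine ⟨a, c, (toComplex_d_hom A h' a).symm.trans ha, ?_⟩
    have hd : ∀ e : B.X i, ((toComplex.obj B).d p i).hom c = e → e = B.d h c := fun e he =>
      he.symm.trans (toComplex_d_hom B h c)
    have := hd (b - Hom.f F i a) hc
    rw [← this, add_sub_cancel]
  · intro H y
    obtain ⟨⟨b, hb⟩, rfl⟩ := Cocycle.cls_surjective h' y
    obtain ⟨a, c, ha, hc⟩ := H b ((toComplex_d_hom B h' b).symm.trans hb)
    refine ⟨Cocycle.cls _ h' ⟨a, (toComplex_d_hom A h' a).trans ha⟩, ?_⟩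
    refine (Cocycle.homologyMap_cls (toComplex.map F) h' _).trans ?_
    rw [eq_comm, ← sub_eq_zero, ← map_sub, Cocycle.cls_eq_zero_iff h' h]
    have e : ∀ e : B.X i, e = Hom.f F i a + B.d h c → B.d h c = e - Hom.f F i a := by
      rintro e rfl; rw [add_sub_cancel_left]
    exact ⟨c, (toComplex_d_hom B h c).trans (e b hc)⟩

theorem isIso_cohomologyMap_iff (F : A ⟶ B) {p i j : ℤ} (h : p + 1 = i) (h' : i + 1 = j) :
    IsIso (cohomologyMap F i) ↔
      (∀ (a : A.X i) (b : B.X p), A.d h' a = 0 → Hom.f F i a = B.d h b →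
        ∃ c : A.X p, a = A.d h c) ∧
      ∀ b : B.X i, B.d h' b = 0 →
        ∃ (a : A.X i) (c : B.X p), A.d h' a = 0 ∧ b = Hom.f F i a + B.d h c := by
  rw [← homologyMap_injective_iff, ← homologyMap_surjective_iff, isIso_iff_mono_and_epi,
    ModuleCat.epi_iff_surjective]

end CDGA

/-! ### The cone differential and gated spaces -/

section Cone

variable {M A : CDGA.{u}}

theorem cone_d_hom (m : M ⟶ A) {i j : ℤ} (h : i + 1 = j) (x : M.X (i + 1) × A.X i) :
    ((cone m).d i j).hom x = ((M.d (by omega) x.1 : M.X (j + 1)),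
      CDGA.Hom.f m j (M.cast h x.1) - A.d h x.2) := by
  subst h
  dsimp only [cone, CochainComplex.of]
  rw [CochainComplex.of_d]
  rfl

end Cone

section Gate

variable {V : Type u} [AddCommGroup V] [Module ℚ V] {W : Type*} [AddCommGroup W] [Module ℚ W]

open Classical in
/-- The linear map out of `gate V P` given by a linear map out of `V` which is only defined if `P`
holds. -/
def gateMap (P : Prop) (g : P → (V →ₗ[ℚ] W)) : gate V P →ₗ[ℚ] W :=
  if h : P then g h ∘ₗ (gate V P).subtype else 0

theorem gateMap_apply {P : Prop} (g : P → (V →ₗ[ℚ] W)) (h : P) (x : gate V P) :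
    gateMap P g x = g h x.1 := by
  rw [gateMap, dif_pos h]; rfl

/-- The inclusion into `gate V P` if `P` holds. -/
def gateMk {P : Prop} (h : P) : V →ₗ[ℚ] gate V P where
  toFun v := ⟨v, Or.inl h⟩
  map_add' _ _ := rfl
  map_smul' _ _ := rfl

theorem gate_eq_zero {P : Prop} (h : ¬ P) (x : gate V P) : x = 0 :=
  Subtype.ext (x.2.resolve_left h)

end Gate

/-! ### Differential graded ideals and quotients -/

namespace CDGA

/-- A differential graded ideal. -/
structure DGIdeal (A : CDGA.{u}) where
  /-- the graded pieces -/
  I : ∀ n, Submodule ℚ (A.X n)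
  mul_mem : ∀ {p q n : ℤ} (h : p + q = n) (a : A.X p) {b : A.X q}, b ∈ I q → A.mul h a b ∈ I n
  d_mem : ∀ {p q : ℤ} (h : p + 1 = q) {a : A.X p}, a ∈ I p → A.d h a ∈ I q

namespace DGIdeal

variable {A : CDGA.{u}} (J : DGIdeal A)

theorem mul_mem_right {p q n : ℤ} (h : p + q = n) {a : A.X p} (ha : a ∈ J.I p) (b : A.X q) :
    A.mul h a b ∈ J.I n := by
  rw [A.mul_comm h ((add_comm q p).trans h)]
  exact Submodule.smul_mem _ _ (J.mul_mem _ _ ha)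

/-- The quotient of a CDGA by a differential graded ideal. -/
def quotient : CDGA.{u} where
  X n := A.X n ⧸ J.I n
  one := Submodule.Quotient.mk A.one
  mul {p q n} h := (J.I p).liftQ
    { toFun := fun a => (J.I q).mapQ (J.I n) (A.mul h a) fun _ hb => J.mul_mem h a hb
      map_add' := fun a a' => by
        refine LinearMap.ext ?_
        rintro ⟨b⟩
        exact congrArg Submodule.Quotient.mk (by rw [map_add]; rfl)
      map_smul' := fun c a => by
        refine LinearMap.ext ?_
        rintro ⟨b⟩
        exact congrArg Submodule.Quotient.mk (by rw [map_smul]; rfl) }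
    fun a ha => by
      refine LinearMap.ext ?_
      rintro ⟨b⟩
      exact (Submodule.Quotient.mk_eq_zero _).2 (J.mul_mem_right h ha b)
  d {p q} h := (J.I p).mapQ (J.I q) (A.d h) fun _ ha => J.d_mem h ha
  eq_zero_of_neg h := by
    rintro ⟨a⟩; exact congrArg Submodule.Quotient.mk (A.eq_zero_of_neg h a)
  one_mul := by rintro p ⟨a⟩; exact congrArg Submodule.Quotient.mk (A.one_mul a)
  mul_assoc h₁ h₂ h₃ h₄ := by
    rintro ⟨a⟩ ⟨b⟩ ⟨c⟩; exact congrArg Submodule.Quotient.mk (A.mul_assoc h₁ h₂ h₃ h₄ a b c)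
  mul_comm h h' := by
    rintro ⟨a⟩ ⟨b⟩; exact congrArg Submodule.Quotient.mk (A.mul_comm h h' a b)
  d_d h h' := by rintro ⟨a⟩; exact congrArg Submodule.Quotient.mk (A.d_d h h' a)
  leibniz h hp hq hn h₁ h₂ := by
    rintro ⟨a⟩ ⟨b⟩; exact congrArg Submodule.Quotient.mk (A.leibniz h hp hq hn h₁ h₂ a b)

/-- The projection to the quotient. -/
def proj : A ⟶ J.quotient where
  f n := (J.I n).mkQ
  map_one := rfl
  map_mul _ _ _ := rfl
  map_d _ _ := rfl

theorem proj_surjective (n : ℤ) : Function.Surjective (Hom.f J.proj n) :=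
  Submodule.mkQ_surjective _

theorem proj_eq_zero_iff {n : ℤ} {a : A.X n} : Hom.f J.proj n a = 0 ↔ a ∈ J.I n :=
  Submodule.Quotient.mk_eq_zero _

/-- The universal property of the quotient. -/
def desc {B : CDGA.{u}} (F : A ⟶ B) (h : ∀ n, ∀ a ∈ J.I n, Hom.f F n a = 0) : J.quotient ⟶ B where
  f n := (J.I n).liftQ (Hom.f F n) (h n)
  map_one := F.map_one
  map_mul e := by rintro ⟨a⟩ ⟨b⟩; exact Hom.map_mul F e a b
  map_d e := by rintro ⟨a⟩; exact Hom.map_d F e a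

/-- The differential graded ideal generated by a family of elements. -/
def span (R : ∀ n, Set (A.X n)) : DGIdeal A where
  I n :=
    -- An intersection of kernels of CDGA maps: closure under products and `d` is immediate, and
    -- membership already says that every map killing the relations descends.
    { carrier := {a | ∀ (B : CDGA.{u}) (F : A ⟶ B), (∀ i, ∀ r ∈ R i, Hom.f F i r = 0) →
        Hom.f F n a = 0}
      add_mem' := fun ha hb B F hF => by rw [map_add, ha B F hF, hb B F hF, add_zero]
      zero_mem' := fun B F _ => map_zero _
      smul_mem' := fun c a ha B F hF => by rw [map_smul, ha B F hF, smul_zero] }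
  mul_mem h a b hb B F hF := by rw [Hom.map_mul, hb B F hF, map_zero]
  d_mem h a ha B F hF := by rw [Hom.map_d, ha B F hF, map_zero]

theorem subset_span (R : ∀ n, Set (A.X n)) {n : ℤ} {a : A.X n} (ha : a ∈ R n) :
    a ∈ (span R).I n := fun _ _ hF => hF n a ha

end DGIdeal

end CDGA

/-! ### Hirsch extensions by generators and relations -/

/-- The data of a Hirsch extension: a linear map from a vector space `V` to the cocycles of degree
`k + 1` of a CDGA `N`. -/
structure HirschData (N : CDGA.{u}) (k : ℤ) (V : Type u) [AddCommGroup V] [Module ℚ V] where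
  /-- the differentials of the new generators -/
  f : V →ₗ[ℚ] N.X (k + 1)
  d_f : ∀ {q : ℤ} (h : k + 1 + 1 = q) (v : V), N.d h (f v) = 0

namespace HirschData

variable {N B : CDGA.{u}} {k : ℤ} {V : Type u} [AddCommGroup V] [Module ℚ V] (h : HirschData N k V)

/-- The differentials of the generators, in an arbitrary degree. -/
def df {n n' : ℤ} (e : n + 1 = n') : gate V (n = k) →ₗ[ℚ] N.X n' :=
  gateMap (n = k) fun hn => N.cast (by omega) ∘ₗ h.f

theorem df_self {n' : ℤ} (e : k + 1 = n') (v : gate V (k = k)) :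
    h.df e v = N.cast e (h.f v.1) := gateMap_apply _ rfl v

theorem d_df {n n' n'' : ℤ} (e : n + 1 = n') (e' : n' + 1 = n'') (v : gate V (n = k)) :
    N.d e' (h.df e v) = 0 := by
  by_cases hn : n = k
  · subst hn
    subst e
    rw [h.df_self]
    exact h.d_f e' _
  · rw [gate_eq_zero hn v, map_zero, map_zero]

theorem map_df (α : N ⟶ B) (y : V →ₗ[ℚ] B.X k)
    (hy : ∀ v, B.d rfl (y v) = CDGA.Hom.f α _ (h.f v)) {n n' : ℤ} (e : n + 1 = n')
    (v : gate V (n = k)) : CDGA.Hom.f α n' (h.df e v) =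
      B.d e (gateMap (n = k) (fun hn => B.cast hn.symm ∘ₗ y) v) := by
  by_cases hn : n = k
  · subst hn
    subst e
    rw [h.df_self, gateMap_apply _ rfl v]
    exact (hy _).symm
  · rw [gate_eq_zero hn v, map_zero, map_zero, map_zero, map_zero]

/-- The complex of algebra generators of a Hirsch extension. -/
def gens : Cplx.{u} :=
  CochainComplex.of (fun n => ModuleCat.of ℚ (N.X n × gate V (n = k)))
    (fun n => ModuleCat.ofHom (LinearMap.prod (N.d rfl ∘ₗ LinearMap.fst ℚ _ _ +
      h.df rfl ∘ₗ LinearMap.snd ℚ _ _) 0))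
    (fun n => by
      refine ModuleCat.hom_ext (LinearMap.ext fun x => Prod.ext ?_ rfl)
      change N.d rfl (N.d rfl x.1 + h.df rfl x.2) + h.df rfl 0 = 0
      rw [map_add, N.d_d, h.d_df, map_zero, add_zero, add_zero])

theorem gens_d {n n' : ℤ} (e : n + 1 = n') (x : N.X n × gate V (n = k)) :
    ((gens h).d n n').hom x = (N.d e x.1 + h.df e x.2, (0 : gate V (n' = k))) := by
  subst e
  dsimp only [gens, CochainComplex.of]
  rw [CochainComplex.of_d]
  rfl

/-- The generators as elements of the free CDGA. -/
def freeIncl (n : ℤ) : N.X n × gate V (n = k) →ₗ[ℚ] (freeCDGA (gens h)).X n :=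
  ((FreeCDGA.incl (gens h)).f n).hom

theorem d_freeIncl {n n' : ℤ} (e : n + 1 = n') (x : N.X n × gate V (n = k)) :
    (freeCDGA (gens h)).d e (h.freeIncl n x) = h.freeIncl n' (N.d e x.1 + h.df e x.2, 0) := by
  rw [← h.gens_d e x]
  have h1 := congrArg (fun g => g.hom x) ((FreeCDGA.incl (gens h)).comm n n')
  exact (CDGA.toComplex_d_hom _ e _).symm.trans h1

/-- The relations which make the inclusion of `N` multiplicative. -/
inductive Rel : ∀ n : ℤ, (freeCDGA (gens h)).X n → Prop
  | one : Rel 0 (h.freeIncl 0 (N.one, 0) - (freeCDGA (gens h)).one)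
  | mul {p q n : ℤ} (e : p + q = n) (a : N.X p) (b : N.X q) :
      Rel n (h.freeIncl n (N.mul e a b, 0) -
        (freeCDGA (gens h)).mul e (h.freeIncl p (a, 0)) (h.freeIncl q (b, 0)))

/-- The ideal generated by the relations. -/
def relIdeal : CDGA.DGIdeal (freeCDGA (gens h)) := CDGA.DGIdeal.span fun n => {x | Rel h n x}

/-- The Hirsch extension `N ⊗ Λ V` with `d v = f v`. -/
def ext : CDGA.{u} := (relIdeal h).quotient

/-- The classes of the generators. -/
def genIncl (n : ℤ) : N.X n × gate V (n = k) →ₗ[ℚ] h.ext.X n :=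
  CDGA.Hom.f (relIdeal h).proj n ∘ₗ h.freeIncl n

theorem d_genIncl {n n' : ℤ} (e : n + 1 = n') (x : N.X n × gate V (n = k)) :
    h.ext.d e (h.genIncl n x) = h.genIncl n' (N.d e x.1 + h.df e x.2, 0) :=
  (CDGA.Hom.map_d (relIdeal h).proj e _).symm.trans (congrArg _ (h.d_freeIncl e x))

/-- The inclusion of `N`. -/
def incl : N ⟶ h.ext where
  f n := h.genIncl n ∘ₗ LinearMap.inl ℚ _ _
  map_one := by
    have := (relIdeal h).proj_eq_zero_iff.2 (CDGA.DGIdeal.subset_span _ (Rel.one (h := h)))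
    rw [map_sub, sub_eq_zero] at this
    exact this
  map_mul e a b := by
    have := (relIdeal h).proj_eq_zero_iff.2 (CDGA.DGIdeal.subset_span _ (Rel.mul (h := h) e a b))
    rw [map_sub, sub_eq_zero] at this
    exact this
  map_d e a := by
    refine Eq.trans ?_ (h.d_genIncl e (a, 0)).symm
    rw [map_zero, add_zero]
    rfl

/-- The new generators. -/
def gen : V →ₗ[ℚ] h.ext.X k :=
  h.genIncl k ∘ₗ LinearMap.inr ℚ _ _ ∘ₗ gateMk rfl

theorem d_gen {n : ℤ} (e : k + 1 = n) (v : V) :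
    h.ext.d e (h.gen v) = CDGA.Hom.f h.incl n (N.cast e (h.f v)) := by
  refine (h.d_genIncl e (0, gateMk rfl v)).trans ?_
  rw [h.df_self]
  dsimp only
  rw [map_zero, zero_add]
  rfl

theorem genIncl_eq {n : ℤ} (x : N.X n × gate V (n = k)) : h.genIncl n x =
    CDGA.Hom.f h.incl n x.1 + gateMap (n = k) (fun hn => h.ext.cast hn.symm ∘ₗ h.gen) x.2 := by
  obtain ⟨a, v⟩ := x
  have : h.genIncl n (a, v) = h.genIncl n (a, 0) + h.genIncl n (0, v) := by
    rw [← map_add]; simp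
  rw [this]
  change CDGA.Hom.f h.incl n a + _ = _
  congr 1
  by_cases hn : n = k
  · subst hn
    exact (gateMap_apply (fun hn : n = n => h.ext.cast hn.symm ∘ₗ h.gen) rfl v).symm
  · rw [gate_eq_zero hn v, map_zero]
    exact map_zero _

/-- Every element of a Hirsch extension is generated by `N` and the new generators. -/
theorem induction {P : ∀ n : ℤ, h.ext.X n → Prop} (incl : ∀ n a, P n (CDGA.Hom.f h.incl n a))
    (gen : ∀ v, P k (h.gen v)) (add : ∀ n a b, P n a → P n b → P n (a + b))
    (smul : ∀ n (c : ℚ) a, P n a → P n (c • a))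
    (mul : ∀ {p q n : ℤ} (e : p + q = n) a b, P p a → P q b → P n (h.ext.mul e a b))
    (d : ∀ {p q : ℤ} (e : p + 1 = q) a, P p a → P q (h.ext.d e a)) {n : ℤ} (a : h.ext.X n) :
    P n a := by
  obtain ⟨a, rfl⟩ := (relIdeal h).proj_surjective n a
  obtain ⟨a, rfl⟩ := Quotient.exists_rep a
  have h0 : ∀ n, P n 0 := fun n => by simpa using incl n 0
  induction a with
  | @of n x =>
    change N.X n × gate V (n = k) at x
    change P n (h.genIncl n x)
    rw [genIncl_eq]
    refine add _ _ _ (incl _ _) ?_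
    by_cases hn : n = k
    · subst hn
      rw [gateMap_apply _ rfl]
      exact gen _
    · rw [gate_eq_zero hn x.2, map_zero]
      exact h0 _
  | zero n => exact h0 n
  | one =>
    have := incl 0 N.one
    rwa [CDGA.Hom.map_one] at this
  | add a b ha hb => exact add _ _ _ ha hb
  | smul c a ha => exact smul _ c _ ha
  | mul e a b ha hb => exact mul e _ _ ha hb
  | d e a ha => exact d e _ ha

theorem hom_ext {F G : h.ext ⟶ B} (h₁ : h.incl ≫ F = h.incl ≫ G)
    (h₂ : ∀ v, CDGA.Hom.f F k (h.gen v) = CDGA.Hom.f G k (h.gen v)) : F = G := by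
  apply CDGA.hom_ext
  intro n a
  induction a using h.induction with
  | incl n a => exact LinearMap.congr_fun (congrFun (congrArg CDGA.Hom.f h₁) n) a
  | gen v => exact h₂ v
  | add n a b ha hb => rw [map_add, map_add, ha, hb]
  | smul n c a ha => rw [map_smul, map_smul, ha]
  | mul e a b ha hb => rw [CDGA.Hom.map_mul, CDGA.Hom.map_mul, ha, hb]
  | d e a ha => rw [CDGA.Hom.map_d, CDGA.Hom.map_d, ha]

section Lift

variable (α : N ⟶ B) (y : V →ₗ[ℚ] B.X k)

/-- The components of the cochain map which defines `HirschData.lift`. -/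
def gensLin (n : ℤ) : N.X n × gate V (n = k) →ₗ[ℚ] B.X n :=
  CDGA.Hom.f α n ∘ₗ LinearMap.fst ℚ _ _ +
    gateMap (n = k) (fun hn => B.cast hn.symm ∘ₗ y) ∘ₗ LinearMap.snd ℚ _ _

theorem d_gensLin (hy : ∀ v, B.d rfl (y v) = CDGA.Hom.f α _ (h.f v))
    {n n' : ℤ} (e : n + 1 = n') (x : N.X n × gate V (n = k)) :
    B.d e (gensLin α y n x) = gensLin α y n' (N.d e x.1 + h.df e x.2, 0) := by
  change B.d e (CDGA.Hom.f α n x.1 + gateMap (n = k) (fun hn => B.cast hn.symm ∘ₗ y) x.2) =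
    CDGA.Hom.f α n' (N.d e x.1 + h.df e x.2) +
      gateMap (n' = k) (fun hn => B.cast hn.symm ∘ₗ y) 0
  rw [map_zero, add_zero, map_add, map_add, h.map_df α y hy, CDGA.Hom.map_d]

/-- The cochain map which defines `HirschData.lift`. -/
def gensMap (hy : ∀ v, B.d rfl (y v) = CDGA.Hom.f α _ (h.f v)) :
    gens h ⟶ CDGA.toComplex.obj B where
  f n := ModuleCat.ofHom (X := N.X n × gate V (n = k)) (Y := B.X n) (gensLin α y n)
  comm' n n' e := by
    have e : n + 1 = n' := e
    refine ModuleCat.hom_ext (LinearMap.ext fun (x : N.X n × gate V (n = k)) => ?_)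
    exact (CDGA.toComplex_d_hom B e _).trans ((h.d_gensLin α y hy e x).trans
      (congrArg (fun z : N.X n' × gate V (n' = k) => gensLin α y n' z) (h.gens_d e x)).symm)

theorem lift_gensMap_freeIncl (hy : ∀ v, B.d rfl (y v) = CDGA.Hom.f α _ (h.f v))
    {n : ℤ} (a : N.X n) (v : gate V (n = k)) :
    CDGA.Hom.f (FreeCDGA.lift (h.gensMap α y hy)) n (h.freeIncl n (a, v)) =
      CDGA.Hom.f α n a + gateMap (n = k) (fun hn => B.cast hn.symm ∘ₗ y) v := rfl

/-- The universal property of a Hirsch extension. -/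
def lift (hy : ∀ v, B.d rfl (y v) = CDGA.Hom.f α _ (h.f v)) : h.ext ⟶ B :=
  (relIdeal h).desc (FreeCDGA.lift (h.gensMap α y hy)) fun n a ha => ha _ _ fun i r hr => by
    cases hr with
    | one =>
      rw [map_sub, lift_gensMap_freeIncl, map_zero, add_zero, CDGA.Hom.map_one, CDGA.Hom.map_one,
        sub_self]
    | mul e a b =>
      rw [map_sub, CDGA.Hom.map_mul, lift_gensMap_freeIncl, lift_gensMap_freeIncl,
        lift_gensMap_freeIncl, map_zero, add_zero, map_zero, add_zero, map_zero, add_zero,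
        CDGA.Hom.map_mul, sub_self]

theorem lift_incl (hy : ∀ v, B.d rfl (y v) = CDGA.Hom.f α _ (h.f v))
    (n : ℤ) (a : N.X n) :
    CDGA.Hom.f (h.lift α y hy) n (CDGA.Hom.f h.incl n a) = CDGA.Hom.f α n a := by
  refine (h.lift_gensMap_freeIncl α y hy a 0).trans ?_
  rw [map_zero, add_zero]

theorem incl_comp_lift (hy : ∀ v, B.d rfl (y v) = CDGA.Hom.f α _ (h.f v)) :
    h.incl ≫ h.lift α y hy = α :=
  CDGA.hom_ext fun n a => h.lift_incl α y hy n a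

theorem incl_comp_lift_assoc (hy : ∀ v, B.d rfl (y v) = CDGA.Hom.f α _ (h.f v)) {C : CDGA.{u}}
    (β : B ⟶ C) : h.incl ≫ h.lift α y hy ≫ β = α ≫ β := by
  rw [← Category.assoc, incl_comp_lift]

theorem lift_gen (hy : ∀ v, B.d rfl (y v) = CDGA.Hom.f α _ (h.f v))
    (v : V) : CDGA.Hom.f (h.lift α y hy) k (h.gen v) = y v := by
  refine (h.lift_gensMap_freeIncl α y hy 0 ⟨v, Or.inl rfl⟩).trans ?_
  rw [map_zero, zero_add, gateMap_apply _ rfl]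
  rfl

end Lift

end HirschData

/-! ### Hirsch extensions in low degrees -/

namespace CDGA

/-- A CDGA is connected if its part of degree `0` is spanned by the unit. -/
def IsConnected (N : CDGA.{u}) : Prop := ∀ a : N.X 0, ∃ c : ℚ, a = c • N.one

theorem IsConnected.mul_eq_smul {N : CDGA.{u}} {p q : ℤ} (e : p + 0 = q) (b : N.X p) (c : ℚ) :
    N.mul e b (c • N.one) = c • N.cast (by omega) b := by
  obtain rfl : p = q := by omega
  rw [map_smul, N.mul_one, cast_rfl]

theorem IsConnected.smul_mul {N : CDGA.{u}} {p q : ℤ} (e : 0 + p = q) (b : N.X p) (c : ℚ) :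
    N.mul e (c • N.one) b = c • N.cast (by omega) b := by
  obtain rfl : p = q := by omega
  rw [map_smul, LinearMap.smul_apply, N.one_mul, cast_rfl]

end CDGA

namespace HirschData

variable {N : CDGA.{u}} {k : ℤ} {V : Type u} [AddCommGroup V] [Module ℚ V] (h : HirschData N k V)

theorem cast_genIncl {p q : ℤ} (e : p = q) (x : N.X p × gate V (p = k)) :
    h.ext.cast e (h.genIncl p x) ∈ LinearMap.range (h.genIncl q) := by
  subst e
  exact ⟨x, rfl⟩

theorem mul_genIncl {p q n : ℤ} (e : p + q = n) (a : N.X p) (b : N.X q) :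
    h.ext.mul e (h.genIncl p (a, 0)) (h.genIncl q (b, 0)) ∈ LinearMap.range (h.genIncl n) :=
  ⟨(N.mul e a b, 0), CDGA.Hom.map_mul h.incl e a b⟩

theorem genIncl_of_ne {n : ℤ} (hn : n ≠ k) (a : N.X n) (v : gate V (n = k)) :
    h.genIncl n (a, v) = h.genIncl n (a, 0) := by
  rw [gate_eq_zero hn v]

/-- In low degrees, a Hirsch extension is spanned by `N` and the new generators. -/
theorem mem_range_genIncl (hk : 1 ≤ k) (hN : N.IsConnected) {b : ℤ}
    (hb : b ≤ k ∨ b ≤ k + 1 ∧ (∀ a : N.X 1, a = 0) ∧ (2 ≤ k ∨ ∀ v : V, v = 0)) {n : ℤ}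
    (x : h.ext.X n) (hn : n ≤ b) : x ∈ LinearMap.range (h.genIncl n) := by
  revert hn
  induction x using h.induction with
  | incl n a => exact fun _ => ⟨(a, 0), rfl⟩
  | gen v => exact fun _ => ⟨(0, gateMk rfl v), rfl⟩
  | add n x y hx hy => exact fun hn => add_mem (hx hn) (hy hn)
  | smul n c x hx => exact fun hn => Submodule.smul_mem _ _ (hx hn)
  | @d p q e x hx =>
    intro hn
    obtain ⟨y, rfl⟩ := hx (by omega)
    exact ⟨_, (h.d_genIncl e y).symm⟩
  | @mul p q n e x y hx hy =>
    intro hn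
    rcases lt_or_ge p 0 with hp | hp
    · rw [h.ext.eq_zero_of_neg hp x, map_zero, LinearMap.zero_apply]; exact zero_mem _
    rcases lt_or_ge q 0 with hq | hq
    · rw [h.ext.eq_zero_of_neg hq y, map_zero]; exact zero_mem _
    obtain ⟨⟨a, v⟩, rfl⟩ := hx (by omega)
    obtain ⟨⟨a', v'⟩, rfl⟩ := hy (by omega)
    have hone (c : ℚ) : h.genIncl 0 (c • N.one, 0) = c • h.ext.one := by
      change CDGA.Hom.f h.incl 0 (c • N.one) = _
      rw [map_smul, CDGA.Hom.map_one]
    -- A factor of degree `0` is a scalar by connectedness, since `k ≥ 1` keeps new generators out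
    -- of degree `0`.
    rcases hp.eq_or_lt with hp | hp
    · subst hp
      obtain ⟨c, rfl⟩ := hN a
      rw [h.genIncl_of_ne (by omega), hone, CDGA.IsConnected.smul_mul]
      exact Submodule.smul_mem _ _ (h.cast_genIncl _ _)
    rcases hq.eq_or_lt with hq | hq
    · subst hq
      obtain ⟨c, rfl⟩ := hN a'
      rw [h.genIncl_of_ne (n := 0) (by omega), hone, CDGA.IsConnected.mul_eq_smul]
      exact Submodule.smul_mem _ _ (h.cast_genIncl _ _)
    -- Both factors now have positive degree. In total degree at most `k` each has degree below `k`
    -- and lies in `N`. In total degree `k + 1` with `k ≥ 2`, a factor of degree `1` vanishes and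
    -- otherwise both have degree below `k`. If `V = 0`, everything lies in `N`.
    rcases hb with hb | ⟨hb, hN1, hb'⟩
    · rw [h.genIncl_of_ne (by omega) a v, h.genIncl_of_ne (by omega) a' v']
      exact h.mul_genIncl e a a'
    · rcases hb' with hk2 | hV
      · have hz {i : ℤ} (hi : i = 1) (a : N.X i) (v : gate V (i = k)) :
            h.genIncl i (a, v) = 0 := by
          subst hi
          rw [h.genIncl_of_ne (by omega), hN1 a]
          exact map_zero _
        by_cases hp1 : p = 1
        · rw [hz hp1, map_zero, LinearMap.zero_apply]; exact zero_mem _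
        by_cases hq1 : q = 1
        · rw [hz hq1, map_zero]; exact zero_mem _
        rw [h.genIncl_of_ne (by omega) a v, h.genIncl_of_ne (by omega) a' v']
        exact h.mul_genIncl e a a'
      · rw [show v = 0 from Subtype.ext (hV _), show v' = 0 from Subtype.ext (hV _)]
        exact h.mul_genIncl e a a'

end HirschData

/-- An augmentation of a connected CDGA, extended by zero to all degrees. -/
structure CDGA.Aug (N : CDGA.{u}) where
  /-- the augmentation -/
  ε : ∀ n, N.X n →ₗ[ℚ] ℚ
  ε_one : ε 0 N.one = 1
  ε_eq_zero : ∀ {n : ℤ}, n ≠ 0 → ∀ a, ε n a = 0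
  eq_smul : ∀ a : N.X 0, a = ε 0 a • N.one

namespace CDGA.Aug

variable {N : CDGA.{u}} (E : N.Aug)

theorem nonempty (hN : N.IsConnected) (h1 : N.one ≠ 0) : Nonempty N.Aug := by
  obtain ⟨g, hg⟩ := (LinearMap.toSpanSingleton ℚ (N.X 0) N.one).exists_leftInverse_of_injective
    (LinearMap.ker_toSpanSingleton ℚ h1)
  have hg1 (c : ℚ) : g (c • N.one) = c := LinearMap.congr_fun hg c
  refine ⟨⟨fun n => if h : n = 0 then g ∘ₗ N.cast h else 0, ?_, ?_, ?_⟩⟩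
  · rw [dif_pos rfl]
    simpa using hg1 1
  · intro n hn a
    rw [dif_neg hn]; rfl
  · intro a
    obtain ⟨c, rfl⟩ := hN a
    rw [dif_pos rfl]
    change c • N.one = g (c • N.one) • N.one
    rw [hg1]

theorem ε_mul {p q n : ℤ} (e : p + q = n) (a : N.X p) (b : N.X q) :
    E.ε n (N.mul e a b) = E.ε p a * E.ε q b := by
  by_cases hp : p = 0
  · subst hp
    obtain rfl : q = n := by omega
    conv_lhs => rw [E.eq_smul a, map_smul, LinearMap.smul_apply, N.one_mul, map_smul]
    rfl
  · rw [E.ε_eq_zero hp, zero_mul]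
    by_cases hn : n = 0
    · rcases lt_or_gt_of_ne hp with hp | hp
      · rw [N.eq_zero_of_neg hp a, map_zero, LinearMap.zero_apply, map_zero]
      · rw [N.eq_zero_of_neg (by omega) b, map_zero, map_zero]
    · exact E.ε_eq_zero hn _

end CDGA.Aug

namespace HirschData

variable {N : CDGA.{u}} {k : ℤ} {V : Type u} [AddCommGroup V] [Module ℚ V] (h : HirschData N k V)
  (E : N.Aug)

theorem smul_mem_gate {p q n : ℤ} (e : p + q = n) (a : N.X p) (w : gate V (q = k)) :
    E.ε p a • w.1 ∈ gate V (n = k) := by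
  by_cases hp : p = 0
  · rcases w.2 with hw | hw
    · exact Or.inl (by omega)
    · exact Or.inr (by rw [hw, smul_zero])
  · exact Or.inr (by rw [E.ε_eq_zero hp, zero_smul])

theorem smul_mem_gate' {p q n : ℤ} (e : p + q = n) (v : gate V (p = k)) (b : N.X q) :
    E.ε q b • v.1 ∈ gate V (n = k) := smul_mem_gate E ((add_comm q p).trans e) b v

/-- The differential of a new generator has degree `k + 1`, so its product with `b` is zero if `b`
has degree `1`, because `N^1 = 0`, or degree at least `2`, because `N` stops at `k + 2`. Only
scalars `b` contribute. This is what makes the Leibniz rule hold in `linearPart`. -/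
theorem df_mul (hk : 1 ≤ k) (hN1 : ∀ a : N.X 1, a = 0) (htop : ∀ n, k + 2 < n → ∀ a : N.X n, a = 0)
    {p p' q n n' : ℤ} (e : p + q = n) (hp : p + 1 = p') (hn : n + 1 = n') (e' : p' + q = n')
    (v : gate V (p = k)) (b : N.X q) :
    N.mul e' (h.df hp v) b = h.df hn ⟨E.ε q b • v.1, smul_mem_gate' E e v b⟩ := by
  by_cases hpk : p = k
  swap
  · have : (⟨E.ε q b • v.1, smul_mem_gate' E e v b⟩ : gate V (n = k)) = 0 :=
      Subtype.ext (by rw [gate_eq_zero hpk v]; exact smul_zero _)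
    rw [this, gate_eq_zero hpk v, map_zero, map_zero, LinearMap.zero_apply, map_zero]
  by_cases hq : q = 0
  · subst hq hpk
    obtain rfl : p = n := by omega
    obtain rfl : p' = n' := by omega
    conv_lhs => rw [E.eq_smul b, map_smul, N.mul_one, ← map_smul]
    rfl
  · have h0 : (⟨E.ε q b • v.1, smul_mem_gate' E e v b⟩ : gate V (n = k)) = 0 :=
      Subtype.ext ((congrArg (· • v.1) (E.ε_eq_zero hq b)).trans (zero_smul _ _))
    rw [h0, map_zero]
    rcases lt_or_ge q 0 with hq0 | hq0
    · rw [N.eq_zero_of_neg hq0 b, map_zero]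
    by_cases hq1 : q = 1
    · subst hq1
      rw [hN1 b, map_zero]
    · exact htop _ (by omega) _

/-- The quotient of the Hirsch extension of `N` along `h` by all products of new generators with
elements of positive degree, for an algebra `N` which vanishes in degrees above `k + 2`. -/
def linearPart (hk : 1 ≤ k) (hN1 : ∀ a : N.X 1, a = 0)
    (htop : ∀ n, k + 2 < n → ∀ a : N.X n, a = 0) : CDGA.{u} where
  X n := N.X n × gate V (n = k)
  one := (N.one, 0)
  mul {p q n} e := LinearMap.mk₂ ℚ
    (fun x y => (N.mul e x.1 y.1, ⟨E.ε p x.1 • y.2.1 + E.ε q y.1 • x.2.1,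
      add_mem (smul_mem_gate E e x.1 y.2) (smul_mem_gate' E e x.2 y.1)⟩))
    (fun x x' y => by
      refine Prod.ext (by simp) (Subtype.ext ?_)
      simp only [Prod.fst_add, Prod.snd_add, map_add, Submodule.coe_add]
      module)
    (fun c x y => by
      refine Prod.ext (by simp) (Subtype.ext ?_)
      simp only [Prod.smul_fst, Prod.smul_snd, map_smul, Submodule.coe_smul, smul_eq_mul]
      module)
    (fun x x' y => by
      refine Prod.ext (by simp) (Subtype.ext ?_)
      simp only [Prod.fst_add, Prod.snd_add, map_add, Submodule.coe_add]
      module)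
    (fun c x y => by
      refine Prod.ext (by simp) (Subtype.ext ?_)
      simp only [Prod.smul_fst, Prod.smul_snd, map_smul, Submodule.coe_smul, smul_eq_mul]
      module)
  d {p q} e := LinearMap.prod (N.d e ∘ₗ LinearMap.fst ℚ _ _ + h.df e ∘ₗ LinearMap.snd ℚ _ _) 0
  eq_zero_of_neg hn a := Prod.ext (N.eq_zero_of_neg hn _) (gate_eq_zero (by omega) _)
  one_mul a := by
    refine Prod.ext (N.one_mul a.1) (Subtype.ext ?_)
    simp [E.ε_one]
  mul_assoc h₁ h₂ h₃ h₄ a b c := by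
    refine Prod.ext (N.mul_assoc h₁ h₂ h₃ h₄ _ _ _) (Subtype.ext ?_)
    simp only [LinearMap.mk₂_apply, E.ε_mul]
    module
  mul_comm {p q n} e e' a b := by
    refine Prod.ext (N.mul_comm e e' _ _) (Subtype.ext ?_)
    simp only [LinearMap.mk₂_apply, Prod.smul_snd, Submodule.coe_smul]
    by_cases hp : p = 0
    · subst hp
      simp [add_comm]
    by_cases hq : q = 0
    · subst hq
      simp [add_comm]
    rw [E.ε_eq_zero hp, E.ε_eq_zero hq]
    simp
  d_d e e' a := by
    refine Prod.ext ?_ rfl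
    simp [N.d_d, h.d_df]
  leibniz {p q n p' q' n'} e hp hq hn h₁ h₂ a b := by
    have h3 : q + p = n := (add_comm q p).trans e
    have h4 : q' + p = n' := (add_comm q' p).trans h₂
    -- The sign does no harm: both sides vanish unless `p = 0`.
    have key : (-1 : ℚ) ^ p • N.mul h₂ a.1 (h.df hq b.2) =
        h.df hn ⟨E.ε p a.1 • b.2.1, smul_mem_gate E e a.1 b.2⟩ := by
      rw [N.mul_comm h₂ h4, h.df_mul E hk hN1 htop h3 hq hn]
      by_cases hp0 : p = 0
      · subst hp0; simp
      · have h0 : (⟨E.ε p a.1 • b.2.1, smul_mem_gate E e a.1 b.2⟩ : gate V (n = k)) = 0 :=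
          Subtype.ext ((congrArg (· • b.2.1) (E.ε_eq_zero hp0 a.1)).trans (zero_smul _ _))
        rw [h0, map_zero, smul_zero, smul_zero]
    -- The augmentation kills boundaries, since a boundary of degree `0` comes from degree `-1`,
    -- where everything is zero.
    have hε {i i' : ℤ} (e : i + 1 = i') (x : N.X i × gate V (i = k)) :
        E.ε i' (N.d e x.1 + h.df e x.2) = 0 := by
      by_cases hi : i' = 0
      · rw [N.eq_zero_of_neg (by omega) x.1, gate_eq_zero (by omega) x.2]; simp
      · exact E.ε_eq_zero hi _
    refine Prod.ext ?_ (Subtype.ext ?_)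
    · change N.d hn (N.mul e a.1 b.1) + h.df hn (⟨E.ε p a.1 • b.2.1, smul_mem_gate E e a.1 b.2⟩ +
          ⟨E.ε q b.1 • a.2.1, smul_mem_gate' E e a.2 b.1⟩) =
        N.mul h₁ (N.d hp a.1 + h.df hp a.2) b.1 +
          (-1 : ℚ) ^ p • N.mul h₂ a.1 (N.d hq b.1 + h.df hq b.2)
      rw [map_add (h.df hn), map_add (N.mul h₁), map_add (N.mul h₂ a.1), LinearMap.add_apply,
        smul_add, key, h.df_mul E hk hN1 htop e hp hn, N.leibniz e hp hq hn h₁ h₂]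
      abel
    · change (0 : V) = (E.ε p' (N.d hp a.1 + h.df hp a.2) • b.2.1 + E.ε q b.1 • (0 : V)) +
        (-1 : ℚ) ^ p • (E.ε p a.1 • (0 : V) + E.ε q' (N.d hq b.1 + h.df hq b.2) • a.2.1)
      rw [hε, hε]
      simp

/-- The universal property gives a map from the extension to `linearPart`, whose underlying space is
`N ⊕ V`; it is a left inverse of `genIncl`. -/
theorem genIncl_injective_of_top (E : N.Aug) (hk : 1 ≤ k) (hN1 : ∀ a : N.X 1, a = 0)
    (htop : ∀ n, k + 2 < n → ∀ a : N.X n, a = 0) (n : ℤ) :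
    Function.Injective (h.genIncl n) := by
  let T := h.linearPart E hk hN1 htop
  let α : N ⟶ T :=
    { f := fun n => LinearMap.inl ℚ _ _
      map_one := rfl
      map_mul := fun {p q n} e a b => Prod.ext rfl (Subtype.ext
        (show (0 : V) = E.ε p a • (0 : V) + E.ε q b • (0 : V) by simp))
      map_d := fun e a => Prod.ext
        (show N.d e a = N.d e a + h.df e 0 by rw [map_zero, add_zero]) rfl }
  let y : V →ₗ[ℚ] T.X k := LinearMap.inr ℚ (N.X k) (gate V (k = k)) ∘ₗ gateMk rfl
  have hy : ∀ v, T.d rfl (y v) = CDGA.Hom.f α _ (h.f v) := fun v => by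
    refine Prod.ext ?_ rfl
    change N.d rfl 0 + h.df rfl (gateMk rfl v) = h.f v
    rw [map_zero, zero_add, h.df_self]
    rfl
  have hinv : ∀ x : N.X n × gate V (n = k),
      CDGA.Hom.f (h.lift α y hy) n (h.genIncl n x) = x := by
    rintro ⟨a, v⟩
    refine (h.lift_gensMap_freeIncl α y hy a v).trans ?_
    by_cases hn : n = k
    · subst hn
      rw [gateMap_apply _ rfl]
      refine Prod.ext ?_ ?_
      · exact add_zero a
      · exact zero_add v
    · rw [gate_eq_zero hn v, map_zero, add_zero]
      rfl
  exact Function.LeftInverse.injective hinv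

/-- The elements of degree above `b`. -/
def _root_.CDGA.above (N : CDGA.{u}) (b : ℤ) : CDGA.DGIdeal N where
  I n :=
    { carrier := {a | n ≤ b → a = 0}
      add_mem' := fun hx hy hn => by rw [hx hn, hy hn, add_zero]
      zero_mem' := fun _ => rfl
      smul_mem' := fun c x hx hn => by rw [hx hn, smul_zero] }
  mul_mem {p q n} e a x hx hn := by
    rcases lt_or_ge p 0 with hp | hp
    · rw [N.eq_zero_of_neg hp a, map_zero, LinearMap.zero_apply]
    · rw [hx (by omega), map_zero]
  d_mem e a ha hn := by rw [ha (by omega), map_zero]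

/-- Dividing `N` by its elements of degree above `k + 2` reduces to the truncated case and loses
nothing in degrees up to `k + 2`. The bound is used in full: closedness of elements of degree `k +
1` is tested in degree `k + 2`. -/
theorem genIncl_injective (hk : 1 ≤ k) (hN : N.IsConnected) (h1 : N.one ≠ 0)
    (hN1 : ∀ a : N.X 1, a = 0) {n : ℤ} (hn : n ≤ k + 2) : Function.Injective (h.genIncl n) := by
  let J := N.above (k + 2)
  have hJ {i : ℤ} (hi : i ≤ k + 2) {a : N.X i} (ha : CDGA.Hom.f J.proj i a = 0) : a = 0 :=
    J.proj_eq_zero_iff.1 ha hi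
  obtain ⟨E⟩ : Nonempty J.quotient.Aug := by
    refine CDGA.Aug.nonempty ?_ fun h0 => h1 (hJ (by omega) h0)
    intro a
    obtain ⟨a, rfl⟩ := J.proj_surjective 0 a
    obtain ⟨c, rfl⟩ := hN a
    exact ⟨c, rfl⟩
  let h' : HirschData J.quotient k V :=
    ⟨CDGA.Hom.f J.proj _ ∘ₗ h.f, fun e v => by
      rw [LinearMap.comp_apply, ← CDGA.Hom.map_d, h.d_f, map_zero]⟩
  have hinj := h'.genIncl_injective_of_top E hk
    (fun a => by
      obtain ⟨a, rfl⟩ := J.proj_surjective 1 a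
      rw [hN1 a, map_zero])
    (fun i hi a => by
      obtain ⟨a, rfl⟩ := J.proj_surjective i a
      exact J.proj_eq_zero_iff.2 fun h => absurd h (by omega)) n
  have hy : ∀ v, h'.ext.d rfl (h'.gen v) = CDGA.Hom.f (J.proj ≫ h'.incl) _ (h.f v) :=
    fun v => h'.d_gen rfl v
  have hmap : ∀ x : N.X n × gate V (n = k),
      CDGA.Hom.f (h.lift (J.proj ≫ h'.incl) h'.gen hy) n (h.genIncl n x) =
        h'.genIncl n (CDGA.Hom.f J.proj n x.1, x.2) := by
    rintro ⟨a, v⟩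
    rw [genIncl_eq h']
    exact h.lift_gensMap_freeIncl (J.proj ≫ h'.incl) h'.gen hy a v
  refine (injective_iff_map_eq_zero _).2 fun x hx => ?_
  have h0 := hmap x
  rw [hx, map_zero, eq_comm, ← map_zero (h'.genIncl n)] at h0
  have h2 := Prod.ext_iff.1 (hinj h0)
  exact Prod.ext (hJ hn h2.1) h2.2

end HirschData

/-! ### Pushouts along a left adjoint, and maps out of cells -/

namespace CategoryTheory.Adjunction

variable {C D : Type*} [Category C] [Category D] {L : C ⥤ D} {R : D ⥤ C}

/-- A criterion for a square out of a map in the image of a left adjoint to be a pushout. -/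
theorem isPushout_of_lift (adj : L ⊣ R) {S T : C} {N M : D} {i : S ⟶ T} {φ : S ⟶ R.obj N}
    {F : N ⟶ M} {ψ : T ⟶ R.obj M} (w : φ ≫ R.map F = i ≫ ψ)
    (hl : ∀ (B : D) (α : N ⟶ B) (β : T ⟶ R.obj B), φ ≫ R.map α = i ≫ β →
      ∃ δ : M ⟶ B, F ≫ δ = α ∧ ψ ≫ R.map δ = β)
    (hu : ∀ (B : D) (δ δ' : M ⟶ B), F ≫ δ = F ≫ δ' → ψ ≫ R.map δ = ψ ≫ R.map δ' → δ = δ') :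
    IsPushout ((adj.homEquiv _ _).symm φ) (L.map i) F ((adj.homEquiv _ _).symm ψ) := by
  have hw : (adj.homEquiv _ _).symm φ ≫ F = L.map i ≫ (adj.homEquiv _ _).symm ψ := by
    rw [← adj.homEquiv_naturality_right_symm, w, adj.homEquiv_naturality_left_symm]
  have key (s : PushoutCocone ((adj.homEquiv _ _).symm φ) (L.map i)) :
      φ ≫ R.map s.inl = i ≫ adj.homEquiv _ _ s.inr := by
    apply (adj.homEquiv _ _).symm.injective
    rw [adj.homEquiv_naturality_right_symm, adj.homEquiv_naturality_left_symm, Equiv.symm_apply_apply]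
    exact s.condition
  choose l hl using fun s => hl _ _ _ (key s)
  refine ⟨⟨hw⟩, ⟨PushoutCocone.IsColimit.mk _ l (fun s => (hl s).1) (fun s => ?_) ?_⟩⟩
  · rw [← adj.homEquiv_naturality_right_symm, (hl s).2, Equiv.symm_apply_apply]
  · intro s δ h₁ h₂
    refine hu _ _ _ (h₁.trans (hl s).1.symm) (Eq.trans ?_ (hl s).2.symm)
    rw [← h₂, adj.homEquiv_naturality_right, Equiv.apply_symm_apply]

end CategoryTheory.Adjunction

theorem Cplx.hom_congr {K L : Cplx.{u}} {φ ψ : K ⟶ L} (h : φ = ψ) (n : ℤ) (x : K.X n) :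
    (φ.f n).hom x = (ψ.f n).hom x := by rw [h]

namespace Cell

variable {V : Type u} [AddCommGroup V] [Module ℚ V] {k : ℤ} {P Q : Prop} {h : Q → P}

/-- The generators of a cell in the upper degree. -/
def top (k : ℤ) (h : Q → P) (hP : P) : V →ₗ[ℚ] (cell V (k + 1) P Q h).X (k + 1) :=
  gateMk (Or.inl ⟨rfl, hP⟩)

/-- The generators of a cell in the lower degree. -/
def bot (k : ℤ) (h : Q → P) (hQ : Q) : V →ₗ[ℚ] (cell V (k + 1) P Q h).X k :=
  gateMk (Or.inr ⟨rfl, hQ⟩)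

theorem d_bot (hQ : Q) (v : V) :
    ((cell V (k + 1) P Q h).d k (k + 1)).hom (bot k h hQ v) = top k h (h hQ) v := by
  dsimp only [cell, CochainComplex.of]
  rw [CochainComplex.of_d, dif_pos rfl]
  rfl

theorem hom_ext {K : Cplx.{u}} {φ ψ : cell V (k + 1) P Q h ⟶ K}
    (ht : ∀ (hP : P) v, (φ.f (k + 1)).hom (top k h hP v) = (ψ.f (k + 1)).hom (top k h hP v))
    (hb : ∀ (hQ : Q) v, (φ.f k).hom (bot k h hQ v) = (ψ.f k).hom (bot k h hQ v)) : φ = ψ := by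
  refine HomologicalComplex.hom_ext _ _ fun n => ModuleCat.hom_ext (LinearMap.ext fun x => ?_)
  obtain ⟨x, hx⟩ := x
  rcases hx with (⟨rfl, hP⟩ | ⟨hn, hQ⟩) | hx
  · exact ht hP x
  · obtain rfl : n = k := by omega
    exact hb hQ x
  · subst hx
    exact (map_zero _).trans (map_zero _).symm

section Desc

variable {B : CDGA.{u}} (z : V →ₗ[ℚ] B.X (k + 1)) (y : V →ₗ[ℚ] B.X k)

open Classical in
/-- The components of a map out of a cell. -/
def descLin (P Q : Prop) (n : ℤ) :
    gate V ((n = k + 1 ∧ P) ∨ (n + 1 = k + 1 ∧ Q)) →ₗ[ℚ] B.X n :=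
  if hn : n = k + 1 then B.cast hn.symm ∘ₗ z ∘ₗ Submodule.subtype _
  else if hn : n = k then B.cast hn.symm ∘ₗ y ∘ₗ Submodule.subtype _ else 0

theorem descLin_top (x : gate V ((k + 1 = k + 1 ∧ P) ∨ (k + 1 + 1 = k + 1 ∧ Q))) :
    descLin z y P Q (k + 1) x = z x.1 := by
  rw [descLin, dif_pos rfl]; rfl

theorem descLin_bot (x : gate V ((k = k + 1 ∧ P) ∨ (k + 1 = k + 1 ∧ Q))) :
    descLin z y P Q k x = y x.1 := by
  rw [descLin, dif_neg (by omega), dif_pos rfl]; rfl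

theorem cell_d (n : ℤ) (hn : n ≠ k) :
    (cell V (k + 1) P Q h).d n (n + 1) = 0 := by
  dsimp only [cell, CochainComplex.of]
  rw [CochainComplex.of_d, dif_neg (by omega)]
  rfl

/-- The map out of a cell given by the images of the generators. -/
def desc (h : Q → P) (hz : P → ∀ v, B.d rfl (z v) = 0) (hy : Q → ∀ v, B.d rfl (y v) = z v) :
    cell V (k + 1) P Q h ⟶ CDGA.toComplex.obj B where
  f n := ModuleCat.ofHom (X := gate V ((n = k + 1 ∧ P) ∨ (n + 1 = k + 1 ∧ Q))) (Y := B.X n)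
    (descLin z y P Q n)
  comm' n n' e := by
    obtain rfl : n + 1 = n' := e
    refine ModuleCat.hom_ext (LinearMap.ext fun
      (x : gate V ((n = k + 1 ∧ P) ∨ (n + 1 = k + 1 ∧ Q))) => ?_)
    refine (CDGA.toComplex_d_hom B rfl _).trans ?_
    change B.d rfl (descLin z y P Q n x) = descLin z y P Q (n + 1)
      (((cell V (k + 1) P Q h).d n (n + 1)).hom x)
    by_cases hk : n = k
    · subst hk
      obtain ⟨x, hx⟩ := x
      rcases hx with (⟨hn, hP⟩ | ⟨hn, hQ⟩) | hx
      · omega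
      · rw [descLin_bot]
        have h1 := d_bot (k := n) (h := h) hQ x
        exact (hy hQ x).trans ((descLin_top z y _).symm.trans (congrArg _ h1.symm))
      · subst hx
        exact ((congrArg _ (map_zero _)).trans (map_zero _)).trans
          ((congrArg _ (map_zero _)).trans (map_zero _)).symm
    · rw [cell_d n hk]
      refine Eq.trans ?_ (map_zero (descLin z y P Q (n + 1))).symm
      obtain ⟨x, hx⟩ := x
      rcases hx with (⟨rfl, hP⟩ | ⟨hn, hQ⟩) | hx
      · rw [descLin_top]
        exact hz hP x
      · omega
      · subst hx
        exact (congrArg _ (map_zero _)).trans (map_zero _)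

variable {z y} {hz : P → ∀ v, B.d rfl (z v) = 0} {hy : Q → ∀ v, B.d rfl (y v) = z v}

theorem desc_top (hP : P) (v : V) :
    ((desc z y h hz hy).f (k + 1)).hom (top k h hP v) = z v := descLin_top z y _

theorem desc_bot (hQ : Q) (v : V) :
    ((desc z y h hz hy).f k).hom (bot k h hQ v) = y v := descLin_bot z y _

end Desc

end Cell

/-! ### The pushout square of a Hirsch extension -/

namespace HirschData

variable {N B : CDGA.{u}} {k : ℤ} {V : Type u} [AddCommGroup V] [Module ℚ V] (h : HirschData N k V)

/-- The attaching map of a Hirsch extension. -/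
def attach : sphere V (k + 1) ⟶ CDGA.toComplex.obj N :=
  Cell.desc h.f 0 _ (fun _ v => h.d_f rfl v) False.elim

/-- The characteristic map of a Hirsch extension. -/
def char : disk V (k + 1) ⟶ CDGA.toComplex.obj h.ext :=
  Cell.desc (CDGA.Hom.f h.incl _ ∘ₗ h.f) h.gen _
    (fun _ v => by rw [LinearMap.comp_apply, ← CDGA.Hom.map_d, h.d_f, map_zero])
    fun _ v => h.d_gen rfl v

/-- A cochain map from the disk is a linear map `y` on its bottom cell, the top cell being forced to
`dy`. Agreement with `α` on the sphere reads `dy = α ∘ f`, which is exactly the input of `lift`. -/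
theorem isPushout : IsPushout ((lamAdj.homEquiv _ _).symm h.attach)
    (Lam.map (sphereToDisk V (k + 1))) h.incl ((lamAdj.homEquiv _ _).symm h.char) := by
  apply lamAdj.isPushout_of_lift
  · refine Cell.hom_ext (fun hP v => ?_) (fun hQ => hQ.elim)
    change CDGA.Hom.f h.incl (k + 1) ((h.attach.f (k + 1)).hom _) = (h.char.f (k + 1)).hom _
    refine (congrArg _ (Cell.desc_top hP v)).trans ?_
    exact (Cell.desc_top (h := id) (z := CDGA.Hom.f h.incl _ ∘ₗ h.f) (y := h.gen) hP v).symm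
  · intro B α β hβ
    let y : V →ₗ[ℚ] B.X k := (β.f k).hom ∘ₗ Cell.bot k id trivial
    have hy : ∀ v, B.d rfl (y v) = CDGA.Hom.f α _ (h.f v) := by
      intro v
      have h1 := congrArg (fun g => g.hom (Cell.bot k id trivial v)) (β.comm k (k + 1))
      refine (CDGA.toComplex_d_hom B rfl _).symm.trans (h1.trans ?_)
      refine (congrArg (β.f (k + 1)).hom (Cell.d_bot (h := id) trivial v)).trans ?_
      have h2 := Cplx.hom_congr hβ (k + 1) (Cell.top k False.elim trivial v)
      refine Eq.trans h2.symm ?_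
      exact congrArg (CDGA.Hom.f α _) (Cell.desc_top trivial v)
    refine ⟨h.lift α y hy, h.incl_comp_lift α y hy, ?_⟩
    refine Cell.hom_ext (fun hP v => ?_) (fun hQ v => ?_)
    · have h1 : (h.char.f (k + 1)).hom (Cell.top k id hP v) = CDGA.Hom.f h.incl _ (h.f v) :=
        Cell.desc_top hP v
      refine (congrArg (CDGA.Hom.f (h.lift α y hy) _) h1).trans ?_
      refine (h.lift_incl α y hy _ _).trans ?_
      have h2 := Cplx.hom_congr hβ (k + 1) (Cell.top k False.elim trivial v)
      refine Eq.trans ?_ h2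
      exact (congrArg (CDGA.Hom.f α _) (Cell.desc_top trivial v)).symm
    · have h1 : (h.char.f k).hom (Cell.bot k id hQ v) = h.gen v :=
        Cell.desc_bot hQ v
      exact (congrArg (CDGA.Hom.f (h.lift α y hy) _) h1).trans (h.lift_gen α y hy v)
  · intro B δ δ' h₁ h₂
    refine h.hom_ext h₁ fun v => ?_
    have h1 : (h.char.f k).hom (Cell.bot k id trivial v) = h.gen v := Cell.desc_bot trivial v
    rw [← h1]
    exact Cplx.hom_congr h₂ k (Cell.bot k id trivial v)

/-- The attaching map is read off on the top cell of the sphere, and pushouts are unique. Thus the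
low-degree computations for `ext` apply to every Hirsch extension. -/
theorem _root_.IsHirschExtension.exists_iso {N M : CDGA.{u}} {F : N ⟶ M} {k : ℕ}
    (hF : IsHirschExtension F k) : ∃ (V : ModuleCat.{u} ℚ) (h : HirschData N k V) (e : h.ext ≅ M),
      h.incl ≫ e.hom = F := by
  obtain ⟨V, f, g, hp⟩ := hF
  let φ := lamAdj.homEquiv _ _ f
  let h : HirschData N k V :=
    ⟨(φ.f (k + 1)).hom ∘ₗ Cell.top k False.elim trivial, fun e v => by
      refine (CDGA.toComplex_d_hom N e _).symm.trans ?_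
      refine Cocycle.map_mem_ker φ ?_
      subst e
      have h1 : (sphere V ((k : ℤ) + 1)).d (k + 1) (k + 1 + 1) = 0 := Cell.cell_d _ (by omega)
      rw [h1]; rfl⟩
  have hf : (lamAdj.homEquiv _ _).symm h.attach = f := by
    rw [Equiv.symm_apply_eq]
    exact Cell.hom_ext (fun hP v => Cell.desc_top hP v) fun hQ => hQ.elim
  have hp' := h.isPushout
  rw [hf] at hp'
  exact ⟨V, h, hp'.isoIsPushout _ _ hp, hp'.inl_isoIsPushout_hom _ _ hp⟩

theorem isHirschExtension {k : ℕ} (h : HirschData N k V) : IsHirschExtension h.incl k :=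
  ⟨ModuleCat.of ℚ V, _, _, h.isPushout⟩

end HirschData

/-! ### Low degrees of minimal algebras and minimal models -/

theorem CDGA.Hom.surjective_of_iso {A B : CDGA.{u}} (e : A ≅ B) (n : ℤ) :
    Function.Surjective (CDGA.Hom.f e.hom n) := fun b =>
  ⟨CDGA.Hom.f e.inv n b,
    LinearMap.congr_fun (congrFun (congrArg CDGA.Hom.f e.inv_hom_id) n) b⟩

namespace IsMinimalAlgebra

theorem eq_zero_of_zero {M : CDGA.{u}} (hM : IsMinimalAlgebra 0 M) {n : ℤ} (hn : n ≠ 0)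
    (a : M.X n) : a = 0 := by
  obtain ⟨e⟩ := hM
  obtain ⟨b, rfl⟩ := CDGA.Hom.surjective_of_iso e.symm n a
  rw [CDGA.ratVal_eq_zero hn b, map_zero]

/-- No stage adds generators in degree `0`, and only the first adds any in degree `1`; their
differentials lie in the degree `2` part of `ℚ`, which is zero. -/
theorem low_degrees {k : ℕ} {M : CDGA.{u}} (hM : IsMinimalAlgebra k M) :
    M.IsConnected ∧ ∀ a : M.X 1, M.d rfl a = 0 := by
  induction k generalizing M with
  | zero =>
    refine ⟨fun a => ?_, fun a => by rw [hM.eq_zero_of_zero one_ne_zero a, map_zero]⟩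
    obtain ⟨e⟩ := hM
    obtain ⟨b, rfl⟩ := CDGA.Hom.surjective_of_iso e.symm 0 a
    refine ⟨CDGA.ratVal 0 b, ?_⟩
    rw [← CDGA.Hom.map_one e.symm.hom, ← map_smul]
    congr 1
    exact CDGA.ratVal_injective 0 (by simp [CDGA.ratVal_one])
  | succ k ih =>
    obtain ⟨N, F, hN, hF⟩ := hM
    obtain ⟨hc, hd⟩ := ih hN
    obtain ⟨V, h, e, -⟩ := hF.exists_iso
    constructor
    · intro a
      obtain ⟨a, rfl⟩ := CDGA.Hom.surjective_of_iso e 0 a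
      obtain ⟨⟨a, v⟩, rfl⟩ := h.mem_range_genIncl (by simp) hc (Or.inl le_rfl) a (by omega)
      obtain ⟨c, rfl⟩ := hc a
      refine ⟨c, ?_⟩
      rw [h.genIncl_of_ne (by omega)]
      change CDGA.Hom.f e.hom 0 (CDGA.Hom.f h.incl 0 (c • N.one)) = _
      rw [map_smul, map_smul, CDGA.Hom.map_one, CDGA.Hom.map_one]
    · intro a
      obtain ⟨a, rfl⟩ := CDGA.Hom.surjective_of_iso e 1 a
      obtain ⟨⟨a, v⟩, rfl⟩ := h.mem_range_genIncl (by simp) hc (Or.inl le_rfl) a (by omega)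
      rw [← CDGA.Hom.map_d, h.d_genIncl]
      have h0 : N.d rfl a + h.df rfl v = 0 := by
        rw [hd a, zero_add]
        cases k with
        | zero => exact hN.eq_zero_of_zero (by omega) _
        | succ k => rw [gate_eq_zero (by omega) v, map_zero]
      dsimp only
      rw [h0]
      exact (congrArg _ (map_zero _)).trans (map_zero _)

end IsMinimalAlgebra

namespace CDGA.IsSimplyConnected

variable {A : CDGA.{u}}

/-- If `1 = 0` in `A`, injectivity of the unit on `H^0` would make `1` a boundary in `ℚ`, whose
differential is zero. -/
theorem one_ne_zero (hA : A.IsSimplyConnected) : A.one ≠ 0 := by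
  intro h0
  have h1 := ((isIso_cohomologyMap_iff A.unit (show (-1 : ℤ) + 1 = 0 by omega)
    (show (0 : ℤ) + 1 = 1 by omega)).1 hA.isIso_unit).1 rat.one 0 rfl
    (by rw [Hom.map_one, h0, map_zero])
  obtain ⟨c, hc⟩ := h1
  have h2 : ratVal 0 rat.one = ratVal 0 0 := congrArg (ratVal 0) (hc.trans rfl)
  rw [ratVal_one, map_zero] at h2
  exact _root_.one_ne_zero h2

theorem exists_eq_d (hA : A.IsSimplyConnected) (a : A.X 1) (ha : A.d rfl a = 0) : ∃ b : A.X 0, a = A.d (zero_add 1) b := by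
  have h0 : Cocycle.cls (toComplex.obj A) rfl ⟨a, (toComplex_d_hom A rfl a).trans ha⟩ = 0 := by
    have := ModuleCat.subsingleton_of_isZero hA.isZero_one
    exact Subsingleton.elim _ _
  rw [Cocycle.cls_eq_zero_iff rfl (zero_add 1)] at h0
  obtain ⟨b, hb⟩ := h0
  exact ⟨b, hb.symm.trans (toComplex_d_hom A (zero_add 1) b)⟩

end CDGA.IsSimplyConnected

namespace IsMinimalModel

variable {k : ℕ} {M A : CDGA.{u}} {m : M ⟶ A}

/-- Unites the isomorphisms up to degree `k` with the injection in degree `k + 1`. -/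
theorem exists_eq_d (hm : IsMinimalModel k m) {p i i' : ℤ} (e : p + 1 = i) (e' : i + 1 = i') (hi : i ≤ k + 1) (a : M.X i)
    (b : A.X p) (ha : M.d e' a = 0) (hb : CDGA.Hom.f m i a = A.d e b) : ∃ c, a = M.d e c := by
  rcases hi.eq_or_lt with rfl | hi
  · exact (CDGA.homologyMap_injective_iff m e e').1 hm.mono a b ha hb
  · exact ((CDGA.isIso_cohomologyMap_iff m e e').1 (hm.isIso i (by omega))).1 a b ha hb

theorem exists_eq_add (hm : IsMinimalModel k m) {p i i' : ℤ} (e : p + 1 = i) (e' : i + 1 = i') (hi : i ≤ k) (b : A.X i)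
    (hb : A.d e' b = 0) :
    ∃ (a : M.X i) (c : A.X p), M.d e' a = 0 ∧ b = CDGA.Hom.f m i a + A.d e c :=
  ((CDGA.isIso_cohomologyMap_iff m e e').1 (hm.isIso i hi)).2 b hb

theorem _root_.CDGA.Hom.one_ne_zero (m : M ⟶ A) (hA : A.IsSimplyConnected) : M.one ≠ 0 := fun h =>
  hA.one_ne_zero (by rw [← CDGA.Hom.map_one m, h, map_zero])

/-- For `k ≥ 1`, elements of degree `1` are closed, their images are exact since `H^1(A) = 0`, so
they are exact in `M` by injectivity on `H^1`; but `M^0` consists of multiples of the unit, whose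
differential vanishes. -/
theorem eq_zero_of_one (hm : IsMinimalModel k m) (hA : A.IsSimplyConnected) (a : M.X 1) : a = 0 := by
  rcases Nat.eq_zero_or_pos k with rfl | hk
  · exact hm.isMinimalAlgebra.eq_zero_of_zero (by omega) a
  · obtain ⟨hc, hd⟩ := hm.isMinimalAlgebra.low_degrees
    obtain ⟨b, hb⟩ := hA.exists_eq_d (CDGA.Hom.f m 1 a) (by rw [← CDGA.Hom.map_d, hd, map_zero])
    obtain ⟨c, rfl⟩ := hm.exists_eq_d (zero_add 1) rfl (by omega) a b (hd a) hb
    obtain ⟨c, rfl⟩ := hc c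
    rw [map_smul, M.d_one, smul_zero]

end IsMinimalModel

/-! ### One index: from `(k - 1)`-minimal to `k`-minimal -/

namespace HirschData

/-- If the pairs `(f v, y v)` represent the cohomology of degree `k` of the cone of a
`(k - 1)`-minimal model `m`, then the Hirsch extension along `f` is a `k`-minimal model. -/
theorem isMinimalModel_lift {M A : CDGA.{u}} (hA : A.IsSimplyConnected) {k : ℕ} (hk : 1 ≤ k)
    {m : M ⟶ A} (hm : IsMinimalModel (k - 1) m) {V : Type u} [AddCommGroup V] [Module ℚ V]
    (h : HirschData M k V) (y : V →ₗ[ℚ] A.X k)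
    (hy : ∀ v, A.d rfl (y v) = CDGA.Hom.f m _ (h.f v))
    (hinj : ∀ {p : ℤ} (e : p + 1 = k) v (w : M.X k) (b : A.X p), h.f v = M.d rfl w →
      y v = CDGA.Hom.f m k w - A.d e b → v = 0)
    (hsurj : ∀ {p : ℤ} (e : p + 1 = k) (z : M.X (k + 1)) (a : A.X k), M.d rfl z = 0 →
      CDGA.Hom.f m _ z = A.d rfl a → ∃ (v : V) (w : M.X k) (b : A.X p),
        z = h.f v + M.d rfl w ∧ a = y v + CDGA.Hom.f m k w - A.d e b) :
    IsMinimalModel k (h.lift m y hy) := by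
  have hc := hm.isMinimalAlgebra.low_degrees.1
  have hM1 := hm.eq_zero_of_one hA
  have hk' : (1 : ℤ) ≤ k := by omega
  -- For `k = 1` the algebra `M` is `ℚ`, so `f v = 0` and `y v` is a closed element of `A^1`, hence
  -- equal to some `db`. The pair `(f v, y v)` is then the boundary of `(0, -b)`, which forces `v =
  -- 0`.
  have hV : (2 : ℤ) ≤ k ∨ ∀ v : V, v = 0 := by
    rcases hk.eq_or_lt with rfl | hk2
    · right
      intro v
      have hf : h.f v = 0 := IsMinimalAlgebra.eq_zero_of_zero hm.isMinimalAlgebra (by simp) _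
      obtain ⟨b, hb⟩ := hA.exists_eq_d (y v) (by
        have := hy v
        rw [hf, map_zero] at this
        exact this)
      refine hinj (zero_add 1) v 0 (-b) (by rw [hf, map_zero]) ?_
      rw [map_zero, map_neg, zero_sub, neg_neg]
      exact hb
    · exact Or.inl (by omega)
  have hinj' {n : ℤ} (hn : n ≤ k + 2) := h.genIncl_injective hk' hc (CDGA.Hom.one_ne_zero m hA) hM1 hn
  have hincl {n : ℤ} (hn : n ≤ k + 2) {a : M.X n} (ha : CDGA.Hom.f h.incl n a = 0) : a = 0 :=
    (Prod.ext_iff.1 (hinj' hn (ha.trans (map_zero _).symm))).1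
  have hrange {n : ℤ} (hn : n ≤ k + 1) (x : h.ext.X n) :
      ∃ a v, x = h.genIncl n (a, v) := by
    obtain ⟨⟨a, v⟩, hx⟩ := h.mem_range_genIncl hk' hc (Or.inr ⟨le_rfl, hM1, hV⟩) x hn
    exact ⟨a, v, hx.symm⟩
  have hrange' {n : ℤ} (hn : n ≤ k + 1) (hnk : n ≠ k) (x : h.ext.X n) :
      ∃ a, x = CDGA.Hom.f h.incl n a := by
    obtain ⟨a, v, rfl⟩ := hrange hn x
    exact ⟨a, h.genIncl_of_ne hnk a v⟩
  have hrangek (x : h.ext.X k) : ∃ a v, x = CDGA.Hom.f h.incl k a + h.gen v := by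
    obtain ⟨a, v, rfl⟩ := hrange (by omega) x
    exact ⟨a, v.1, by rw [h.genIncl_eq, gateMap_apply _ rfl]; rfl⟩
  have hinjlow {p i i' : ℤ} (e : p + 1 = i) (e' : i + 1 = i') (hi : i ≤ k + 1) (x : h.ext.X i)
      (b : A.X p) (hx : h.ext.d e' x = 0) (hb : CDGA.Hom.f (h.lift m y hy) i x = A.d e b) :
      ∃ c, x = h.ext.d e c := by
    rcases eq_or_ne i k with rfl | hik
    · subst e'
      obtain ⟨a, v, rfl⟩ := hrangek x
      rw [map_add, ← CDGA.Hom.map_d, h.d_gen, ← map_add] at hx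
      have hx0 := hincl (by omega) hx
      rw [map_add, h.lift_incl, h.lift_gen] at hb
      -- Here `f v = -da` and `y v = db - m a`: the pair is the boundary of `(-a, -b)` in the cone.
      have hv : v = 0 := by
        refine hinj e v (-a) (-b) ?_ ?_
        · rw [map_neg]; exact (neg_eq_of_add_eq_zero_right hx0).symm
        · rw [map_neg, map_neg, ← hb]; abel
      subst hv
      rw [map_zero, add_zero] at hb ⊢
      obtain ⟨c, rfl⟩ := hm.exists_eq_d e rfl (by omega) a b (by simpa using hx0) hb
      exact ⟨CDGA.Hom.f h.incl p c, CDGA.Hom.map_d _ _ _⟩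
    · obtain ⟨a, rfl⟩ := hrange' hi hik x
      rw [← CDGA.Hom.map_d] at hx
      have hx0 := hincl (by omega) hx
      rw [h.lift_incl] at hb
      rcases hi.eq_or_lt with rfl | hi
      -- In degree `k + 1`, a closed `a` with `m a = db` gives the cone cocycle `(a, b)`, so `a`
      -- equals `f v + dw` and is killed by the new generator `v` together with `w`.
      · obtain rfl : p = k := by omega
        obtain ⟨v, w, b', hz, -⟩ := hsurj (p := k - 1) (by omega) a b (by subst e'; exact hx0) hb
        refine ⟨h.gen v + CDGA.Hom.f h.incl k w, ?_⟩
        rw [map_add, h.d_gen, ← CDGA.Hom.map_d, hz, map_add]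
        rfl
      · obtain ⟨c, rfl⟩ := hm.exists_eq_d e e' (by omega) a b hx0 hb
        exact ⟨CDGA.Hom.f h.incl p c, CDGA.Hom.map_d _ _ _⟩
  refine ⟨?_, fun i hi => ?_, ?_⟩
  · obtain ⟨j, rfl⟩ : ∃ j, k = j + 1 := ⟨k - 1, by omega⟩
    exact ⟨M, h.incl, hm.isMinimalAlgebra, h.isHirschExtension⟩
  · rw [CDGA.isIso_cohomologyMap_iff _ (sub_add_cancel i 1) rfl]
    refine ⟨hinjlow _ _ (by omega), fun b hb => ?_⟩
    rcases hi.eq_or_lt with rfl | hi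
    -- A closed `b` of degree `k` gives the cone cocycle `(0, b)`; writing it as `(f v, y v)` plus a
    -- boundary makes `v + w` a closed preimage of `b` up to a boundary.
    · obtain ⟨v, w, b', hz, ha⟩ := hsurj (sub_add_cancel _ 1) 0 b (map_zero _)
        (by rw [map_zero]; exact hb.symm)
      refine ⟨h.gen v + CDGA.Hom.f h.incl k w, -b', ?_, ?_⟩
      · rw [map_add, h.d_gen, ← CDGA.Hom.map_d, ← map_add, CDGA.cast_rfl, ← hz, map_zero]
      · rw [map_add, h.lift_gen, h.lift_incl, map_neg, ← sub_eq_add_neg]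
        exact ha
    · obtain ⟨a, c, ha, hc⟩ := hm.exists_eq_add (sub_add_cancel i 1) rfl (by omega) b hb
      exact ⟨CDGA.Hom.f h.incl i a, c, by rw [← CDGA.Hom.map_d, ha, map_zero],
        by rw [h.lift_incl]; exact hc⟩
  · rw [CDGA.homologyMap_injective_iff _ rfl rfl]
    exact hinjlow _ _ le_rfl

end HirschData

/-! ### Antiderivatives and primitives in the path object -/

namespace CDGA

variable (A : CDGA.{u})

/-- The antiderivative `f ↦ ∫₀ᵗ f` of polynomials. -/
def antideriv : ℚ[X] →ₗ[ℚ] ℚ[X] :=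
  Polynomial.lsum fun k => (1 / ((k : ℚ) + 1)) • Polynomial.monomial (k + 1)

theorem antideriv_monomial (k : ℕ) (a : ℚ) : antideriv (Polynomial.monomial k a) =
    Polynomial.monomial (k + 1) (1 / ((k : ℚ) + 1) * a) := by
  simp [antideriv, Polynomial.smul_monomial]

theorem derivative_antideriv (f : ℚ[X]) : Polynomial.derivative (antideriv f) = f := by
  induction f using Polynomial.induction_on' with
  | add f g hf hg => rw [map_add, map_add, hf, hg]
  | monomial k a =>
    rw [antideriv_monomial, Polynomial.derivative_monomial]
    congr 1
    push_cast
    field_simp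

theorem antideriv_derivative (f : ℚ[X]) :
    antideriv (Polynomial.derivative f) = f - Polynomial.C (f.eval 0) := by
  induction f using Polynomial.induction_on' with
  | add f g hf hg => rw [map_add, map_add, hf, hg, Polynomial.eval_add, map_add]; ring
  | monomial k a =>
    rcases k with _ | k
    · simp
    · rw [Polynomial.derivative_monomial, antideriv_monomial]
      simp only [Polynomial.eval_monomial]
      rw [Nat.add_sub_cancel, zero_pow (Nat.succ_ne_zero k), mul_zero, map_zero, sub_zero]
      congr 1
      push_cast
      field_simp

theorem eval_zero_antideriv (f : ℚ[X]) : (antideriv f).eval 0 = 0 := by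
  induction f using Polynomial.induction_on' with
  | add f g hf hg => rw [map_add, Polynomial.eval_add, hf, hg, add_zero]
  | monomial k a => rw [antideriv_monomial]; simp

theorem eval_one_antideriv (f : ℚ[X]) : (antideriv f).eval 1 = integral f := by
  have := integral_derivative (antideriv f)
  rw [derivative_antideriv, eval_zero_antideriv, sub_zero] at this
  exact this.symm

/-- The antiderivative with coefficients in a CDGA. -/
def polyAntideriv (n : ℤ) : A.poly.X n →ₗ[ℚ] A.poly.X n := antideriv.lTensor (A.X n)

theorem polyAntideriv_tmul {n : ℤ} (a : A.X n) (f : ℚ[X]) :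
    A.polyAntideriv n (a ⊗ₜ[ℚ] f : A.X n ⊗[ℚ] ℚ[X]) =
      (a ⊗ₜ[ℚ] antideriv f : A.X n ⊗[ℚ] ℚ[X]) := rfl

/-- The inclusion of constants. -/
def polyConst (f : ℚ[X]) (n : ℤ) : A.X n →ₗ[ℚ] A.poly.X n :=
  (TensorProduct.mk ℚ (A.X n) ℚ[X]).flip f

theorem polyConst_apply {n : ℤ} (a : A.X n) (f : ℚ[X]) :
    A.polyConst f n a = (a ⊗ₜ[ℚ] f : A.X n ⊗[ℚ] ℚ[X]) := rfl

theorem polyDeriv_antideriv {n : ℤ} (a : A.poly.X n) :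
    A.polyDeriv n (A.polyAntideriv n a) = a := by
  induction a using poly_induction with
  | zero => rw [map_zero, map_zero]
  | add a b ha hb => rw [map_add, map_add, ha, hb]
  | tmul a f => rw [polyAntideriv_tmul, polyDeriv_tmul, derivative_antideriv]

theorem polyAntideriv_deriv {n : ℤ} (a : A.poly.X n) :
    A.polyAntideriv n (A.polyDeriv n a) = a - A.polyConst 1 n (A.polyEval 0 n a) := by
  induction a using poly_induction with
  | zero => simp
  | add a b ha hb => rw [map_add, map_add, ha, hb, map_add, map_add]; abel
  | tmul a f =>
    rw [polyDeriv_tmul, polyAntideriv_tmul, antideriv_derivative, polyEval_tmul, polyConst_apply]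
    rw [TensorProduct.tmul_sub, TensorProduct.smul_tmul, ← Polynomial.C_1, Polynomial.smul_C,
      smul_eq_mul, _root_.mul_one]
    rfl

theorem polyEval_zero_antideriv {n : ℤ} (a : A.poly.X n) :
    A.polyEval 0 n (A.polyAntideriv n a) = 0 := by
  induction a using poly_induction with
  | zero => rw [map_zero, map_zero]
  | add a b ha hb => rw [map_add, map_add, ha, hb, add_zero]
  | tmul a f => rw [polyAntideriv_tmul, polyEval_tmul, eval_zero_antideriv, zero_smul]

theorem polyEval_one_antideriv {n : ℤ} (a : A.poly.X n) :
    A.polyEval 1 n (A.polyAntideriv n a) = A.polyIntegral n a := by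
  induction a using poly_induction with
  | zero => rw [map_zero, map_zero, map_zero]
  | add a b ha hb => rw [map_add, map_add, ha, hb, map_add]
  | tmul a f => rw [polyAntideriv_tmul, polyEval_tmul, eval_one_antideriv, polyIntegral_tmul]

theorem polyAntideriv_d {p q : ℤ} (e : p + 1 = q) (a : A.poly.X p) :
    A.polyAntideriv q (A.poly.d e a) = A.poly.d e (A.polyAntideriv p a) := by
  induction a using poly_induction with
  | zero => simp
  | add a b ha hb => simp only [map_add, ha, hb]
  | tmul a f => rw [poly_d_tmul, polyAntideriv_tmul, polyAntideriv_tmul, poly_d_tmul]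

theorem polyEval_const {n : ℤ} (c : ℚ) (f : ℚ[X]) (a : A.X n) :
    A.polyEval c n (A.polyConst f n a) = f.eval c • a := polyEval_tmul _ _ _ _

theorem poly_d_const {p q : ℤ} (e : p + 1 = q) (f : ℚ[X]) (a : A.X p) :
    A.poly.d e (A.polyConst f p a) = A.polyConst f q (A.d e a) := rfl

theorem polyDeriv_const {n : ℤ} (f : ℚ[X]) (a : A.X n) :
    A.polyDeriv n (A.polyConst f n a) = A.polyConst (Polynomial.derivative f) n a := rfl

/-- A closed element `z` of the path object whose restriction to `t = 0` is the differential of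
`a` has a primitive which restricts to `a` at `t = 0` and, up to a prescribed boundary, to
`a + ∫₀¹ z` at `t = 1`. -/
theorem exists_path_primitive {o p q : ℤ} (e' : o + 1 = p) (e : p + 1 = q) (z : A.path.X q)
    (hz : A.path.d rfl z = 0) (a : A.X p) (ha : A.d e a = Hom.f (A.pathEval 0) q z) (b : A.X o) :
    ∃ h : A.path.X p, A.path.d e h = z ∧ Hom.f (A.pathEval 0) p h = a ∧
      Hom.f (A.pathEval 1) p h = a + A.pathIntegral e z + A.d e' b := by
  obtain rfl : p = q - 1 := by omega
  -- This is the `dt` component of `dz = 0`.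
  have hz2 : A.poly.d (show q - 1 + 1 = q by omega) z.2 = (-1 : ℚ) ^ (q - 1) • A.polyDeriv q z.1 := by
    have h1 : A.poly.d (by omega) z.2 +
        (-1 : ℚ) ^ q • A.poly.cast (show q = q + 1 - 1 by omega) (A.polyDeriv q z.1) = 0 :=
      congrArg Prod.snd hz
    have h2 := congrArg (A.poly.cast (show q + 1 - 1 = q by omega)) h1
    rw [map_add, map_smul, cast_cast, cast_rfl, map_zero,
      ← A.poly.d_cast rfl (show q - 1 + 1 = q by omega) (by omega), cast_rfl] at h2
    rw [eq_neg_of_add_eq_zero_left h2, neg_one_zpow_sub_one, neg_smul]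
  -- The `dt` component of `d(w, 0)` is `(-1)^(q-1) ∂w/∂t`, so the signed antiderivative of `z.2` is
  -- the only choice once the value `a` at `t = 0` is prescribed. The sign is the Koszul sign of
  -- `pathIntegral`.
  let w : A.poly.X (q - 1) := A.polyConst 1 _ a + (-1 : ℚ) ^ (q - 1) • A.polyAntideriv _ z.2
  -- The boundary of `t b` vanishes at `t = 0` and is `db` at `t = 1`, so it moves only the end
  -- value.
  let c : A.path.X o := (A.polyConst Polynomial.X o b, 0)
  have hd : A.path.d e (w, 0) = z := by
    refine Prod.ext ?_ ?_
    · change A.poly.d e w = z.1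
      rw [map_add, map_smul, poly_d_const, ha, ← polyAntideriv_d, hz2, map_smul, smul_smul,
        neg_one_zpow_mul_self, one_smul, polyAntideriv_deriv]
      exact add_sub_cancel _ _
    · change A.poly.d _ 0 + (-1 : ℚ) ^ (q - 1) • A.poly.cast _ (A.polyDeriv (q - 1) w) = z.2
      rw [map_zero, zero_add, cast_rfl, map_add, polyDeriv_const, Polynomial.derivative_one, map_smul,
        polyDeriv_antideriv, smul_add, smul_smul, neg_one_zpow_mul_self, one_smul, polyConst_apply,
        TensorProduct.tmul_zero]
      exact (congrArg (· + z.2) (smul_zero _)).trans (zero_add _)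
  have hc (s : ℚ) : Hom.f (A.pathEval s) _ (A.path.d e' c) = s • A.d e' b := by
    rw [Hom.map_d, show Hom.f (A.pathEval s) o c = s • b from
      (A.polyEval_const s _ b).trans (by rw [Polynomial.eval_X]), map_smul]
  have hw (s : ℚ) : Hom.f (A.pathEval s) (q - 1) (w, 0) =
      a + (-1 : ℚ) ^ (q - 1) • A.polyEval s _ (A.polyAntideriv _ z.2) := by
    change A.polyEval s _ w = _
    rw [map_add, polyEval_const, Polynomial.eval_one, one_smul, map_smul]
  let w' : A.path.X (q - 1) := (w, 0)
  refine ⟨w' + A.path.d e' c, ?_, ?_, ?_⟩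
  · rw [map_add, hd, A.path.d_d, add_zero]
  · rw [map_add, hc, hw, polyEval_zero_antideriv, smul_zero, add_zero, zero_smul, add_zero]
  · rw [map_add, hc, hw, polyEval_one_antideriv, one_smul]
    rfl

end CDGA

/-! ### Generators of a tame extension and the extended model -/

/-- Generators for an extension of a tame minimal model `m` in degree `k`: a compatible family of
cocycles `(v, a)` of the mapping cones, alive between a birth and a death index, which form bases
of the cohomology of the cones, together with elements `w` which bound `v` after the death. -/
structure TameGenerators {n : ℕ} {t : Fin (n + 1) ↪o ℝ≥0} {A : ℝ≥0 ⥤ CDGA.{u}} {l : ℕ}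
    (m : TameMinimalModel t A l) (k : ℕ) (Γ : Type u) where
  /-- the index of birth -/
  birth : Γ → Fin (n + 1)
  /-- the index of death -/
  death : Γ → WithTop (Fin (n + 1))
  /-- the first components of the cocycles -/
  v : Γ → ∀ r, (m.M.obj r).X (k + 1)
  /-- the second components of the cocycles -/
  a : Γ → ∀ r, (A.obj (t r)).X k
  /-- the bounding elements -/
  w : Γ → ∀ r, (m.M.obj r).X k
  d_v : ∀ γ r, (m.M.obj r).d rfl (v γ r) = 0
  d_a : ∀ γ r, birth γ ≤ r → (A.obj (t r)).d rfl (a γ r) = CDGA.Hom.f (m.m r) _ (v γ r)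
  map_v : ∀ γ {r s} (h : r ≤ s), birth γ ≤ r →
    CDGA.Hom.f (m.M.map (homOfLE h)) _ (v γ r) = v γ s
  d_w : ∀ γ (r : Fin (n + 1)), death γ ≤ r → (m.M.obj r).d rfl (w γ r) = v γ r
  map_w : ∀ γ {r s : Fin (n + 1)} (h : r ≤ s), death γ ≤ r →
    CDGA.Hom.f (m.M.map (homOfLE h)) _ (w γ r) = w γ s
  a_succ : ∀ γ (r : Fin n), birth γ ≤ r.castSucc → a γ r.succ =
    CDGA.Hom.f (A.map (homOfLE (t.monotone r.castSucc_le_succ))) _ (a γ r.castSucc) +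
      (A.obj (t r.succ)).pathIntegral rfl (CDGA.Hom.f (m.H r).map _ (v γ r.castSucc))
  -- Asked only at the step where `γ` dies. Later the generator is represented by `w` alone, and its
  -- homotopy is already given on the old algebra.
  a_death : ∀ {p : ℤ} (e : p + 1 = k) γ (r : Fin n), ¬ death γ ≤ r.castSucc → death γ ≤ r.succ →
    ∃ b : (A.obj (t r.succ)).X p,
      a γ r.succ = CDGA.Hom.f (m.m r.succ) _ (w γ r.succ) - (A.obj (t r.succ)).d e b
  inj : ∀ r {p : ℤ} (e : p + 1 = k) (c : {γ // birth γ ≤ r ∧ ¬ death γ ≤ r} →₀ ℚ)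
    (x : (m.M.obj r).X k) (b : (A.obj (t r)).X p),
    Finsupp.linearCombination ℚ (fun γ => v γ.1 r) c = (m.M.obj r).d rfl x →
    Finsupp.linearCombination ℚ (fun γ => a γ.1 r) c =
      CDGA.Hom.f (m.m r) k x - (A.obj (t r)).d e b → c = 0
  surj : ∀ r {p : ℤ} (e : p + 1 = k) (z : (m.M.obj r).X (k + 1)) (y : (A.obj (t r)).X k),
    (m.M.obj r).d rfl z = 0 → CDGA.Hom.f (m.m r) _ z = (A.obj (t r)).d rfl y →
    ∃ (c : {γ // birth γ ≤ r ∧ ¬ death γ ≤ r} →₀ ℚ) (x : (m.M.obj r).X k)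
      (b : (A.obj (t r)).X p),
      z = Finsupp.linearCombination ℚ (fun γ => v γ.1 r) c + (m.M.obj r).d rfl x ∧
      y = Finsupp.linearCombination ℚ (fun γ => a γ.1 r) c +
        CDGA.Hom.f (m.m r) k x - (A.obj (t r)).d e b

namespace TameGenerators

variable {n : ℕ} {t : Fin (n + 1) ↪o ℝ≥0} {A : ℝ≥0 ⥤ CDGA.{u}} {l : ℕ}
  {m : TameMinimalModel t A l} {k : ℕ} {Γ : Type u} (g : TameGenerators m k Γ)

theorem linearMap_eq {α V W : Type*} [AddCommGroup V] [Module ℚ V] [AddCommGroup W] [Module ℚ W]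
    (F : V →ₗ[ℚ] W) (x : α → V) (y : α → W) (h : ∀ i, F (x i) = y i) (c : α →₀ ℚ) :
    F (Finsupp.linearCombination ℚ x c) = Finsupp.linearCombination ℚ y c := by
  rw [Finsupp.apply_linearCombination]
  congr 2
  exact funext h

/-- The generators alive at a given index. -/
abbrev Alive (r : Fin (n + 1)) : Type u := {γ // g.birth γ ≤ r ∧ ¬ g.death γ ≤ r}

/-- The Hirsch extension at a given index. -/
def hirsch (r : Fin (n + 1)) : HirschData (m.M.obj r) k (g.Alive r →₀ ℚ) where
  f := Finsupp.linearCombination ℚ fun γ => g.v γ.1 r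
  d_f e x := by
    subst e
    rw [linearMap_eq _ _ (fun _ => 0) fun γ : {γ // g.birth γ ≤ r ∧ ¬ g.death γ ≤ r} => g.d_v γ.1 r]
    simp [Finsupp.linearCombination_apply]

open Classical in
/-- The generator `γ` at an index after its birth. -/
def gen (γ : Γ) (r : Fin (n + 1)) : (g.hirsch r).ext.X k :=
  -- The second branch is meant for dead generators; before the birth its value is irrelevant.
  if h : g.birth γ ≤ r ∧ ¬ g.death γ ≤ r then (g.hirsch r).gen (Finsupp.single ⟨γ, h⟩ 1)
  else CDGA.Hom.f (g.hirsch r).incl _ (g.w γ r)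

theorem gen_alive {r : Fin (n + 1)} (γ : g.Alive r) :
    g.gen γ.1 r = (g.hirsch r).gen (Finsupp.single γ 1) := dif_pos γ.2

theorem gen_dead {r : Fin (n + 1)} {γ : Γ} (h : g.death γ ≤ r) :
    g.gen γ r = CDGA.Hom.f (g.hirsch r).incl _ (g.w γ r) := dif_neg fun h' => h'.2 h

theorem d_gen {γ : Γ} {r : Fin (n + 1)} (h : g.birth γ ≤ r) :
    (g.hirsch r).ext.d rfl (g.gen γ r) = CDGA.Hom.f (g.hirsch r).incl _ (g.v γ r) := by
  by_cases hd : g.death γ ≤ r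
  · rw [g.gen_dead hd, ← CDGA.Hom.map_d, g.d_w γ r hd]
  · rw [g.gen_alive ⟨γ, h, hd⟩, HirschData.d_gen]
    congr 1
    exact (Finsupp.linearCombination_single ℚ _ _).trans (one_smul _ _)

theorem hom_ext {B : CDGA.{u}} {r : Fin (n + 1)} {F G : (g.hirsch r).ext ⟶ B}
    (h₁ : (g.hirsch r).incl ≫ F = (g.hirsch r).incl ≫ G)
    (h₂ : ∀ γ, g.birth γ ≤ r → CDGA.Hom.f F k (g.gen γ r) = CDGA.Hom.f G k (g.gen γ r)) :
    F = G := by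
  refine (g.hirsch r).hom_ext h₁ ?_
  have : CDGA.Hom.f F k ∘ₗ (g.hirsch r).gen = CDGA.Hom.f G k ∘ₗ (g.hirsch r).gen := by
    refine Finsupp.lhom_ext' fun γ => LinearMap.ext_ring ?_
    have := h₂ γ.1 γ.2.1
    rwa [gen_alive] at this
  exact LinearMap.congr_fun this

/-- The universal property of the Hirsch extension at a given index. -/
theorem exists_lift {B : CDGA.{u}} {r : Fin (n + 1)} (α : m.M.obj r ⟶ B) (y : Γ → B.X k)
    (hy : ∀ γ, g.birth γ ≤ r → B.d rfl (y γ) = CDGA.Hom.f α _ (g.v γ r))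
    (hw : ∀ γ, g.death γ ≤ r → y γ = CDGA.Hom.f α _ (g.w γ r)) :
    ∃ F : (g.hirsch r).ext ⟶ B, (g.hirsch r).incl ≫ F = α ∧
      ∀ γ, g.birth γ ≤ r → CDGA.Hom.f F k (g.gen γ r) = y γ := by
  let y' : (g.Alive r →₀ ℚ) →ₗ[ℚ] B.X k := Finsupp.linearCombination ℚ fun γ => y γ.1
  have hy' : ∀ c, B.d rfl (y' c) = CDGA.Hom.f α _ ((g.hirsch r).f c) := fun c => by
    change B.d rfl (Finsupp.linearCombination ℚ _ c) =
      CDGA.Hom.f α _ (Finsupp.linearCombination ℚ _ c)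
    rw [linearMap_eq _ _ _ fun γ : g.Alive r => hy γ.1 γ.2.1, linearMap_eq _ _ _ fun _ => rfl]
  refine ⟨(g.hirsch r).lift α y' hy', HirschData.incl_comp_lift _ _ _ _, fun γ h => ?_⟩
  by_cases hd : g.death γ ≤ r
  · rw [g.gen_dead hd, HirschData.lift_incl, hw γ hd]
  · rw [g.gen_alive ⟨γ, h, hd⟩, HirschData.lift_gen]
    exact (Finsupp.linearCombination_single ℚ _ _).trans (one_smul _ _)

/-- Since `gen` already becomes `w` at the death, sending `gen γ r` to `gen γ s` covers survival,
dying and being dead alike; the differentials match because `v` is compatible from the birth on. -/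
theorem exists_map {r s : Fin (n + 1)} (h : r ≤ s) :
    ∃ F : (g.hirsch r).ext ⟶ (g.hirsch s).ext,
      (g.hirsch r).incl ≫ F = m.M.map (homOfLE h) ≫ (g.hirsch s).incl ∧
      ∀ γ, g.birth γ ≤ r → CDGA.Hom.f F k (g.gen γ r) = g.gen γ s := by
  refine g.exists_lift _ (fun γ => g.gen γ s) (fun γ hγ => ?_) fun γ hγ => ?_
  · rw [g.d_gen (hγ.trans h), CDGA.comp_f, LinearMap.comp_apply, g.map_v γ h hγ]
  · rw [g.gen_dead (hγ.trans (WithTop.coe_le_coe.2 h)), CDGA.comp_f, LinearMap.comp_apply,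
      g.map_w γ h hγ]

/-- The structure maps of the extended sequence. -/
def map {r s : Fin (n + 1)} (h : r ≤ s) : (g.hirsch r).ext ⟶ (g.hirsch s).ext :=
  (g.exists_map h).choose

theorem incl_map {r s : Fin (n + 1)} (h : r ≤ s) :
    (g.hirsch r).incl ≫ g.map h = m.M.map (homOfLE h) ≫ (g.hirsch s).incl :=
  (g.exists_map h).choose_spec.1

theorem map_gen {r s : Fin (n + 1)} (h : r ≤ s) {γ : Γ} (hγ : g.birth γ ≤ r) :
    CDGA.Hom.f (g.map h) k (g.gen γ r) = g.gen γ s :=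
  (g.exists_map h).choose_spec.2 γ hγ

/-- The extended sequence. -/
def seq : ComposableArrows CDGA.{u} n where
  obj r := (g.hirsch r).ext
  map f := g.map (leOfHom f)
  map_id r := by
    refine g.hom_ext ?_ fun γ hγ => by rw [g.map_gen _ hγ]; rfl
    rw [g.incl_map, Category.comp_id]
    exact (congrArg (· ≫ _) (m.M.map_id r)).trans (Category.id_comp _)
  map_comp {r s u} e f := by
    refine g.hom_ext ?_ fun γ hγ => ?_
    · rw [g.incl_map, ← Category.assoc, g.incl_map, Category.assoc, g.incl_map, ← Category.assoc]
      exact congrArg (· ≫ _) (m.M.map_comp e f)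
    · rw [g.map_gen _ hγ, CDGA.comp_f, LinearMap.comp_apply, g.map_gen _ hγ,
        g.map_gen _ (hγ.trans (leOfHom e))]

/-- The map of the extended model at a given index. -/
def model (r : Fin (n + 1)) : (g.hirsch r).ext ⟶ A.obj (t r) :=
  (g.hirsch r).lift (m.m r) (Finsupp.linearCombination ℚ fun γ => g.a γ.1 r) fun c => by
    change _ = CDGA.Hom.f _ _ (Finsupp.linearCombination ℚ _ c)
    rw [linearMap_eq _ _ _ fun γ : g.Alive r => g.d_a γ.1 r γ.2.1,
      linearMap_eq _ _ _ fun _ => rfl]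

theorem incl_model (r : Fin (n + 1)) : (g.hirsch r).incl ≫ g.model r = m.m r :=
  HirschData.incl_comp_lift _ _ _ _

theorem model_alive {γ : Γ} {r : Fin (n + 1)} (h : g.birth γ ≤ r) (hd : ¬ g.death γ ≤ r) :
    CDGA.Hom.f (g.model r) k (g.gen γ r) = g.a γ r := by
  rw [g.gen_alive ⟨γ, h, hd⟩, model, HirschData.lift_gen]
  exact (Finsupp.linearCombination_single ℚ _ _).trans (one_smul _ _)

theorem model_dead {γ : Γ} {r : Fin (n + 1)} (hd : g.death γ ≤ r) :
    CDGA.Hom.f (g.model r) k (g.gen γ r) = CDGA.Hom.f (m.m r) k (g.w γ r) := by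
  rw [g.gen_dead hd, model, HirschData.lift_incl]

/-- The error term at the end of the homotopy: it is zero if `γ` survives, and if `γ` dies it comes
from the second component `b` of the element bounding the cocycle. -/
theorem exists_boundary {p : ℤ} (e : p + 1 = k) (r : Fin n) {γ : Γ}
    (h : g.birth γ ≤ r.castSucc) (hd : ¬ g.death γ ≤ r.castSucc) :
    ∃ b : (A.obj (t r.succ)).X p, CDGA.Hom.f (g.model r.succ) k (g.gen γ r.succ) =
      g.a γ r.succ + (A.obj (t r.succ)).d e b := by
  by_cases hd' : g.death γ ≤ r.succ
  · obtain ⟨b, hb⟩ := g.a_death e γ r hd hd'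
    exact ⟨b, by rw [g.model_dead hd', hb, sub_add_cancel]⟩
  · exact ⟨0, by rw [g.model_alive (h.trans r.castSucc_le_succ) hd', map_zero, add_zero]⟩

/-- On a living generator the homotopy is a primitive of `H(v)` in the path object starting at the
image of `a`. Its end value is right because `a_succ` builds `∫₀¹ H(v)` into the next `a`, and the
remaining boundary is the one from `exists_boundary`. -/
theorem exists_homotopy (r : Fin n) :
    ∃ H : CDGA.Homotopy
        (g.model r.castSucc ≫ A.map (homOfLE (t.monotone r.castSucc_le_succ)))
        (g.map r.castSucc_le_succ ≫ g.model r.succ),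
      (g.hirsch r.castSucc).incl ≫ H.map = (m.H r).map := by
  let P := (A.obj (t r.succ)).path
  have hz (γ : Γ) : P.d rfl (CDGA.Hom.f (m.H r).map _ (g.v γ r.castSucc)) = 0 := by
    rw [← CDGA.Hom.map_d, g.d_v, map_zero]
  have h0 (i : ℤ) (x) : CDGA.Hom.f ((A.obj (t r.succ)).pathEval 0) i
      (CDGA.Hom.f (m.H r).map i x) =
      CDGA.Hom.f (A.map (homOfLE (t.monotone r.castSucc_le_succ))) i
        (CDGA.Hom.f (m.m r.castSucc) i x) :=
    LinearMap.congr_fun (congrFun (congrArg CDGA.Hom.f (m.H r).map_zero) i) x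
  have hh (γ : g.Alive r.castSucc) : ∃ x : P.X k,
      P.d rfl x = CDGA.Hom.f (m.H r).map _ (g.v γ.1 r.castSucc) ∧
      CDGA.Hom.f ((A.obj (t r.succ)).pathEval 0) k x =
        CDGA.Hom.f (A.map (homOfLE (t.monotone r.castSucc_le_succ))) k (g.a γ.1 r.castSucc) ∧
      CDGA.Hom.f ((A.obj (t r.succ)).pathEval 1) k x =
        CDGA.Hom.f (g.model r.succ) k (g.gen γ.1 r.succ) := by
    obtain ⟨b, hb⟩ := g.exists_boundary (sub_add_cancel (k : ℤ) 1) r γ.2.1 γ.2.2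
    obtain ⟨x, hx, hx0, hx1⟩ := (A.obj (t r.succ)).exists_path_primitive (sub_add_cancel (k : ℤ) 1)
      rfl _ (hz γ.1) (CDGA.Hom.f (A.map (homOfLE (t.monotone r.castSucc_le_succ))) k
        (g.a γ.1 r.castSucc)) (by rw [h0, ← CDGA.Hom.map_d, g.d_a _ _ γ.2.1]) b
    exact ⟨x, hx, hx0, by rw [hx1, hb, g.a_succ _ _ γ.2.1]⟩
  choose x hx hx0 hx1 using hh
  have hy (c : g.Alive r.castSucc →₀ ℚ) : P.d rfl (Finsupp.linearCombination ℚ x c) =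
      CDGA.Hom.f (m.H r).map _ ((g.hirsch r.castSucc).f c) := by
    change _ = CDGA.Hom.f _ _ (Finsupp.linearCombination ℚ _ c)
    rw [linearMap_eq _ _ _ hx, linearMap_eq _ _ _ fun _ => rfl]
  let F := (g.hirsch r.castSucc).lift (m.H r).map (Finsupp.linearCombination ℚ x) hy
  have hF (γ : g.Alive r.castSucc) : CDGA.Hom.f F k (g.gen γ.1 r.castSucc) = x γ := by
    rw [g.gen_alive γ, HirschData.lift_gen]
    exact (Finsupp.linearCombination_single ℚ _ _).trans (one_smul _ _)
  -- Dead generators lie in the old algebra, so the end conditions need checking only on the living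
  -- ones.
  have hext {B : CDGA.{u}} {F G : (g.hirsch r.castSucc).ext ⟶ B}
      (h₁ : (g.hirsch r.castSucc).incl ≫ F = (g.hirsch r.castSucc).incl ≫ G)
      (h₂ : ∀ γ : g.Alive r.castSucc, CDGA.Hom.f F k (g.gen γ.1 r.castSucc) =
        CDGA.Hom.f G k (g.gen γ.1 r.castSucc)) : F = G := by
    refine g.hom_ext h₁ fun γ hγ => ?_
    by_cases hd : g.death γ ≤ r.castSucc
    · rw [g.gen_dead hd]
      exact LinearMap.congr_fun (congrFun (congrArg CDGA.Hom.f h₁) k) _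
    · exact h₂ ⟨γ, hγ, hd⟩
  refine ⟨⟨F, hext ?_ fun γ => ?_, hext ?_ fun γ => ?_⟩, HirschData.incl_comp_lift _ _ _ _⟩
  · rw [HirschData.incl_comp_lift_assoc, (m.H r).map_zero, ← Category.assoc, incl_model]
  · rw [CDGA.comp_f, LinearMap.comp_apply, hF, hx0, CDGA.comp_f, LinearMap.comp_apply,
      g.model_alive γ.2.1 γ.2.2]
  · rw [HirschData.incl_comp_lift_assoc, (m.H r).map_one, ← Category.assoc, incl_map,
      Category.assoc, incl_model]
  · rw [CDGA.comp_f, LinearMap.comp_apply, hF, hx1, CDGA.comp_f, LinearMap.comp_apply,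
      g.map_gen _ γ.2.1]

end TameGenerators

section Extend

variable {n : ℕ} {t : Fin (n + 1) ↪o ℝ≥0} {A : ℝ≥0 ⥤ CDGA.{u}} {k : ℕ}
  {m : TameMinimalModel t A (k - 1)} {Γ : Type u} (g : TameGenerators m k Γ)

/-- The extension of a tame minimal model along a system of generators. -/
def TameGenerators.extend (hA : ∀ x, (A.obj x).IsSimplyConnected) (hk : 1 ≤ k) :
    TameMinimalModel t A k where
  M := g.seq
  m := g.model
  isMinimalModel r := HirschData.isMinimalModel_lift (hA _) hk (m.isMinimalModel r) _ _ _
    (fun e c w b => g.inj r e c w b) (fun e z a => g.surj r e z a)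
  H r := (g.exists_homotopy r).choose

/-- The inclusion into the extension along a system of generators. -/
def TameGenerators.extension (hA : ∀ x, (A.obj x).IsSimplyConnected) (hk : 1 ≤ k) :
    m.Extension (g.extend hA hk) where
  incl := { app := fun r => (g.hirsch r).incl
            naturality := fun _ _ f => (g.incl_map (leOfHom f)).symm }
  comp_m r := g.incl_model r
  comp_H r := (g.exists_homotopy r).choose_spec

end Extend

/-! ### Step functors and the end points of their intervals -/

namespace StepExtension

variable {C : Type*} [Category C] {n : ℕ} (t : Fin (n + 1) ↪o ℝ≥0)

/-- An adjunction between indices and times, which reduces comparisons of times with discretization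
points to comparisons of indices. -/
theorem coe_le_index {r : Fin (n + 1)} {x : ℝ≥0} :
    (r : WithBot (Fin (n + 1))) ≤ index t x ↔ t r ≤ x := by
  constructor
  · intro h
    obtain ⟨s, hs⟩ : ∃ s : Fin (n + 1), index t x = s :=
      ⟨_, (WithBot.coe_unbot _ fun h0 => by rw [h0] at h; exact WithBot.not_coe_le_bot r h).symm⟩
    rw [hs, WithBot.coe_le_coe] at h
    have h1 := Finset.mem_of_max hs
    rw [Finset.mem_filter] at h1
    exact (t.monotone h).trans h1.2
  · intro h
    exact Finset.le_max (by simpa using h)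

theorem index_apply (r : Fin (n + 1)) : index t (t r) = r := by
  apply le_antisymm
  · refine Finset.max_le fun s hs => ?_
    simpa using hs
  · rw [coe_le_index]

theorem index_eq_coe {x : ℝ≥0} {r : Fin (n + 1)} (h : index t x = r) : t r ≤ x := by
  rw [← coe_le_index, h]

theorem isIso_map (F : ComposableArrows C n) {E : C} (hE : IsInitial E)
    {a b : WithBot (Fin (n + 1))} (h : a ≤ b) (e : a = b) : IsIso (map F hE h) := by
  subst e
  rw [map_self]
  infer_instance

theorem map_comp_eqToHom (F : ComposableArrows C n) {E : C} (hE : IsInitial E)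
    {a b : WithBot (Fin (n + 1))} (h : a ≤ b) {r s : Fin (n + 1)} (ha : a = r) (hb : b = s)
    (hrs : r ≤ s) : map F hE h ≫ eqToHom (congrArg (obj F E) hb) =
      eqToHom (congrArg (obj F E) ha) ≫ F.map (homOfLE hrs) := by
  subst ha hb
  simp only [eqToHom_refl]
  exact (Category.comp_id _).trans (Category.id_comp _).symm

end StepExtension

section Coproduct

variable {J : Type*} [Category J] {C : Type*} [Category C] {β : Type u} [HasCoproductsOfShape β C]

/-- Evaluation at `x` preserves coproducts of functors. -/
theorem sigma_app_hom_ext (F : β → J ⥤ C) {x : J} {Z : C} {f g : (∐ F).obj x ⟶ Z}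
    (h : ∀ b, (Sigma.ι F b).app x ≫ f = (Sigma.ι F b).app x ≫ g) : f = g :=
  (isColimitOfPreserves ((evaluation J C).obj x) (coproductIsCoproduct F)).hom_ext
    fun ⟨b⟩ => h b

end Coproduct

theorem PersistenceModule.hom_congr {V W : ℝ≥0 ⥤ ModuleCat.{u} ℚ} {f g : V ⟶ W} (h : f = g)
    (x : ℝ≥0) (y : V.obj x) : (f.app x).hom y = (g.app x).hom y := by rw [h]

/-- A persistence module which is a left Kan extension from `t₀ < ⋯ < t_n`. -/
structure IsStep {n : ℕ} (t : Fin (n + 1) ↪o ℝ≥0) (V : ℝ≥0 ⥤ ModuleCat.{u} ℚ) : Prop where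
  eq_zero : ∀ x, StepExtension.index t x = ⊥ → ∀ y : V.obj x, y = 0
  bijective : ∀ (r : Fin (n + 1)) (x : ℝ≥0) (h : t r ≤ x), StepExtension.index t x = r →
    Function.Bijective (V.map (homOfLE h)).hom

namespace IntervalDecomposition

variable {V : ℝ≥0 ⥤ ModuleCat.{u} ℚ} (D : IntervalDecomposition V)

/-- The inclusion of a summand. -/
def inj (γ : D.Γ) : (D.I γ).intervalModule ⟶ V := Sigma.ι (fun γ => (D.I γ).intervalModule) γ ≫ D.iso.inv

open Classical in
/-- The projection to a summand. -/
def proj (γ : D.Γ) : V ⟶ (D.I γ).intervalModule :=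
  D.iso.hom ≫ Sigma.desc (Pi.single γ (𝟙 _))

theorem inj_proj (γ : D.Γ) : D.inj γ ≫ D.proj γ = 𝟙 _ := by
  simp [inj, proj]

theorem inj_proj_ne {γ γ' : D.Γ} (h : γ ≠ γ') : D.inj γ ≫ D.proj γ' = 0 := by
  simp [inj, proj, h]

theorem hom_ext_app {x : ℝ≥0} {Z : ModuleCat.{u} ℚ} {f g : V.obj x ⟶ Z}
    (h : ∀ γ, (D.inj γ).app x ≫ f = (D.inj γ).app x ≫ g) : f = g := by
  rw [← cancel_epi (D.iso.inv.app x)]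
  refine sigma_app_hom_ext _ fun γ => ?_
  simpa [inj] using h γ

/-- The interval contains `x`. -/
def Mem (γ : D.Γ) (x : ℝ≥0) : Prop := (D.I γ).birth ≤ x ∧ (x : WithTop ℝ≥0) < (D.I γ).death

open Classical in
/-- The generator of an interval module. -/
def one (γ : D.Γ) (x : ℝ≥0) : gate (ULift.{u} ℚ) (D.Mem γ x) :=
  if h : D.Mem γ x then gateMk h ⟨1⟩ else 0

/-- The generator of a summand, as an element of the persistence module. -/
def elt (γ : D.Γ) (x : ℝ≥0) : V.obj x := ((D.inj γ).app x).hom (D.one γ x)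

theorem one_of_mem {γ : D.Γ} {x : ℝ≥0} (h : D.Mem γ x) : D.one γ x = gateMk h ⟨1⟩ := dif_pos h

theorem one_of_not_mem {γ : D.Γ} {x : ℝ≥0} (h : ¬ D.Mem γ x) : D.one γ x = 0 := dif_neg h

theorem elt_eq_zero {γ : D.Γ} {x : ℝ≥0} (h : ¬ D.Mem γ x) : D.elt γ x = 0 := by
  rw [elt, D.one_of_not_mem h]
  exact map_zero _

theorem map_one {γ : D.Γ} {x y : ℝ≥0} (h : x ≤ y) (hb : (D.I γ).birth ≤ x) :
    ((D.I γ).intervalModule.map (homOfLE h)).hom (D.one γ x) = D.one γ y := by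
  by_cases hy : (y : WithTop ℝ≥0) < (D.I γ).death
  · have hx : D.Mem γ x := ⟨hb, (WithTop.coe_le_coe.2 h).trans_lt hy⟩
    rw [D.one_of_mem hx, D.one_of_mem ⟨hb.trans h, hy⟩]
    dsimp only [PInterval.intervalModule]
    rw [dif_pos hy]
    rfl
  · rw [D.one_of_not_mem fun hm => hy hm.2]
    dsimp only [PInterval.intervalModule]
    rw [dif_neg hy]
    rfl

theorem map_elt {γ : D.Γ} {x y : ℝ≥0} (h : x ≤ y) (hb : (D.I γ).birth ≤ x) :
    (V.map (homOfLE h)).hom (D.elt γ x) = D.elt γ y := by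
  have := congrArg (fun f => f.hom (D.one γ x)) ((D.inj γ).naturality (homOfLE h))
  refine this.symm.trans ?_
  exact congrArg ((D.inj γ).app y).hom (D.map_one h hb)

theorem proj_elt (γ : D.Γ) (x : ℝ≥0) : ((D.proj γ).app x).hom (D.elt γ x) = D.one γ x :=
  PersistenceModule.hom_congr (D.inj_proj γ) x (D.one γ x)

theorem proj_elt_ne {γ γ' : D.Γ} (h : γ ≠ γ') (x : ℝ≥0) :
    ((D.proj γ').app x).hom (D.elt γ x) = 0 :=
  PersistenceModule.hom_congr (D.inj_proj_ne h) x (D.one γ x)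

theorem one_ne_zero {γ : D.Γ} {x : ℝ≥0} (h : D.Mem γ x) : D.one γ x ≠ 0 := by
  rw [D.one_of_mem h]
  intro h0
  have : (1 : ℚ) = 0 := congrArg (fun z => ULift.down z.1) h0
  exact _root_.one_ne_zero this

theorem elt_ne_zero {γ : D.Γ} {x : ℝ≥0} (h : D.Mem γ x) : D.elt γ x ≠ 0 := fun h0 =>
  D.one_ne_zero h (by rw [← D.proj_elt, h0]; exact map_zero _)

/-- The generators alive at `x` span. -/
theorem span_elt {x : ℝ≥0} (P : D.Γ → Prop) (hP : ∀ γ, P γ ↔ D.Mem γ x) (y : V.obj x) :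
    ∃ c : {γ // P γ} →₀ ℚ, y = Finsupp.linearCombination ℚ (fun γ => D.elt γ.1 x) c := by
  let R : Submodule ℚ (V.obj x) :=
    LinearMap.range (Finsupp.linearCombination ℚ (fun γ : {γ // P γ} => D.elt γ.1 x))
  -- The projection modulo the span vanishes on each summand, hence everywhere.
  have hR : ModuleCat.ofHom R.mkQ = 0 := by
    refine D.hom_ext_app fun γ => ?_
    rw [comp_zero]
    refine ModuleCat.hom_ext (LinearMap.ext fun z => (Submodule.Quotient.mk_eq_zero R).2 ?_)
    change gate (ULift.{u} ℚ) (D.Mem γ x) at z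
    by_cases h : D.Mem γ x
    · refine ⟨Finsupp.single ⟨γ, (hP γ).2 h⟩ z.1.down, ?_⟩
      have hz : z = z.1.down • D.one γ x := by
        rw [D.one_of_mem h]
        exact Subtype.ext (ULift.ext _ _ (mul_one z.1.down).symm)
      refine (Finsupp.linearCombination_single ℚ _ _).trans ?_
      conv_rhs => rw [hz]
      exact (map_smul _ _ _).symm
    · rw [gate_eq_zero h z]
      exact (map_zero ((D.inj γ).app x).hom) ▸ zero_mem R
  obtain ⟨c, hc⟩ := (Submodule.Quotient.mk_eq_zero R).1
    (congrArg (fun f => f.hom y) hR : R.mkQ y = 0)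
  exact ⟨c, hc.symm⟩

/-- The projection to the summand `γ` kills all other generators and isolates the coefficient of
`γ`. -/
theorem linearIndependent_elt {x : ℝ≥0} (P : D.Γ → Prop) (hP : ∀ γ, P γ ↔ D.Mem γ x)
    (c : {γ // P γ} →₀ ℚ)
    (hc : Finsupp.linearCombination ℚ (fun γ => D.elt γ.1 x) c = 0) : c = 0 := by
  ext γ
  have h1 := congrArg ((D.proj γ.1).app x).hom hc
  rw [map_zero, Finsupp.linearCombination_apply, map_finsuppSum, Finsupp.sum] at h1
  have h2 : ∑ γ' ∈ c.support, ((D.proj γ.1).app x).hom (c γ' • D.elt γ'.1 x) =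
      c γ • ((D.proj γ.1).app x).hom (D.elt γ.1 x) := by
    rw [Finset.sum_eq_single γ]
    · exact map_smul _ _ _
    · intro γ' _ hne
      rw [map_smul, D.proj_elt_ne fun h => hne (Subtype.ext h), smul_zero]
    · intro h
      rw [Finsupp.notMem_support_iff.1 h, zero_smul, map_zero]
  rw [h2, D.proj_elt] at h1
  exact (smul_eq_zero.1 h1).resolve_right (D.one_ne_zero ((hP _).1 γ.2))

variable {n : ℕ} {t : Fin (n + 1) ↪o ℝ≥0}

/-- If the birth fell strictly after the last `t_b` before it, the generator would come from
`V(t_b)` by surjectivity, where its `γ`-component is zero. -/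
theorem exists_birth (hV : IsStep t V) (γ : D.Γ) : ∃ b, (D.I γ).birth = t b := by
  set x := (D.I γ).birth with hx
  have hmem : D.Mem γ x := ⟨le_rfl, (D.I γ).lt⟩
  rcases hi : StepExtension.index t x with _ | b
  · exact absurd (hV.eq_zero x hi _) (D.elt_ne_zero hmem)
  · have hb := StepExtension.index_eq_coe t hi
    refine ⟨b, hb.eq_or_lt.elim Eq.symm fun hlt => ?_⟩
    obtain ⟨u, hu⟩ := (hV.bijective b x hb hi).2 (D.elt γ x)
    have h1 := congrArg (fun f => f.hom u) ((D.proj γ).naturality (homOfLE hb))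
    have h2 : ((D.proj γ).app (t b)).hom u = 0 :=
      gate_eq_zero (P := D.Mem γ (t b)) (fun h => absurd h.1 (not_le.2 hlt)) _
    have h3 : ((D.proj γ).app x).hom ((V.map (homOfLE hb)).hom u) = 0 :=
      h1.trans ((congrArg _ h2).trans (map_zero ((D.I γ).intervalModule.map (homOfLE hb)).hom))
    rw [hu, D.proj_elt] at h3
    exact absurd h3 (D.one_ne_zero hmem)

/-- If a finite death fell strictly after the last `t_r` before it, the generator, nonzero at `t_r`,
would be killed by an injective map. -/
theorem exists_death (hV : IsStep t V) (γ : D.Γ) :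
    ∃ d : WithTop (Fin (n + 1)), (D.I γ).death = d.map t := by
  obtain ⟨b, hb⟩ := D.exists_birth hV γ
  rcases hq : (D.I γ).death with _ | q
  · exact ⟨⊤, rfl⟩
  have hlt : t b < q := by
    have := (D.I γ).lt
    rw [hq, hb] at this
    exact WithTop.coe_lt_coe.1 this
  rcases hi : StepExtension.index t q with _ | r
  · have := (StepExtension.coe_le_index t).2 hlt.le
    rw [hi] at this
    exact absurd this (WithBot.not_coe_le_bot b)
  · have hr := StepExtension.index_eq_coe t hi
    refine ⟨r, congrArg WithTop.some (hr.eq_or_lt.elim Eq.symm fun hlt' => ?_)⟩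
    have hbr : b ≤ r := by
      have := (StepExtension.coe_le_index t).2 hlt.le
      rw [hi] at this
      exact WithBot.coe_le_coe.1 this
    have hb' : (D.I γ).birth ≤ t r := hb.le.trans (t.monotone hbr)
    have hmem : D.Mem γ (t r) := ⟨hb', by rw [hq]; exact WithTop.coe_lt_coe.2 hlt'⟩
    have h0 : D.elt γ q = 0 := D.elt_eq_zero fun h => by
      have := h.2
      rw [hq] at this
      exact lt_irrefl _ this
    rw [← D.map_elt hr hb'] at h0
    exact absurd ((hV.bijective r q hr hi).1 (h0.trans (map_zero _).symm)) (D.elt_ne_zero hmem)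

end IntervalDecomposition

/-! ### Cohomology of the tame cone -/

section StepHomology

variable {n : ℕ} (t : Fin (n + 1) ↪o ℝ≥0) (F : ComposableArrows Cplx.{u} n) {E : Cplx.{u}}
  (hE : IsInitial E) (k : ℤ)

/-- The cohomology of the left Kan extension of a sequence of complexes. -/
abbrev stepHomology : ℝ≥0 ⥤ ModuleCat.{u} ℚ :=
  stepExtension t F hE ⋙ HomologicalComplex.homologyFunctor (ModuleCat.{u} ℚ) (ComplexShape.up ℤ) k

/-- The complex is zero before `t_0`, and two times with the same index are joined by an
isomorphism; cohomology preserves both. -/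
theorem isStep_stepHomology (hE0 : IsZero E) : IsStep t (stepHomology t F hE k) where
  eq_zero x hx y := by
    have h0 : IsZero ((stepHomology t F hE k).obj x) := by
      change IsZero ((HomologicalComplex.homologyFunctor _ _ k).obj
        (StepExtension.obj F E (StepExtension.index t x)))
      rw [hx]
      exact Functor.map_isZero _ hE0
    have := ModuleCat.subsingleton_of_isZero h0
    exact Subsingleton.elim _ _
  bijective r x h hx := by
    have : IsIso ((stepExtension t F hE).map (homOfLE h)) :=
      StepExtension.isIso_map F hE _ ((StepExtension.index_apply t r).trans hx.symm)
    have : IsIso ((stepHomology t F hE k).map (homOfLE h)) :=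
      inferInstanceAs (IsIso ((HomologicalComplex.homologyFunctor _ _ k).map
        ((stepExtension t F hE).map (homOfLE h))))
    exact ConcreteCategory.bijective_of_isIso ((stepHomology t F hE k).map (homOfLE h))

/-- The value of a step extension at `t_r`. -/
def stepIso (r : Fin (n + 1)) : F.obj r ≅ (stepExtension t F hE).obj (t r) :=
  eqToIso (congrArg (StepExtension.obj F E) (StepExtension.index_apply t r).symm)

theorem stepIso_naturality {r s : Fin (n + 1)} (h : r ≤ s) :
    F.map (homOfLE h) ≫ (stepIso t F hE s).hom =
      (stepIso t F hE r).hom ≫ (stepExtension t F hE).map (homOfLE (t.monotone h)) := by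
  have h1 := StepExtension.map_comp_eqToHom F hE (StepExtension.index_mono t (t.monotone h))
    (StepExtension.index_apply t r) (StepExtension.index_apply t s) h
  rw [← cancel_mono (stepIso t F hE s).inv, Category.assoc, Category.assoc, Iso.hom_inv_id,
    Category.comp_id, ← Iso.inv_comp_eq]
  exact h1.symm

variable {F}

/-- The class of a cocycle at the index `r`. -/
def stepCls (r : Fin (n + 1)) :
    LinearMap.ker ((F.obj r).d k (k + 1)).hom →ₗ[ℚ] (stepHomology t F hE k).obj (t r) :=
  (HomologicalComplex.homologyMap (stepIso t F hE r).hom k).hom ∘ₗ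
    Cocycle.cls (F.obj r) rfl

theorem stepCls_surjective (r : Fin (n + 1)) : Function.Surjective (stepCls t (F := F) hE k r) :=
  (ConcreteCategory.bijective_of_isIso
    ((HomologicalComplex.homologyFunctor _ _ k).map (stepIso t F hE r).hom)).2.comp
    (Cocycle.cls_surjective rfl)

theorem stepCls_eq_zero_iff (r : Fin (n + 1)) {p : ℤ} (e : p + 1 = k)
    (x : LinearMap.ker ((F.obj r).d k (k + 1)).hom) :
    stepCls t hE k r x = 0 ↔ ∃ y : (F.obj r).X p, ((F.obj r).d p k).hom y = x.1 := by
  rw [← Cocycle.cls_eq_zero_iff rfl e]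
  have hinj := (ConcreteCategory.bijective_of_isIso
    ((HomologicalComplex.homologyFunctor _ _ k).map (stepIso t F hE r).hom)).1
  exact ⟨fun h => hinj (h.trans (map_zero _).symm), fun h =>
    (congrArg (HomologicalComplex.homologyMap (stepIso t F hE r).hom k).hom h).trans
      (map_zero (HomologicalComplex.homologyMap (stepIso t F hE r).hom k).hom)⟩

theorem map_stepCls {r s : Fin (n + 1)} (h : r ≤ s)
    (x : LinearMap.ker ((F.obj r).d k (k + 1)).hom) :
    ((stepHomology t F hE k).map (homOfLE (t.monotone h))).hom (stepCls t hE k r x) =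
      stepCls t hE k s ⟨((F.map (homOfLE h)).f k).hom x.1, Cocycle.map_mem_ker _ x.2⟩ := by
  have h1 := congrArg ((HomologicalComplex.homologyFunctor _ _ k).map) (stepIso_naturality t F hE h)
  rw [Functor.map_comp, Functor.map_comp] at h1
  have h2 := congrArg (fun f => f.hom (Cocycle.cls (F.obj r) rfl x)) h1
  refine h2.symm.trans ?_
  exact congrArg ((HomologicalComplex.homologyFunctor _ _ k).map (stepIso t F hE s).hom).hom
    (Cocycle.homologyMap_cls (F.map (homOfLE h)) rfl x)

end StepHomology

namespace TameMinimalModel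

variable {n : ℕ} {t : Fin (n + 1) ↪o ℝ≥0} {A : ℝ≥0 ⥤ CDGA.{u}} {l : ℕ}
  (m : TameMinimalModel t A l)

/-- The sequence of mapping cones. -/
abbrev coneSeq : ComposableArrows Cplx.{u} n :=
  ComposableArrows.mkOfObjOfMapSucc (fun r => cone (m.m r)) fun r => coneMap _ _ (m.H r)

/-- Elements of the mapping cones as pairs. -/
abbrev ConeX (r : Fin (n + 1)) (k : ℤ) : Type u := (m.M.obj r).X (k + 1) × (A.obj (t r)).X k

/-- The structure maps of the sequence of mapping cones. -/
def coneSeqMap {r s : Fin (n + 1)} (h : r ≤ s) (k : ℤ) : m.ConeX r k →ₗ[ℚ] m.ConeX s k :=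
  ((m.coneSeq.map (homOfLE h)).f k).hom

theorem coneSeqMap_succ (r : Fin n) (k : ℤ) (x : m.ConeX r.castSucc k) :
    m.coneSeqMap r.castSucc_le_succ k x =
      (CDGA.Hom.f (m.M.map (homOfLE r.castSucc_le_succ)) _ x.1,
        CDGA.Hom.f (A.map (homOfLE (t.monotone r.castSucc_le_succ))) k x.2 +
          (A.obj (t r.succ)).pathIntegral rfl (CDGA.Hom.f (m.H r).map _ x.1)) := by
  have := ComposableArrows.mkOfObjOfMapSucc_map_succ (fun r => cone (m.m r))
    (fun r => coneMap _ _ (m.H r)) r.1 r.2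
  exact congrArg (fun f : cone (m.m r.castSucc) ⟶ cone (m.m r.succ) => (f.f k).hom x) this

theorem coneSeqMap_self (r : Fin (n + 1)) (k : ℤ) (x : m.ConeX r k) :
    m.coneSeqMap le_rfl k x = x :=
  congrArg (fun f : cone (m.m r) ⟶ cone (m.m r) => (f.f k).hom x) (m.coneSeq.map_id r)

theorem coneSeqMap_trans {r s u : Fin (n + 1)} (h : r ≤ s) (h' : s ≤ u) (k : ℤ)
    (x : m.ConeX r k) :
    m.coneSeqMap h' k (m.coneSeqMap h k x) = m.coneSeqMap (h.trans h') k x :=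
  (congrArg (fun f : cone (m.m r) ⟶ cone (m.m u) => (f.f k).hom x)
    (m.coneSeq.map_comp (homOfLE h) (homOfLE h'))).symm

/-- The homotopies enter only the second component of the cone maps, so the first is strictly
functorial; induct over single steps. -/
theorem coneSeqMap_fst {r s : Fin (n + 1)} (h : r ≤ s) (k : ℤ) (x : m.ConeX r k) :
    (m.coneSeqMap h k x).1 = CDGA.Hom.f (m.M.map (homOfLE h)) _ x.1 := by
  induction s using Fin.induction with
  | zero =>
    obtain rfl : r = 0 := le_antisymm h (Fin.zero_le r)
    rw [coneSeqMap_self]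
    exact (congrArg (fun f => CDGA.Hom.f f _ x.1) (m.M.map_id 0)).symm
  | succ s ih =>
    rcases h.eq_or_lt with rfl | hlt
    · rw [coneSeqMap_self]
      exact (congrArg (fun f => CDGA.Hom.f f _ x.1) (m.M.map_id _)).symm
    · have h' : r ≤ s.castSucc := Fin.le_castSucc_iff.2 hlt
      rw [← m.coneSeqMap_trans h' s.castSucc_le_succ, coneSeqMap_succ, ih h']
      exact (congrArg (fun f => CDGA.Hom.f f _ x.1)
        (m.M.map_comp (homOfLE h') (homOfLE s.castSucc_le_succ))).symm

/-- Cocycles of the mapping cones. -/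
def IsConeCocycle {r : Fin (n + 1)} {k : ℤ} (x : m.ConeX r k) : Prop :=
  (m.M.obj r).d rfl x.1 = 0 ∧ CDGA.Hom.f (m.m r) _ x.1 = (A.obj (t r)).d rfl x.2

theorem isConeCocycle_iff {r : Fin (n + 1)} {k : ℤ} (x : m.ConeX r k) :
    m.IsConeCocycle x ↔ x ∈ LinearMap.ker ((cone (m.m r)).d k (k + 1)).hom := by
  have := cone_d_hom (m.m r) rfl x
  constructor
  · rintro ⟨h1, h2⟩
    refine this.trans (Prod.ext h1 ?_)
    exact sub_eq_zero.2 h2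
  · intro h
    have h0 := Prod.ext_iff.1 (this.symm.trans h)
    exact ⟨h0.1, sub_eq_zero.1 h0.2⟩

variable {m}

theorem IsConeCocycle.map {r s : Fin (n + 1)} (h : r ≤ s) {k : ℤ} {x : m.ConeX r k}
    (hx : m.IsConeCocycle x) : m.IsConeCocycle (m.coneSeqMap h k x) :=
  (m.isConeCocycle_iff _).2 (Cocycle.map_mem_ker (m.coneSeq.map (homOfLE h))
    ((m.isConeCocycle_iff _).1 hx))

variable (m)

/-- The class of a cocycle of a mapping cone in the cohomology of the tame cone. -/
def coneCls (r : Fin (n + 1)) (k : ℤ) :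
    LinearMap.ker ((cone (m.m r)).d k (k + 1)).hom →ₗ[ℚ] (m.coneCohomology k).obj (t r) :=
  stepCls t (F := m.coneSeq) (isZero_zero Cplx.{u}).isInitial k r

theorem isStep_coneCohomology (k : ℤ) : IsStep t (m.coneCohomology k) :=
  isStep_stepHomology t m.coneSeq _ k (isZero_zero _)

theorem exists_coneCls (r : Fin (n + 1)) (k : ℤ) (y : (m.coneCohomology k).obj (t r)) :
    ∃ (x : m.ConeX r k) (hx : m.IsConeCocycle x),
      m.coneCls r k ⟨x, (m.isConeCocycle_iff x).1 hx⟩ = y := by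
  obtain ⟨⟨x, hx⟩, h⟩ := stepCls_surjective t (F := m.coneSeq)
    (isZero_zero Cplx.{u}).isInitial k r y
  exact ⟨x, (m.isConeCocycle_iff x).2 hx, h⟩

theorem map_coneCls {r s : Fin (n + 1)} (h : r ≤ s) {k : ℤ} {x : m.ConeX r k}
    (hx : m.IsConeCocycle x) :
    ((m.coneCohomology k).map (homOfLE (t.monotone h))).hom
      (m.coneCls r k ⟨x, (m.isConeCocycle_iff x).1 hx⟩) =
      m.coneCls s k ⟨m.coneSeqMap h k x, (m.isConeCocycle_iff _).1 (hx.map h)⟩ :=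
  map_stepCls t (F := m.coneSeq) (isZero_zero Cplx.{u}).isInitial k h _

theorem coneCls_eq_zero_iff {r : Fin (n + 1)} {k p : ℤ} (e : p + 1 = k)
    (x : LinearMap.ker ((cone (m.m r)).d k (k + 1)).hom) :
    m.coneCls r k x = 0 ↔ ∃ (w : (m.M.obj r).X k) (b : (A.obj (t r)).X p),
      x.1 = (((m.M.obj r).d rfl w, CDGA.Hom.f (m.m r) k w - (A.obj (t r)).d e b) : m.ConeX r k) := by
  refine (stepCls_eq_zero_iff t (F := m.coneSeq) (isZero_zero Cplx.{u}).isInitial k r e x).trans ?_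
  subst e
  constructor
  · rintro ⟨y, hy⟩
    exact ⟨y.1, y.2, hy.symm.trans (cone_d_hom (m.m r) rfl y)⟩
  · rintro ⟨w, b, h⟩
    exact ⟨(w, b), (cone_d_hom (m.m r) rfl (w, b)).trans h.symm⟩

end TameMinimalModel

/-! ### Generators from an interval decomposition -/

namespace TameMinimalModel

variable {n : ℕ} {t : Fin (n + 1) ↪o ℝ≥0} {A : ℝ≥0 ⥤ CDGA.{u}} {l : ℕ}
  (m : TameMinimalModel t A l)

/-- A family of cocycles of the mapping cones which starts at index `b`. -/
def coneFamily {k : ℤ} {b : Fin (n + 1)} (x : m.ConeX b k) (r : Fin (n + 1)) : m.ConeX r k :=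
  if h : b ≤ r then m.coneSeqMap h k x else 0

variable {m}

theorem coneFamily_of_le {k : ℤ} {b : Fin (n + 1)} (x : m.ConeX b k) {r : Fin (n + 1)}
    (h : b ≤ r) : m.coneFamily x r = m.coneSeqMap h k x := dif_pos h

theorem isConeCocycle_coneFamily {k : ℤ} {b : Fin (n + 1)} {x : m.ConeX b k}
    (hx : m.IsConeCocycle x) (r : Fin (n + 1)) : m.IsConeCocycle (m.coneFamily x r) := by
  by_cases h : b ≤ r
  · rw [coneFamily_of_le x h]
    exact hx.map h
  · rw [coneFamily, dif_neg h, isConeCocycle_iff]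
    exact zero_mem _

theorem coneSeqMap_coneFamily {k : ℤ} {b : Fin (n + 1)} (x : m.ConeX b k) {r s : Fin (n + 1)}
    (hb : b ≤ r) (h : r ≤ s) : m.coneSeqMap h k (m.coneFamily x r) = m.coneFamily x s := by
  rw [coneFamily_of_le x hb, coneFamily_of_le x (hb.trans h), coneSeqMap_trans]

/-- Choose a cone element `(w, b)` bounding the cocycle at the index `d` only, and push `w` forward.
It keeps bounding the first component, which is strictly functorial. For `d = ∞` nothing is
required. -/
theorem exists_bounding {k : ℕ} {b : Fin (n + 1)} {x : m.ConeX b k} (hx : m.IsConeCocycle x)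
    (d : WithTop (Fin (n + 1))) (hd : ∀ r : Fin (n + 1), d = r → b ≤ r ∧ m.coneCls r k
      ⟨m.coneFamily x r, (m.isConeCocycle_iff _).1 (isConeCocycle_coneFamily hx r)⟩ = 0) :
    ∃ w : ∀ r, (m.M.obj r).X k,
      (∀ r : Fin (n + 1), d ≤ r → (m.M.obj r).d rfl (w r) = (m.coneFamily x r).1) ∧
      (∀ {r s : Fin (n + 1)} (h : r ≤ s), d ≤ r →
        CDGA.Hom.f (m.M.map (homOfLE h)) _ (w r) = w s) ∧
      ∀ {p : ℤ} (e : p + 1 = k) (r : Fin (n + 1)), d = r →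
        ∃ b : (A.obj (t r)).X p,
          (m.coneFamily x r).2 = CDGA.Hom.f (m.m r) _ (w r) - (A.obj (t r)).d e b := by
  cases d with
  | top =>
    exact ⟨fun _ => 0, fun r h => absurd h (WithTop.not_top_le_coe r),
      fun {r} _ _ h => absurd h (WithTop.not_top_le_coe r),
      fun _ _ h => absurd h WithTop.top_ne_coe⟩
  | coe d =>
    obtain ⟨hbd, h0⟩ := hd d rfl
    obtain ⟨w, b, hwb⟩ := (m.coneCls_eq_zero_iff (sub_add_cancel (k : ℤ) 1) _).1 h0
    obtain ⟨w', hw⟩ : ∃ w' : ∀ r, (m.M.obj r).X k,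
        ∀ r (h : d ≤ r), w' r = CDGA.Hom.f (m.M.map (homOfLE h)) k w :=
      ⟨fun r => if h : d ≤ r then CDGA.Hom.f (m.M.map (homOfLE h)) k w else 0,
        fun r h => dif_pos h⟩
    refine ⟨w', fun r h => ?_, fun {r s} h h' => ?_, fun {p} e r h => ?_⟩
    · have h := WithTop.coe_le_coe.1 h
      rw [hw r h, ← CDGA.Hom.map_d]
      refine (congrArg _ (congrArg Prod.fst hwb).symm).trans ?_
      exact (m.coneSeqMap_fst h k _).symm.trans
        (congrArg Prod.fst (coneSeqMap_coneFamily x hbd h))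
    · have h' := WithTop.coe_le_coe.1 h'
      rw [hw r h', hw s (h'.trans h)]
      exact (congrArg (fun f => CDGA.Hom.f f _ w) (m.M.map_comp (homOfLE h') (homOfLE h))).symm
    · obtain rfl := WithTop.coe_injective h
      obtain rfl : p = k - 1 := by omega
      refine ⟨b, (congrArg Prod.snd hwb).trans ?_⟩
      rw [hw d le_rfl]
      exact congrArg (fun f => CDGA.Hom.f (m.m d) _ (CDGA.Hom.f f _ w) - _) (m.M.map_id d).symm

end TameMinimalModel

theorem Finsupp.linearCombination_prodMk {α V W : Type*} [AddCommGroup V] [Module ℚ V]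
    [AddCommGroup W] [Module ℚ W] (x : α → V × W) (c : α →₀ ℚ) :
    Finsupp.linearCombination ℚ x c = (Finsupp.linearCombination ℚ (fun i => (x i).1) c,
      Finsupp.linearCombination ℚ (fun i => (x i).2) c) :=
  Prod.ext (TameGenerators.linearMap_eq (LinearMap.fst ℚ V W) _ _ (fun _ => rfl) c)
    (TameGenerators.linearMap_eq (LinearMap.snd ℚ V W) _ _ (fun _ => rfl) c)

section Generators

variable {n : ℕ} {t : Fin (n + 1) ↪o ℝ≥0} {A : ℝ≥0 ⥤ CDGA.{u}} {l : ℕ}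
  {m : TameMinimalModel t A l} {k : ℕ}

theorem IntervalDecomposition.mem_iff {V : ℝ≥0 ⥤ ModuleCat.{u} ℚ} (D : IntervalDecomposition V)
    {γ : D.Γ} {b : Fin (n + 1)} {d : WithTop (Fin (n + 1))} (hb : (D.I γ).birth = t b)
    (hd : (D.I γ).death = d.map t) (r : Fin (n + 1)) : b ≤ r ∧ ¬ d ≤ r ↔ D.Mem γ (t r) := by
  rw [IntervalDecomposition.Mem, hb, hd, t.le_iff_le, not_le]
  refine and_congr_right fun _ => ?_
  cases d with
  | top => exact iff_of_true (WithTop.coe_lt_top r) (WithTop.coe_lt_top (t r))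
  | coe d => exact WithTop.coe_lt_coe.trans (t.lt_iff_lt.symm.trans WithTop.coe_lt_coe.symm)

/-- Each generator is represented once, at its birth; transporting that single cocycle makes the
family strictly compatible, while its classes are the generators of `D` at all later indices. Hence
the class vanishes at the death, and the living ones form a basis. -/
theorem TameGenerators.exists_of_decomposition (D : IntervalDecomposition (m.coneCohomology k)) :
    ∃ g : TameGenerators m k D.Γ, (∀ γ, (D.I γ).birth = t (g.birth γ)) ∧
      ∀ γ, (D.I γ).death = (g.death γ).map t := by
  have hV := m.isStep_coneCohomology k
  choose birth hbirth using D.exists_birth hV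
  choose death hdeath using D.exists_death hV
  choose x hx hcls using fun γ => m.exists_coneCls (birth γ) k (D.elt γ (t (birth γ)))
  obtain ⟨z, hzx⟩ : ∃ z : D.Γ → ∀ r, m.ConeX r k, ∀ γ r, z γ r = m.coneFamily (x γ) r :=
    ⟨_, fun _ _ => rfl⟩
  have hz (γ r) : m.IsConeCocycle (z γ r) := by
    rw [hzx]
    exact TameMinimalModel.isConeCocycle_coneFamily (hx γ) r
  have hzk (γ r) := (m.isConeCocycle_iff (z γ r)).1 (hz γ r)
  have hzcls (γ r) (h : birth γ ≤ r) : m.coneCls r k ⟨z γ r, hzk γ r⟩ = D.elt γ (t r) := by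
    rw [← D.map_elt (t.monotone h) (hbirth γ).le, ← hcls γ, m.map_coneCls h (hx γ)]
    congr 2
    exact (hzx γ r).trans (TameMinimalModel.coneFamily_of_le _ h)
  have hmem (γ r) : birth γ ≤ r ∧ ¬ death γ ≤ r ↔ D.Mem γ (t r) :=
    D.mem_iff (hbirth γ) (hdeath γ) r
  have hlt (γ) : (birth γ : WithTop (Fin (n + 1))) < death γ := by
    have := ((hmem γ (birth γ)).2 ⟨(hbirth γ).le, by rw [← hbirth γ]; exact (D.I γ).lt⟩).2
    exact not_le.1 this
  have hw (γ) := TameMinimalModel.exists_bounding (hx γ) (death γ) fun d hd => by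
    have hbd : birth γ ≤ d := by
      have := hlt γ
      rw [hd] at this
      exact (WithTop.coe_lt_coe.1 this).le
    refine ⟨hbd, ?_⟩
    simp only [← hzx]
    refine ((hzcls γ d hbd).trans (D.elt_eq_zero ?_))
    rw [← hmem, hd]
    exact fun h => h.2 le_rfl
  simp only [← hzx] at hw
  choose w hdw hmw hbw using hw
  have hcomb (r : Fin (n + 1)) (c : {γ // birth γ ≤ r ∧ ¬ death γ ≤ r} →₀ ℚ) :
      m.coneCls r k (Finsupp.linearCombination ℚ (fun γ => ⟨z γ.1 r, hzk γ.1 r⟩) c) =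
        Finsupp.linearCombination ℚ (fun γ => D.elt γ.1 (t r)) c :=
    TameGenerators.linearMap_eq _ _ _
      (fun γ : {γ // birth γ ≤ r ∧ ¬ death γ ≤ r} => hzcls γ.1 r γ.2.1) c
  -- A combination of cocycles is computed componentwise, so statements about classes become the
  -- paired equations required of the generators.
  have hval (r : Fin (n + 1)) (c : {γ // birth γ ≤ r ∧ ¬ death γ ≤ r} →₀ ℚ) :
      (Finsupp.linearCombination ℚ (fun γ : {γ // birth γ ≤ r ∧ ¬ death γ ≤ r} =>
        (⟨z γ.1 r, hzk γ.1 r⟩ : LinearMap.ker ((cone (m.m r)).d k (k + 1)).hom)) c).1 =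
      ((Finsupp.linearCombination ℚ (fun γ => (z γ.1 r).1) c,
        Finsupp.linearCombination ℚ (fun γ => (z γ.1 r).2) c) : m.ConeX r k) :=
    (TameGenerators.linearMap_eq
      (LinearMap.ker ((cone (m.m r)).d k (k + 1)).hom).subtype _ (fun γ => z γ.1 r) (fun _ => rfl) c).trans
      (Finsupp.linearCombination_prodMk _ c)
  have hinj (r : Fin (n + 1)) {p : ℤ} (e : p + 1 = k)
      (c : {γ // birth γ ≤ r ∧ ¬ death γ ≤ r} →₀ ℚ) (x : (m.M.obj r).X k) (b : (A.obj (t r)).X p)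
      (h1 : Finsupp.linearCombination ℚ (fun γ => (z γ.1 r).1) c = (m.M.obj r).d rfl x)
      (h2 : Finsupp.linearCombination ℚ (fun γ => (z γ.1 r).2) c =
        CDGA.Hom.f (m.m r) k x - (A.obj (t r)).d e b) : c = 0 := by
    refine D.linearIndependent_elt _ (fun γ => hmem γ r) c ?_
    rw [← hcomb, m.coneCls_eq_zero_iff e]
    exact ⟨x, b, (hval r c).trans (Prod.ext h1 h2)⟩
  have hsurj (r : Fin (n + 1)) {p : ℤ} (e : p + 1 = k) (z' : (m.M.obj r).X (k + 1))
      (y : (A.obj (t r)).X k) (h1 : (m.M.obj r).d rfl z' = 0)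
      (h2 : CDGA.Hom.f (m.m r) _ z' = (A.obj (t r)).d rfl y) :
      ∃ (c : {γ // birth γ ≤ r ∧ ¬ death γ ≤ r} →₀ ℚ) (x : (m.M.obj r).X k)
        (b : (A.obj (t r)).X p),
        z' = Finsupp.linearCombination ℚ (fun γ => (z γ.1 r).1) c + (m.M.obj r).d rfl x ∧
        y = Finsupp.linearCombination ℚ (fun γ => (z γ.1 r).2) c +
          CDGA.Hom.f (m.m r) k x - (A.obj (t r)).d e b := by
    have hc : m.IsConeCocycle ((z', y) : m.ConeX r k) := ⟨h1, h2⟩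
    obtain ⟨c, hc'⟩ := D.span_elt _ (fun γ => hmem γ r)
      (m.coneCls r k ⟨(z', y), (m.isConeCocycle_iff _).1 hc⟩)
    rw [← hcomb, ← sub_eq_zero, ← map_sub, m.coneCls_eq_zero_iff e] at hc'
    obtain ⟨x, b, h⟩ := hc'
    have h' := (congrArg (fun u => ((z', y) : m.ConeX r k) - u) (hval r c)).symm.trans h
    refine ⟨c, x, b, ?_, ?_⟩
    · exact sub_eq_iff_eq_add'.1 (congrArg Prod.fst h')
    · rw [add_sub_assoc]
      exact sub_eq_iff_eq_add'.1 (congrArg Prod.snd h')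
  -- Dying between `r` and `r + 1` means that the death index is exactly `r + 1`, the one index
  -- where a bounding pair was chosen.
  have hdeath_succ (γ) (r : Fin n) (h : ¬ death γ ≤ r.castSucc) (h' : death γ ≤ r.succ) :
      death γ = r.succ := by
    rcases hd : death γ with _ | d
    · rw [hd] at h'
      exact absurd h' (WithTop.not_top_le_coe _)
    · rw [hd] at h h'
      have h' : d ≤ r.succ := WithTop.coe_le_coe.1 h'
      have h : ¬ d ≤ r.castSucc := fun h0 => h (WithTop.coe_le_coe.2 h0)
      congr 1
      exact le_antisymm h' (Fin.castSucc_lt_iff_succ_le.1 (not_le.1 h))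
  have hmap (γ) {r s : Fin (n + 1)} (hb : birth γ ≤ r) (h : r ≤ s) :
      m.coneSeqMap h k (z γ r) = z γ s := by
    rw [hzx, hzx]
    exact TameMinimalModel.coneSeqMap_coneFamily (x γ) hb h
  exact ⟨{
    birth := birth
    death := death
    v := fun γ r => (z γ r).1
    a := fun γ r => (z γ r).2
    w := w
    d_v := fun γ r => (hz γ r).1
    d_a := fun γ r _ => (hz γ r).2.symm
    map_v := fun γ {r s} h hb => (m.coneSeqMap_fst h k _).symm.trans (congrArg Prod.fst (hmap γ hb h))
    d_w := hdw
    map_w := hmw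
    a_succ := fun γ r hb => (congrArg Prod.snd (hmap γ hb r.castSucc_le_succ)).symm.trans
      (congrArg Prod.snd (m.coneSeqMap_succ r k _))
    a_death := fun {p} e γ r h h' => hbw γ e r.succ (hdeath_succ γ r h h')
    inj := hinj
    surj := hsurj }, hbirth, hdeath⟩

end Generators

/-! ### Pushout squares of persistent algebras -/

theorem CategoryTheory.Adjunction.exists_isPushout_whiskerRight {J C D : Type*} [Category J]
    [Category C] [Category D] {L : C ⥤ D} {R : D ⥤ C} (adj : L ⊣ R) {S T : J ⥤ C} {N M : J ⥤ D}
    (i : S ⟶ T) (φ : S ⟶ N ⋙ R) (F : N ⟶ M) (ψ : T ⟶ M ⋙ R)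
    (w : φ ≫ Functor.whiskerRight F R = i ≫ ψ)
    (hl : ∀ (x : J) (B : D) (α : N.obj x ⟶ B) (β : T.obj x ⟶ R.obj B),
      φ.app x ≫ R.map α = i.app x ≫ β → ∃ δ : M.obj x ⟶ B, F.app x ≫ δ = α ∧
        ψ.app x ≫ R.map δ = β)
    (hu : ∀ (x : J) (B : D) (δ δ' : M.obj x ⟶ B), F.app x ≫ δ = F.app x ≫ δ' →
      ψ.app x ≫ R.map δ = ψ.app x ≫ R.map δ' → δ = δ') :
    ∃ (f : S ⋙ L ⟶ N) (g : T ⋙ L ⟶ M), IsPushout f (Functor.whiskerRight i L) F g := by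
  refine ⟨{ app := fun x => (adj.homEquiv _ _).symm (φ.app x), naturality := fun x y e => ?_ },
    { app := fun x => (adj.homEquiv _ _).symm (ψ.app x), naturality := fun x y e => ?_ },
    IsPushout.of_forall_isPushout_app fun x => ?_⟩
  · change L.map (S.map e) ≫ _ = _
    rw [← adj.homEquiv_naturality_left_symm, ← adj.homEquiv_naturality_right_symm, φ.naturality]
    rfl
  · change L.map (T.map e) ≫ _ = _
    rw [← adj.homEquiv_naturality_left_symm, ← adj.homEquiv_naturality_right_symm, ψ.naturality]
    rfl
  · exact adj.isPushout_of_lift (NatTrans.congr_app w x) (hl x) (hu x)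

/-- Pushouts and coproducts of functors are computed at each time, so the universal property may be
tested there, one summand at a time. -/
theorem CategoryTheory.Adjunction.exists_isPushout_sigma {J C D : Type*} [Category J]
    [Category C] [Category D] {L : C ⥤ D} {R : D ⥤ C} (adj : L ⊣ R) {β : Type u}
    [HasCoproductsOfShape β C] {S T : β → J ⥤ C} {N M : J ⥤ D} (i : ∀ b, S b ⟶ T b)
    (φ : ∀ b, S b ⟶ N ⋙ R) (F : N ⟶ M) (ψ : ∀ b, T b ⟶ M ⋙ R)
    (w : ∀ b, φ b ≫ Functor.whiskerRight F R = i b ≫ ψ b)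
    (hl : ∀ (x : J) (B : D) (α : N.obj x ⟶ B) (y : ∀ b, (T b).obj x ⟶ R.obj B),
      (∀ b, (φ b).app x ≫ R.map α = (i b).app x ≫ y b) → ∃ δ : M.obj x ⟶ B, F.app x ≫ δ = α ∧
        ∀ b, (ψ b).app x ≫ R.map δ = y b)
    (hu : ∀ (x : J) (B : D) (δ δ' : M.obj x ⟶ B), F.app x ≫ δ = F.app x ≫ δ' →
      (∀ b, (ψ b).app x ≫ R.map δ = (ψ b).app x ≫ R.map δ') → δ = δ') :
    ∃ (f : (∐ S) ⋙ L ⟶ N) (g : (∐ T) ⋙ L ⟶ M),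
      IsPushout f (Functor.whiskerRight (Limits.Sigma.map i) L) F g := by
  have hφ (b) (x) : (Sigma.ι S b).app x ≫ (Limits.Sigma.desc φ).app x = (φ b).app x :=
    NatTrans.congr_app (Sigma.ι_desc φ b) x
  have hψ (b) (x) : (Sigma.ι T b).app x ≫ (Limits.Sigma.desc ψ).app x = (ψ b).app x :=
    NatTrans.congr_app (Sigma.ι_desc ψ b) x
  have hi (b) (x) : (Sigma.ι S b).app x ≫ (Limits.Sigma.map i).app x =
      (i b).app x ≫ (Sigma.ι T b).app x := NatTrans.congr_app (Sigma.ι_map i b) x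
  refine adj.exists_isPushout_whiskerRight (Limits.Sigma.map i) (Limits.Sigma.desc φ) F (Limits.Sigma.desc ψ)
    (Sigma.hom_ext _ _ fun b => ?_) (fun x B α y h => ?_) fun x B δ δ' h h' => ?_
  · simpa using w b
  · obtain ⟨δ, h1, h2⟩ := hl x B α (fun b => (Sigma.ι T b).app x ≫ y) fun b => by
      rw [← hφ, Category.assoc, h, ← Category.assoc, hi, Category.assoc]
    refine ⟨δ, h1, sigma_app_hom_ext T fun b => ?_⟩
    rw [← Category.assoc, hψ, h2]
  · refine hu x B δ δ' h fun b => ?_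
    rw [← hψ, Category.assoc, h', Category.assoc]

namespace PInterval

variable (I : PInterval) {G : ℝ≥0 ⥤ CDGA.{u}} {k : ℤ}

/-- The linear map from the line which takes the generator to a given element. -/
def span {V : Type u} [AddCommGroup V] [Module ℚ V] (z : V) : ULift.{u} ℚ →ₗ[ℚ] V :=
  LinearMap.toSpanSingleton ℚ V z ∘ₗ ULift.moduleEquiv.toLinearMap

theorem span_one {V : Type u} [AddCommGroup V] [Module ℚ V] (z : V) : span z ⟨1⟩ = z :=
  one_smul ℚ z

theorem linearMap_ext {V : Type u} [AddCommGroup V] [Module ℚ V] {F G : ULift.{u} ℚ →ₗ[ℚ] V}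
    (h : F ⟨1⟩ = G ⟨1⟩) (x : ULift.{u} ℚ) : F x = G x := by
  have hx : x = x.down • (⟨1⟩ : ULift.{u} ℚ) := ULift.ext _ _ (mul_one x.down).symm
  rw [hx, map_smul, map_smul, h]

theorem cell_hom_ext {P Q : Prop} {h : Q → P} {K : Cplx.{u}}
    {φ ψ : cell (ULift.{u} ℚ) (k + 1) P Q h ⟶ K}
    (ht : ∀ hP : P, (φ.f (k + 1)).hom (Cell.top k h hP ⟨1⟩) =
      (ψ.f (k + 1)).hom (Cell.top k h hP ⟨1⟩))
    (hb : ∀ hQ : Q, (φ.f k).hom (Cell.bot k h hQ ⟨1⟩) = (ψ.f k).hom (Cell.bot k h hQ ⟨1⟩)) :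
    φ = ψ :=
  Cell.hom_ext
    (fun hP => linearMap_ext (F := (φ.f (k + 1)).hom ∘ₗ Cell.top k h hP)
      (G := (ψ.f (k + 1)).hom ∘ₗ Cell.top k h hP) (ht hP))
    (fun hQ => linearMap_ext (F := (φ.f k).hom ∘ₗ Cell.bot k h hQ)
      (G := (ψ.f k).hom ∘ₗ Cell.bot k h hQ) (hb hQ))

/-- The map out of a cell given by the images of the two generators. -/
def cellDesc {B : CDGA.{u}} {P Q : Prop} (h : Q → P) (z : B.X (k + 1)) (y : B.X k)
    (hz : P → B.d rfl z = 0) (hy : Q → B.d rfl y = z) :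
    cell (ULift.{u} ℚ) (k + 1) P Q h ⟶ CDGA.toComplex.obj B :=
  Cell.desc (span z) (span y) h
    (fun hP => linearMap_ext (F := B.d rfl ∘ₗ span z) (G := 0)
      ((congrArg (B.d rfl) (span_one z)).trans (hz hP)))
    (fun hQ => linearMap_ext (F := B.d rfl ∘ₗ span y) (G := span z)
      (((congrArg (B.d rfl) (span_one y)).trans (hy hQ)).trans (span_one z).symm))

section

variable {B : CDGA.{u}} {P Q : Prop} {h : Q → P} {z : B.X (k + 1)} {y : B.X k}
    {hz : P → B.d rfl z = 0} {hy : Q → B.d rfl y = z}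

theorem cellDesc_top (hP : P) :
    ((cellDesc h z y hz hy).f (k + 1)).hom (Cell.top k h hP ⟨1⟩) = z :=
  (Cell.desc_top hP _).trans (span_one z)

theorem cellDesc_bot (hQ : Q) : ((cellDesc h z y hz hy).f k).hom (Cell.bot k h hQ ⟨1⟩) = y :=
  (Cell.desc_bot hQ _).trans (span_one y)

end

variable (z : ∀ x, (G.obj x).X (k + 1)) (y : ∀ x, (G.obj x).X k)

/-- The map out of an interval sphere given by elements which are compatible with the structure
maps. -/
def sphereDesc (hz : ∀ x, I.birth ≤ x → (G.obj x).d rfl (z x) = 0)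
    (hy : ∀ x : ℝ≥0, I.death ≤ x → (G.obj x).d rfl (y x) = z x)
    (mz : ∀ {x x'} (h : x ≤ x'), I.birth ≤ x → CDGA.Hom.f (G.map (homOfLE h)) _ (z x) = z x')
    (my : ∀ {x x' : ℝ≥0} (h : x ≤ x'), I.death ≤ x →
      CDGA.Hom.f (G.map (homOfLE h)) _ (y x) = y x') :
    I.sphere (k + 1) ⟶ G ⋙ CDGA.toComplex where
  app x := cellDesc _ (z x) (y x) (hz x) (hy x)
  naturality x x' e := by
    refine cell_hom_ext (h := fun h => WithTop.coe_le_coe.1 (I.lt.le.trans h))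
      (fun hP => ?_) (fun hQ => ?_)
    · exact (cellDesc_top (hP.trans (leOfHom e))).trans ((congrArg (CDGA.Hom.f (G.map e) _)
        (cellDesc_top hP)).trans (mz (leOfHom e) hP)).symm
    · exact (cellDesc_bot (hQ.trans (WithTop.coe_le_coe.2 (leOfHom e)))).trans
        ((congrArg (CDGA.Hom.f (G.map e) _) (cellDesc_bot hQ)).trans (my (leOfHom e) hQ)).symm

/-- The map out of a persistent disk given by elements which are compatible with the structure
maps. -/
def diskDesc (hz : ∀ x, I.birth ≤ x → (G.obj x).d rfl (z x) = 0)
    (hy : ∀ x, I.birth ≤ x → (G.obj x).d rfl (y x) = z x)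
    (mz : ∀ {x x'} (h : x ≤ x'), I.birth ≤ x → CDGA.Hom.f (G.map (homOfLE h)) _ (z x) = z x')
    (my : ∀ {x x'} (h : x ≤ x'), I.birth ≤ x → CDGA.Hom.f (G.map (homOfLE h)) _ (y x) = y x') :
    I.disk (k + 1) ⟶ G ⋙ CDGA.toComplex where
  app x := cellDesc _ (z x) (y x) (hz x) (hy x)
  naturality x x' e := by
    refine cell_hom_ext (h := id) (fun hP => ?_) (fun hQ => ?_)
    · exact (cellDesc_top (hP.trans (leOfHom e))).trans ((congrArg (CDGA.Hom.f (G.map e) _)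
        (cellDesc_top hP)).trans (mz (leOfHom e) hP)).symm
    · exact (cellDesc_bot (hQ.trans (leOfHom e))).trans
        ((congrArg (CDGA.Hom.f (G.map e) _) (cellDesc_bot hQ)).trans (my (leOfHom e) hQ)).symm

end PInterval

namespace StepExtension

variable {n : ℕ} {F : ComposableArrows CDGA.{u} n} {i : ℤ}

/-- A family of elements of a sequence, extended by zero. -/
def elt (z : ∀ r, (F.obj r).X i) : ∀ a, (obj F CDGA.rat a).X i
  | ⊥ => 0
  | (r : Fin (n + 1)) => z r

/-- The threshold `b` may be infinite so that the same statement serves births and deaths. -/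
theorem map_elt {b : WithTop (Fin (n + 1))} {z : ∀ r, (F.obj r).X i}
    (hz : ∀ {r s : Fin (n + 1)} (h : r ≤ s), b ≤ r →
      CDGA.Hom.f (F.map (homOfLE h)) _ (z r) = z s)
    {a a' : WithBot (Fin (n + 1))} (h : a ≤ a') (hb : ∃ r : Fin (n + 1), a = r ∧ b ≤ r) :
    CDGA.Hom.f (map F CDGA.isInitialRat h) i (elt z a) = elt z a' := by
  obtain ⟨r, rfl, hr⟩ := hb
  cases a' with
  | bot => exact absurd h (WithBot.not_coe_le_bot r)
  | coe s => exact hz (WithBot.coe_le_coe.1 h) hr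

theorem exists_index {t : Fin (n + 1) ↪o ℝ≥0} {q : WithTop ℝ≥0} {d : WithTop (Fin (n + 1))}
    (hd : q = d.map t) {x : ℝ≥0} : q ≤ x ↔ ∃ r : Fin (n + 1), index t x = r ∧ d ≤ r := by
  subst hd
  cases d with
  | top =>
    exact iff_of_false (WithTop.not_top_le_coe x) fun ⟨r, _, h⟩ => WithTop.not_top_le_coe r h
  | coe d =>
    refine (WithTop.coe_le_coe : ((t d : ℝ≥0) : WithTop ℝ≥0) ≤ x ↔ _).trans ((coe_le_index t).symm.trans ?_)
    constructor
    · intro h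
      rcases hi : index t x with _ | r
      · rw [hi] at h
        exact absurd h (WithBot.not_coe_le_bot d)
      · rw [hi] at h
        exact ⟨r, rfl, WithTop.coe_le_coe.2 (WithBot.coe_le_coe.1 h)⟩
    · rintro ⟨r, hr, h⟩
      rw [hr]
      exact WithBot.coe_le_coe.2 (WithTop.coe_le_coe.1 h)

end StepExtension

section Pushout

variable {n : ℕ} {t : Fin (n + 1) ↪o ℝ≥0} {A : ℝ≥0 ⥤ CDGA.{u}} {k : ℕ}

namespace TameGenerators

variable {l : ℕ} {m : TameMinimalModel t A l} {Γ : Type u} (g : TameGenerators m k Γ)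

/-- The inclusion of a sequence into its extension. -/
def inclSeq : m.M ⟶ g.seq where
  app r := (g.hirsch r).incl
  naturality _ _ f := (g.incl_map (leOfHom f)).symm

theorem homApp_inclSeq_elt {i : ℤ} (z : ∀ r, (m.M.obj r).X i) (y : ∀ r, (g.seq.obj r).X i)
    (a : WithBot (Fin (n + 1))) (h : ∀ r : Fin (n + 1), a = r →
      CDGA.Hom.f (g.hirsch r).incl i (z r) = y r) :
    CDGA.Hom.f (StepExtension.homApp g.inclSeq CDGA.rat a) i (StepExtension.elt z a) =
      StepExtension.elt y a := by
  cases a with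
  | bot => rfl
  | coe r => exact h r rfl

theorem hom_ext_step {B : CDGA.{u}} {a : WithBot (Fin (n + 1))}
    {F G : StepExtension.obj g.seq CDGA.rat a ⟶ B}
    (h₁ : StepExtension.homApp g.inclSeq CDGA.rat a ≫ F =
      StepExtension.homApp g.inclSeq CDGA.rat a ≫ G)
    (h₂ : ∀ γ, (∃ r : Fin (n + 1), a = r ∧ g.birth γ ≤ r) →
      CDGA.Hom.f F k (StepExtension.elt (g.gen γ) a) =
        CDGA.Hom.f G k (StepExtension.elt (g.gen γ) a)) : F = G := by
  cases a with
  | bot => exact CDGA.isInitialRat.hom_ext F G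
  | coe r => exact g.hom_ext h₁ fun γ h => h₂ γ ⟨r, rfl, h⟩

/-- At the index `⊥` both algebras are `ℚ` and no generator is born; at a genuine index this is
`exists_lift`. -/
theorem exists_lift_step {B : CDGA.{u}} {a : WithBot (Fin (n + 1))}
    (α : StepExtension.obj m.M CDGA.rat a ⟶ B) (y : Γ → B.X k)
    (hy : ∀ γ, (∃ r : Fin (n + 1), a = r ∧ g.birth γ ≤ r) →
      B.d rfl (y γ) = CDGA.Hom.f α _ (StepExtension.elt (g.v γ) a))
    (hw : ∀ γ, (∃ r : Fin (n + 1), a = r ∧ g.death γ ≤ r) →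
      y γ = CDGA.Hom.f α _ (StepExtension.elt (g.w γ) a)) :
    ∃ F : StepExtension.obj g.seq CDGA.rat a ⟶ B,
      StepExtension.homApp g.inclSeq CDGA.rat a ≫ F = α ∧
      ∀ γ, (∃ r : Fin (n + 1), a = r ∧ g.birth γ ≤ r) →
        CDGA.Hom.f F k (StepExtension.elt (g.gen γ) a) = y γ := by
  cases a with
  | bot =>
    exact ⟨α, Category.id_comp α, fun γ ⟨r, h, _⟩ => absurd h.symm (WithBot.coe_ne_bot)⟩
  | coe r =>
    obtain ⟨F, h1, h2⟩ := g.exists_lift α y (fun γ h => hy γ ⟨r, rfl, h⟩)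
      fun γ h => hw γ ⟨r, rfl, h⟩
    refine ⟨F, h1, ?_⟩
    rintro γ ⟨s, hs, h⟩
    obtain rfl := WithBot.coe_injective hs
    exact h2 γ h

end TameGenerators

variable {m : TameMinimalModel t A (k - 1)}

-- The attaching map takes the top cell of the sphere of `γ` to `v` and, once `γ` is dead, the
-- bottom cell to `w`; the characteristic map takes the bottom cell of the disk to the generator and
-- the top cell to its differential. After the death the sphere has become a disk, and gluing
-- identifies the generator with `w`.
open Classical in
theorem TameGenerators.isPersistentHirschExtension (D : IntervalDecomposition (m.coneCohomology k))
    (g : TameGenerators m k D.Γ) (hb : ∀ γ, (D.I γ).birth = t (g.birth γ))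
    (hd : ∀ γ, (D.I γ).death = (g.death γ).map t) (hA : ∀ x, (A.obj x).IsSimplyConnected)
    (hk : 1 ≤ k) : IsPersistentHirschExtension (g.extension hA hk).persistent k D := by
  have hb' (γ : D.Γ) {x : ℝ≥0} : (D.I γ).birth ≤ x ↔
      ∃ r : Fin (n + 1), StepExtension.index t x = r ∧ g.birth γ ≤ r := by
    have h1 := StepExtension.exists_index (t := t) (q := (D.I γ).birth) (d := g.birth γ)
      (congrArg _ (hb γ)) (x := x)
    simpa only [WithTop.coe_le_coe] using h1
  have hd' (γ : D.Γ) {x : ℝ≥0} : (D.I γ).death ≤ x ↔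
      ∃ r : Fin (n + 1), StepExtension.index t x = r ∧ g.death γ ≤ r :=
    StepExtension.exists_index (hd γ)
  have key {a : WithBot (Fin (n + 1))} {γ : D.Γ}
      (h : ∃ r : Fin (n + 1), a = r ∧ g.birth γ ≤ r) :
      ∃ r : Fin (n + 1), a = r ∧ (g.birth γ : WithTop (Fin (n + 1))) ≤ r :=
    h.imp fun r h => ⟨h.1, WithTop.coe_le_coe.2 h.2⟩
  have hz₁ (γ : D.Γ) (x : ℝ≥0) (h : (D.I γ).birth ≤ x) : (m.persistent.obj x).d rfl
      (StepExtension.elt (g.v γ) (StepExtension.index t x)) = 0 := by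
    obtain ⟨r, hr, h⟩ := (hb' γ).1 h
    change (StepExtension.obj m.M CDGA.rat (StepExtension.index t x)).d rfl _ = 0
    rw [hr]
    exact g.d_v γ r
  have hy₁ (γ : D.Γ) (x : ℝ≥0) (h : (D.I γ).death ≤ x) : (m.persistent.obj x).d rfl
      (StepExtension.elt (g.w γ) (StepExtension.index t x)) =
        StepExtension.elt (g.v γ) (StepExtension.index t x) := by
    obtain ⟨r, hr, h⟩ := (hd' γ).1 h
    change (StepExtension.obj m.M CDGA.rat (StepExtension.index t x)).d rfl _ = _
    rw [hr]
    exact g.d_w γ r h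
  let φ' (γ : D.Γ) : (D.I γ).sphere (k + 1) ⟶ m.persistent ⋙ CDGA.toComplex :=
    (D.I γ).sphereDesc (fun x => StepExtension.elt (g.v γ) (StepExtension.index t x))
      (fun x => StepExtension.elt (g.w γ) (StepExtension.index t x)) (hz₁ γ) (hy₁ γ)
      (fun h hx => StepExtension.map_elt (fun h' h'' => g.map_v γ h' (WithTop.coe_le_coe.1 h''))
        (StepExtension.index_mono t h) (key ((hb' γ).1 hx)))
      (fun h hx => StepExtension.map_elt (g.map_w γ) (StepExtension.index_mono t h)
        ((hd' γ).1 hx))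
  let G := stepExtension t g.seq CDGA.isInitialRat
  let u (γ : D.Γ) (r : Fin (n + 1)) : (g.seq.obj r).X (k + 1) :=
    CDGA.Hom.f (g.hirsch r).incl _ (g.v γ r)
  have hz₂ (γ : D.Γ) (x : ℝ≥0) (h : (D.I γ).birth ≤ x) : (G.obj x).d rfl
      (StepExtension.elt (F := g.seq) (u γ) (StepExtension.index t x)) = 0 := by
    obtain ⟨r, hr, h⟩ := (hb' γ).1 h
    change (StepExtension.obj g.seq CDGA.rat (StepExtension.index t x)).d rfl _ = 0
    rw [hr]
    change (g.hirsch r).ext.d rfl (CDGA.Hom.f (g.hirsch r).incl _ (g.v γ r)) = 0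
    rw [← CDGA.Hom.map_d, g.d_v, map_zero]
  have hy₂ (γ : D.Γ) (x : ℝ≥0) (h : (D.I γ).birth ≤ x) : (G.obj x).d rfl
      (StepExtension.elt (F := g.seq) (g.gen γ) (StepExtension.index t x)) =
        StepExtension.elt (F := g.seq) (u γ) (StepExtension.index t x) := by
    obtain ⟨r, hr, h⟩ := (hb' γ).1 h
    change (StepExtension.obj g.seq CDGA.rat (StepExtension.index t x)).d rfl _ = _
    rw [hr]
    exact g.d_gen h
  let ψ' (γ : D.Γ) : (D.I γ).disk (k + 1) ⟶ G ⋙ CDGA.toComplex :=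
    (D.I γ).diskDesc (fun x => StepExtension.elt (F := g.seq) (u γ) (StepExtension.index t x))
      (fun x => StepExtension.elt (F := g.seq) (g.gen γ) (StepExtension.index t x)) (hz₂ γ) (hy₂ γ)
      (fun h hx => StepExtension.map_elt (F := g.seq) (fun {r s} h' h'' => by
          refine (LinearMap.congr_fun (congrFun (congrArg CDGA.Hom.f (g.incl_map h')) _)
            (g.v γ r)).trans ?_
          exact congrArg (CDGA.Hom.f (g.hirsch s).incl _) (g.map_v γ h' (WithTop.coe_le_coe.1 h'')))
        (StepExtension.index_mono t h) (key ((hb' γ).1 hx)))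
      (fun h hx => StepExtension.map_elt (F := g.seq) (z := g.gen γ)
        (fun h' h'' => g.map_gen h' (WithTop.coe_le_coe.1 h''))
        (StepExtension.index_mono t h) (key ((hb' γ).1 hx)))
  have hle (γ : D.Γ) {x : ℝ≥0} (h : (D.I γ).death ≤ x) : (D.I γ).birth ≤ x :=
    WithTop.coe_le_coe.1 ((D.I γ).lt.le.trans h)
  have hφt (γ : D.Γ) {x : ℝ≥0} (hP : (D.I γ).birth ≤ x) :
      (((φ' γ).app x).f (k + 1)).hom (Cell.top k (hle γ) hP ⟨1⟩) =
        StepExtension.elt (g.v γ) (StepExtension.index t x) := PInterval.cellDesc_top (hz := hz₁ γ x) (hy := hy₁ γ x) hP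
  have hφb (γ : D.Γ) {x : ℝ≥0} (hQ : (D.I γ).death ≤ x) :
      (((φ' γ).app x).f k).hom (Cell.bot k (hle γ) hQ ⟨1⟩) =
        StepExtension.elt (g.w γ) (StepExtension.index t x) := PInterval.cellDesc_bot (hz := hz₁ γ x) (hy := hy₁ γ x) hQ
  have hψt (γ : D.Γ) {x : ℝ≥0} (hP : (D.I γ).birth ≤ x) :
      (((ψ' γ).app x).f (k + 1)).hom (Cell.top k id hP ⟨1⟩) =
        StepExtension.elt (F := g.seq) (u γ) (StepExtension.index t x) :=
    PInterval.cellDesc_top (h := id) (hz := hz₂ γ x) (hy := hy₂ γ x) hP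
  have hψb (γ : D.Γ) {x : ℝ≥0} (hQ : (D.I γ).birth ≤ x) :
      (((ψ' γ).app x).f k).hom (Cell.bot k id hQ ⟨1⟩) =
        StepExtension.elt (F := g.seq) (g.gen γ) (StepExtension.index t x) :=
    PInterval.cellDesc_bot (h := id) (hz := hz₂ γ x) (hy := hy₂ γ x) hQ
  have hu (γ : D.Γ) (a : WithBot (Fin (n + 1))) :
      CDGA.Hom.f (StepExtension.homApp g.inclSeq CDGA.rat a) _ (StepExtension.elt (g.v γ) a) =
        StepExtension.elt (F := g.seq) (u γ) a :=
    g.homApp_inclSeq_elt _ _ a fun _ _ => rfl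
  have w (γ : D.Γ) : φ' γ ≫ Functor.whiskerRight (stepExtensionMap t g.inclSeq CDGA.isInitialRat) CDGA.toComplex =
      (D.I γ).sphereToDisk (k + 1) ≫ ψ' γ := by
    ext x : 2
    refine PInterval.cell_hom_ext (h := hle γ) (fun hP => ?_) (fun hQ => ?_)
    · refine (congrArg (CDGA.Hom.f (StepExtension.homApp g.inclSeq CDGA.rat
        (StepExtension.index t x)) _) (hφt γ hP)).trans ((hu γ _).trans ?_)
      exact (hψt γ hP).symm
    · refine (congrArg (CDGA.Hom.f (StepExtension.homApp g.inclSeq CDGA.rat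
        (StepExtension.index t x)) _) (hφb γ hQ)).trans ?_
      refine Eq.trans ?_ (hψb γ (hle γ hQ)).symm
      obtain ⟨r, hr, h⟩ := (hd' γ).1 hQ
      rw [hr]
      exact (g.gen_dead h).symm
  refine lamAdj.exists_isPushout_sigma (fun γ => (D.I γ).sphereToDisk (k + 1)) φ' _ ψ' w
    (fun x B α β h => ?_) fun x B δ δ' h h' => ?_
  -- The prescribed image of the generator is the value of `β` on the bottom cell of the disk;
  -- unborn generators get the default `0`, which is never used.
  · let y (γ : D.Γ) : B.X k := if h : (D.I γ).birth ≤ x then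
      ((β γ).f k).hom (Cell.bot k id h ⟨1⟩) else 0
    have hy (γ : D.Γ) (h : (D.I γ).birth ≤ x) : y γ = ((β γ).f k).hom (Cell.bot k id h ⟨1⟩) :=
      dif_pos h
    have htop (γ : D.Γ) (hx : (D.I γ).birth ≤ x) :
        ((β γ).f (k + 1)).hom (Cell.top k id hx ⟨1⟩) =
          CDGA.Hom.f α _ (StepExtension.elt (g.v γ) (StepExtension.index t x)) := by
      have h1 := Cplx.hom_congr (h γ) (k + 1) (Cell.top k (hle γ) hx ⟨1⟩)
      exact h1.symm.trans (congrArg (CDGA.Hom.f α _) (hφt γ hx))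
    have hy' (γ : D.Γ) (hx : (D.I γ).birth ≤ x) : B.d rfl (y γ) =
        CDGA.Hom.f α _ (StepExtension.elt (g.v γ) (StepExtension.index t x)) := by
      rw [hy γ hx, ← htop γ hx, ← Cell.d_bot (h := id) hx]
      have h1 := congrArg (fun g => g.hom (Cell.bot k id hx ⟨1⟩)) ((β γ).comm k (k + 1))
      exact (CDGA.toComplex_d_hom B rfl _).symm.trans h1
    -- Once `γ` is dead, the sphere also has a bottom cell, and agreement there is the condition `y
    -- = α w`.
    have hw' (γ : D.Γ) (hx : (D.I γ).death ≤ x) :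
        y γ = CDGA.Hom.f α _ (StepExtension.elt (g.w γ) (StepExtension.index t x)) := by
      rw [hy γ (hle γ hx)]
      have h1 := Cplx.hom_congr (h γ) k (Cell.bot k (hle γ) hx ⟨1⟩)
      exact h1.symm.trans (congrArg (CDGA.Hom.f α _) (hφb γ hx))
    obtain ⟨δ, h1, h2⟩ := g.exists_lift_step α y (fun γ hγ => hy' γ ((hb' γ).2 hγ))
      fun γ hγ => hw' γ ((hd' γ).2 hγ)
    refine ⟨δ, h1, fun γ => PInterval.cell_hom_ext (h := id) (fun hP => ?_) (fun hQ => ?_)⟩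
    · refine (congrArg (CDGA.Hom.f δ _) (hψt γ hP)).trans ?_
      refine Eq.trans ?_ (htop γ hP).symm
      rw [← h1]
      exact congrArg (CDGA.Hom.f δ _) (hu γ _).symm
    · refine (congrArg (CDGA.Hom.f δ _) (hψb γ hQ)).trans ?_
      exact (h2 γ ((hb' γ).1 hQ)).trans (hy γ hQ)
  · refine g.hom_ext_step h fun γ hγ => ?_
    have hx := (hb' γ).2 hγ
    have h1 := Cplx.hom_congr (h' γ) k (Cell.bot k id hx ⟨1⟩)
    refine Eq.trans ?_ (h1.trans ?_)
    · exact (congrArg (CDGA.Hom.f δ _) (hψb γ hx)).symm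
    · exact congrArg (CDGA.Hom.f δ' _) (hψb γ hx)

end Pushout

/-! ### Decomposing a finite sequence of vector spaces -/

theorem Submodule.exists_relative_complement {V : Type*} [AddCommGroup V] [Module ℚ V]
    {N K : Submodule ℚ V} (h : N ≤ K) : ∃ U : Submodule ℚ V, U ≤ K ∧ U ⊓ N = ⊥ ∧ N ⊔ U = K := by
  obtain ⟨U, hU⟩ := N.exists_isCompl
  refine ⟨U ⊓ K, inf_le_right, ?_, ?_⟩
  · rw [eq_bot_iff, ← hU.inf_eq_bot]
    exact le_inf inf_le_right (inf_le_left.trans inf_le_left)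
  · rw [← sup_inf_assoc_of_le U h, hU.sup_eq_top, top_inf_eq]

namespace FinitePersistence

variable {n : ℕ} (W : Fin (n + 1) ⥤ ModuleCat.{u} ℚ)

/-- The structure maps of a finite sequence of vector spaces. -/
def tr {r s : Fin (n + 1)} (h : r ≤ s) : W.obj r →ₗ[ℚ] W.obj s := (W.map (homOfLE h)).hom

theorem tr_self (r : Fin (n + 1)) (x : W.obj r) : tr W le_rfl x = x :=
  congrArg (fun f => f.hom x) (W.map_id r)

theorem tr_tr {r s u : Fin (n + 1)} (h : r ≤ s) (h' : s ≤ u) (x : W.obj r) :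
    tr W h' (tr W h x) = tr W (h.trans h') x :=
  (congrArg (fun f => f.hom x) (W.map_comp (homOfLE h) (homOfLE h'))).symm

/-- The elements born before `b`. -/
def old (b : Fin (n + 1)) : Submodule ℚ (W.obj b) :=
  ⨆ r : {r // r < b}, LinearMap.range (tr W r.2.le)

/-- The elements at `b` which are dead at the indices satisfying `P`. -/
def dead (b : Fin (n + 1)) (P : Fin (n + 1) → Prop) : Submodule ℚ (W.obj b) :=
  ⨅ r : {r // b ≤ r ∧ P r}, LinearMap.ker (tr W r.2.1)

variable {W}

theorem mem_dead {b : Fin (n + 1)} {P : Fin (n + 1) → Prop} {x : W.obj b} :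
    x ∈ dead W b P ↔ ∀ r (h : b ≤ r), P r → tr W h x = 0 := by
  simp only [dead, Submodule.mem_iInf, LinearMap.mem_ker]
  exact ⟨fun h r hr hP => h ⟨r, hr, hP⟩, fun h r => h r.1 r.2.1 r.2.2⟩

theorem dead_le_dead {b d : Fin (n + 1)} : dead W b (d ≤ ·) ≤ dead W b (d < ·) := fun _ hx =>
  mem_dead.2 fun r h hr => mem_dead.1 hx r h hr.le

/-- Among the elements of `W_b` dead after `d`, one splits off those already dead at `d` and those
born before `b`. What remains lives exactly on the closed range of indices from `b` to `d`. -/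
theorem exists_fresh (b d : Fin (n + 1)) : ∃ U : Submodule ℚ (W.obj b), U ≤ dead W b (d < ·) ∧
    U ⊓ (dead W b (d ≤ ·) ⊔ old W b ⊓ dead W b (d < ·)) = ⊥ ∧
    dead W b (d ≤ ·) ⊔ old W b ⊓ dead W b (d < ·) ⊔ U = dead W b (d < ·) :=
  Submodule.exists_relative_complement (sup_le dead_le_dead inf_le_right)

variable (W)

/-- A space of representatives for the elements which live precisely from `b` to `d`. -/
def fresh (b d : Fin (n + 1)) : Submodule ℚ (W.obj b) := (exists_fresh (W := W) b d).choose

variable {W}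

theorem fresh_le (b d : Fin (n + 1)) : fresh W b d ≤ dead W b (d < ·) :=
  (exists_fresh b d).choose_spec.1

/-- By the modular law, a fresh element lying in the larger sum with all old elements, not only
those dead after `d`, already lies in the subspace that was split off. -/
theorem eq_zero_of_mem_fresh {b d : Fin (n + 1)} {x : W.obj b} (hx : x ∈ fresh W b d)
    (h : x ∈ dead W b (d ≤ ·) ⊔ old W b) : x = 0 := by
  have h1 : x ∈ (dead W b (d ≤ ·) ⊔ old W b) ⊓ dead W b (d < ·) := ⟨h, fresh_le b d hx⟩
  rw [sup_inf_assoc_of_le _ dead_le_dead] at h1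
  have h2 : x ∈ fresh W b d ⊓ (dead W b (d ≤ ·) ⊔ old W b ⊓ dead W b (d < ·)) := ⟨hx, h1⟩
  rw [fresh, (exists_fresh (W := W) b d).choose_spec.2.1] at h2
  exact h2

/-- A compatible family of subspaces which contains the fresh elements is everything. -/
theorem eq_top_of_fresh_le (T : ∀ r, Submodule ℚ (W.obj r))
    (hT : ∀ {r s : Fin (n + 1)} (h : r ≤ s) (x), x ∈ T r → tr W h x ∈ T s)
    (hf : ∀ {b d : Fin (n + 1)}, b ≤ d → fresh W b d ≤ T b) (b : Fin (n + 1)) : T b = ⊤ := by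
  induction b using WellFoundedLT.induction with
  | ind b ih =>
    have hold : old W b ≤ T b := iSup_le fun r => by
      rintro _ ⟨x, rfl⟩
      exact hT _ x (by rw [ih r.1 r.2]; trivial)
    -- One step of the filtration of `W_b` by death: earlier deaths are covered by `hd`, old
    -- elements by the induction on `b`, and fresh ones by assumption.
    have key (d : Fin (n + 1)) (hd : dead W b (d ≤ ·) ≤ T b) (hbd : b ≤ d) :
        dead W b (d < ·) ≤ T b := by
      rw [← (exists_fresh (W := W) b d).choose_spec.2.2]
      exact sup_le (sup_le hd (inf_le_left.trans hold)) (hf hbd)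
    have hbot : dead W b (b ≤ ·) ≤ T b := fun x hx => by
      have h0 := mem_dead.1 hx b le_rfl le_rfl
      rw [tr_self] at h0
      rw [h0]
      exact zero_mem _
    -- The filtration starts from the zero space of elements already dead at `b`, and after the last
    -- index the condition is vacuous, so it ends with all of `W_b`.
    have hdead (d : Fin (n + 1)) : b ≤ d → dead W b (d < ·) ≤ T b := by
      induction d using Fin.induction with
      | zero =>
        intro h
        obtain rfl : b = 0 := le_antisymm h (Fin.zero_le b)
        exact key 0 hbot le_rfl
      | succ d ihd =>
        intro h
        rcases h.eq_or_lt with rfl | hlt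
        · exact key _ hbot le_rfl
        · refine key _ (fun x hx => ihd (Fin.le_castSucc_iff.2 hlt) (mem_dead.2 fun r hr hdr => ?_)) h
          exact mem_dead.1 hx r hr (Fin.castSucc_lt_iff_succ_le.1 hdr)
    rw [eq_top_iff]
    exact fun x _ => hdead (Fin.last n) (Fin.le_last b)
      (mem_dead.2 fun r _ hr => absurd hr (not_lt.2 (Fin.le_last r)))

/-- The intervals which contain `r`. -/
abbrev Alive (r : Fin (n + 1)) : Type :=
  {p : Fin (n + 1) × Fin (n + 1) // p.1 ≤ r ∧ r ≤ p.2}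

variable (W)

/-- The map which assembles the fresh elements alive at `r`. -/
def assemble (r : Fin (n + 1)) : (∀ p : Alive r, fresh W p.1.1 p.1.2) →ₗ[ℚ] W.obj r :=
  ∑ p : Alive r, tr W p.2.1 ∘ₗ (fresh W p.1.1 p.1.2).subtype ∘ₗ LinearMap.proj p

variable {W}

theorem assemble_apply (r : Fin (n + 1)) (u : ∀ p : Alive r, fresh W p.1.1 p.1.2) :
    assemble W r u = ∑ p : Alive r, tr W p.2.1 (u p).1 := by
  simp [assemble]

theorem assemble_single (r : Fin (n + 1)) (p : Alive r) (x : fresh W p.1.1 p.1.2) :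
    assemble W r (Pi.single p x) = tr W p.2.1 x.1 := by
  rw [assemble_apply, Finset.sum_eq_single p]
  · rw [Pi.single_eq_same]
  · intro q _ hq
    rw [Pi.single_eq_of_ne hq]
    exact map_zero _
  · exact fun h => absurd (Finset.mem_univ p) h

theorem tr_mem_range_assemble {b d r : Fin (n + 1)} (h : b ≤ r) {x : W.obj b}
    (hx : x ∈ fresh W b d) : tr W h x ∈ LinearMap.range (assemble W r) := by
  by_cases hd : r ≤ d
  · exact ⟨_, assemble_single r ⟨(b, d), h, hd⟩ ⟨x, hx⟩⟩
  · rw [mem_dead.1 (fresh_le b d hx) r h (not_le.1 hd)]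
    exact zero_mem _

/-- The images of the assembly maps are stable under the structure maps, as a fresh element either
stays alive or becomes zero, and they contain all fresh elements. -/
theorem assemble_surjective (r : Fin (n + 1)) : Function.Surjective (assemble W r) := by
  rw [← LinearMap.range_eq_top]
  refine eq_top_of_fresh_le (fun r => LinearMap.range (assemble W r)) (fun {r s} h x hx => ?_)
    (fun {b d} _ x hx => ?_) r
  · obtain ⟨u, rfl⟩ := hx
    rw [assemble_apply, map_sum]
    refine sum_mem fun p _ => ?_
    rw [tr_tr]
    exact tr_mem_range_assemble _ (u p).2
  · have := tr_mem_range_assemble le_rfl hx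
    rwa [tr_self] at this

theorem assemble_injective (r : Fin (n + 1)) : Function.Injective (assemble W r) := by
  rw [injective_iff_map_eq_zero]
  intro u hu
  -- The components vanish one by one in descending lexicographic order of (birth, last living
  -- index): latest births first, then latest deaths.
  have key (q : Fin (n + 1) ×ₗ Fin (n + 1)) : ∀ p : Alive r, toLex p.1 = q → u p = 0 := by
    induction q using WellFoundedGT.induction with
    | ind q ih =>
      rintro ⟨⟨b, d⟩, hp⟩ rfl
      have ih₁ (p : Alive r) (h : b < p.1.1) : u p = 0 :=
        ih _ (Prod.Lex.toLex_lt_toLex.2 (Or.inl h)) p rfl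
      have ih₂ (p : Alive r) (h : b = p.1.1) (h' : d < p.1.2) : u p = 0 :=
        ih _ (Prod.Lex.toLex_lt_toLex.2 (Or.inr ⟨h, h'⟩)) p rfl
      -- The relation is pulled back from `r` to the index `b`; terms born later cannot be moved
      -- there, but they vanish by induction.
      let θ (p : Alive r) : W.obj b := if h : p.1.1 ≤ b then tr W h (u p).1 else 0
      have hθ (p : Alive r) (h : p.1.1 ≤ b) : θ p = tr W h (u p).1 := dif_pos h
      have hθ₀ (p : Alive r) (h : u p = 0) : θ p = 0 := by
        by_cases hb : p.1.1 ≤ b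
        · rw [hθ p hb, h]
          exact map_zero _
        · exact dif_neg hb
      -- For `s ≥ d ≥ r` the map from `b` to `s` passes through `r`, where the sum is the given
      -- relation.
      have hX : ∑ p, θ p ∈ dead W b (d ≤ ·) := by
        refine mem_dead.2 fun s hs hds => ?_
        rw [← tr_tr W hp.1 (hp.2.trans hds)]
        refine (congrArg _ ?_).trans (map_zero _)
        rw [map_sum, ← hu, assemble_apply]
        refine Finset.sum_congr rfl fun p _ => ?_
        by_cases hb : p.1.1 ≤ b
        · rw [hθ p hb, tr_tr]
        · have h0 := ih₁ p (not_le.1 hb)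
          rw [hθ₀ p h0, h0]
          exact (map_zero _).trans (map_zero _).symm
      -- Earlier births give old elements, equal births with earlier death give elements dead from
      -- `d` on, and the rest is zero by induction. The remaining term is thus fresh and negligible,
      -- hence zero.
      have hrest (p : Alive r) (hne : p ≠ ⟨(b, d), hp⟩) :
          θ p ∈ dead W b (d ≤ ·) ⊔ old W b := by
        obtain ⟨⟨b', d'⟩, hp'⟩ := p
        rcases lt_trichotomy b' b with hb | rfl | hb
        · rw [hθ _ hb.le]
          exact Submodule.mem_sup_right (Submodule.mem_iSup_of_mem ⟨b', hb⟩ ⟨_, rfl⟩)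
        · rcases lt_trichotomy d' d with hd | rfl | hd
          · rw [hθ _ le_rfl, tr_self]
            exact Submodule.mem_sup_left (mem_dead.2 fun s hs hds =>
              mem_dead.1 (fresh_le _ _ (u ⟨(b', d'), hp'⟩).2) s hs (hd.trans_le hds))
          · exact absurd rfl hne
          · rw [hθ₀ _ (ih₂ _ rfl hd)]
            exact zero_mem _
        · rw [hθ₀ _ (ih₁ _ hb)]
          exact zero_mem _
      refine Subtype.ext (eq_zero_of_mem_fresh (u _).2 ?_)
      have h1 : θ ⟨(b, d), hp⟩ = (u ⟨(b, d), hp⟩).1 := by rw [hθ _ le_rfl, tr_self]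
      rw [← h1, eq_sub_of_add_eq (Finset.add_sum_erase _ θ (Finset.mem_univ ⟨(b, d), hp⟩))]
      exact sub_mem (Submodule.mem_sup_left hX) (sum_mem fun p hp' =>
        hrest p (Finset.ne_of_mem_erase hp'))
  exact funext fun p => key _ p rfl

/-- The intervals in a finite sequence. -/
abbrev Interval (n : ℕ) : Type := {p : Fin (n + 1) × Fin (n + 1) // p.1 ≤ p.2}

variable (W)

/-- A basis of a space of representatives. -/
def freshBasis (p : Interval n) : Module.Basis (Module.Basis.ofVectorSpaceIndex ℚ
    (fresh W p.1.1 p.1.2)) ℚ (fresh W p.1.1 p.1.2) := Module.Basis.ofVectorSpace ℚ _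

/-- The index set of the interval decomposition of a finite sequence. -/
abbrev Index : Type u := Σ p : Interval n, Module.Basis.ofVectorSpaceIndex ℚ (fresh W p.1.1 p.1.2)

/-- The generator of a summand, at its birth. -/
def elt (γ : Index W) : W.obj γ.1.1.1 := (freshBasis W γ.1 γ.2).1

/-- The indices of the basis elements alive at `r`. -/
def aliveEquiv (r : Fin (n + 1)) :
    (Σ p : Alive r, Module.Basis.ofVectorSpaceIndex ℚ (fresh W p.1.1 p.1.2)) ≃
      {γ : Index W // γ.1.1.1 ≤ r ∧ r ≤ γ.1.1.2} where
  toFun x := ⟨⟨⟨x.1.1, x.1.2.1.trans x.1.2.2⟩, x.2⟩, x.1.2⟩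
  invFun γ := ⟨⟨γ.1.1.1, γ.2⟩, γ.1.2⟩
  left_inv _ := rfl
  right_inv _ := rfl

/-- The basis of the space at `r` formed by the images of the generators alive at `r`. -/
def basis (r : Fin (n + 1)) :
    Module.Basis {γ : Index W // γ.1.1.1 ≤ r ∧ r ≤ γ.1.1.2} ℚ (W.obj r) :=
  ((Pi.basis fun p : Alive r => freshBasis W ⟨p.1, p.2.1.trans p.2.2⟩).map
    (LinearEquiv.ofBijective (assemble W r)
      ⟨assemble_injective r, assemble_surjective r⟩)).reindex (aliveEquiv W r)

theorem basis_apply (r : Fin (n + 1)) (γ : {γ : Index W // γ.1.1.1 ≤ r ∧ r ≤ γ.1.1.2}) :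
    basis W r γ = tr W γ.2.1 (elt W γ.1) := by
  rw [basis, Module.Basis.reindex_apply, Module.Basis.map_apply, Pi.basis_apply]
  exact assemble_single r _ _

theorem tr_elt_eq_zero (γ : Index W) {r : Fin (n + 1)} (h : γ.1.1.1 ≤ r) (h' : γ.1.1.2 < r) :
    tr W h (elt W γ) = 0 := mem_dead.1 (fresh_le _ _ (freshBasis W γ.1 γ.2).2) r h h'

end FinitePersistence

/-! ### Existence of interval decompositions over `[0, ∞)` -/

section Existence

variable {V : ℝ≥0 ⥤ ModuleCat.{u} ℚ}

/-- The map from an interval module given by elements which are compatible with the structure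
maps. -/
def PInterval.moduleDesc (I : PInterval) (e : ∀ x, V.obj x)
    (he : ∀ x y (h : x ≤ y), I.birth ≤ x → (V.map (homOfLE h)).hom (e x) = e y)
    (he₀ : ∀ x : ℝ≥0, I.death ≤ x → e x = 0) : I.intervalModule ⟶ V where
  app x := ModuleCat.ofHom (X := gate (ULift.{u} ℚ) (I.birth ≤ x ∧ (x : WithTop ℝ≥0) < I.death))
    (PInterval.span (e x) ∘ₗ Submodule.subtype _)
  naturality x y f := by
    refine ModuleCat.hom_ext (LinearMap.ext fun
      (z : gate (ULift.{u} ℚ) (I.birth ≤ x ∧ (x : WithTop ℝ≥0) < I.death)) => ?_)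
    have h2 : (V.map f).hom (PInterval.span (e x) z.1) = PInterval.span (e y) z.1 := by
      obtain ⟨z, hz | rfl⟩ := z
      · change (V.map f).hom (z.down • e x) = z.down • e y
        rw [map_smul]
        exact congrArg _ (he x y (leOfHom f) hz.1)
      · rw [map_zero, map_zero, map_zero]
    refine Eq.trans ?_ h2.symm
    by_cases hy : (y : WithTop ℝ≥0) < I.death
    · dsimp only [PInterval.intervalModule]
      rw [dif_pos hy]
      rfl
    · dsimp only [PInterval.intervalModule]
      rw [dif_neg hy, he₀ y (not_lt.1 hy), zero_comp]
      exact (smul_zero (A := V.obj y) z.1.down : _ • (0 : V.obj y) = 0).symm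

/-- A persistence module with compatible bases at all times is a direct sum of interval modules. -/
theorem IntervalDecomposition.nonempty_of_basis {Γ : Type u} (I : Γ → PInterval)
    (e : Γ → ∀ x, V.obj x)
    (he : ∀ γ x y (h : x ≤ y), (I γ).birth ≤ x → (V.map (homOfLE h)).hom (e γ x) = e γ y)
    (he₀ : ∀ γ (x : ℝ≥0), (I γ).death ≤ x → e γ x = 0)
    (B : ∀ x : ℝ≥0, ∃ B : Module.Basis {γ // (I γ).birth ≤ x ∧ (x : WithTop ℝ≥0) < (I γ).death} ℚ
      (V.obj x), ∀ γ, B γ = e γ.1 x) : Nonempty (IntervalDecomposition V) := by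
  let θ (γ : Γ) : (I γ).intervalModule ⟶ V := (I γ).moduleDesc (e γ) (he γ) (he₀ γ)
  suffices h : IsIso (Limits.Sigma.desc θ) from ⟨Γ, I, (asIso (Limits.Sigma.desc θ)).symm⟩
  have hθ (γ : Γ) (x : ℝ≥0) : (Sigma.ι (fun γ => (I γ).intervalModule) γ).app x ≫
      (Limits.Sigma.desc θ).app x = (θ γ).app x := NatTrans.congr_app (Sigma.ι_desc θ γ) x
  suffices h : ∀ x, IsIso ((Limits.Sigma.desc θ).app x) from NatIso.isIso_of_isIso_app _
  intro x
  obtain ⟨B, hB⟩ := B x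
  let ι (γ : Γ) : gate (ULift.{u} ℚ) ((I γ).birth ≤ x ∧ (x : WithTop ℝ≥0) < (I γ).death) →ₗ[ℚ]
      (∐ fun γ => (I γ).intervalModule : ℝ≥0 ⥤ ModuleCat.{u} ℚ).obj x :=
    ((Sigma.ι (fun γ => (I γ).intervalModule) γ).app x).hom
  -- The inverse at time `x` is prescribed on the basis.
  let s : V.obj x →ₗ[ℚ] (∐ fun γ => (I γ).intervalModule : ℝ≥0 ⥤ ModuleCat.{u} ℚ).obj x :=
    B.constr ℚ fun γ => ι γ.1 (gateMk γ.2 ⟨1⟩)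
  have hs (γ : {γ // (I γ).birth ≤ x ∧ (x : WithTop ℝ≥0) < (I γ).death}) : s (e γ.1 x) = ι γ.1 (gateMk γ.2 ⟨1⟩) := by
    rw [← hB]
    exact B.constr_basis ℚ _ γ
  have hd (γ : Γ) (h) : ((Limits.Sigma.desc θ).app x).hom (ι γ (gateMk h ⟨1⟩)) = e γ x :=
    (congrArg (fun f => f.hom (gateMk h ⟨1⟩)) (hθ γ x)).trans (PInterval.span_one _)
  refine ⟨ModuleCat.ofHom s, sigma_app_hom_ext _ fun γ => ?_, ModuleCat.hom_ext (B.ext fun γ => ?_)⟩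
  · refine ModuleCat.hom_ext (LinearMap.ext fun
      (z : gate (ULift.{u} ℚ) ((I γ).birth ≤ x ∧ (x : WithTop ℝ≥0) < (I γ).death)) => ?_)
    change s (((Limits.Sigma.desc θ).app x).hom (ι γ z)) = ι γ z
    obtain ⟨z, hz⟩ := z
    rcases hz with h | rfl
    · have hz : (⟨z, Or.inl h⟩ : gate (ULift.{u} ℚ) ((I γ).birth ≤ x ∧
          (x : WithTop ℝ≥0) < (I γ).death)) = z.down • gateMk h ⟨1⟩ :=
        Subtype.ext (ULift.ext _ _ (mul_one z.down).symm)
      rw [hz, map_smul, map_smul, map_smul, hd γ h, hs ⟨γ, h⟩]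
    · exact ((congrArg _ ((congrArg _ (map_zero (ι γ))).trans (map_zero _))).trans
        (map_zero s)).trans (map_zero (ι γ)).symm
  · rw [hB]
    exact (congrArg ((Limits.Sigma.desc θ).app x).hom (hs γ)).trans (hd γ.1 γ.2)

variable {n : ℕ} {t : Fin (n + 1) ↪o ℝ≥0}

/-- The index of death of an interval which ends with the index `d`. -/
def deathIndex (d : Fin (n + 1)) : WithTop (Fin (n + 1)) :=
  if h : (d : ℕ) < n then ((⟨d + 1, Nat.succ_lt_succ h⟩ : Fin (n + 1)) : WithTop _) else ⊤

/-- Passes from closed index ranges to half-open intervals: the death is the index after `d`, and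
`∞` when `d` is the last. -/
theorem deathIndex_le {d r : Fin (n + 1)} : deathIndex d ≤ r ↔ d < r := by
  rw [deathIndex]
  split_ifs with h
  · exact WithTop.coe_le_coe
  · exact iff_of_false (WithTop.not_top_le_coe r) (by rw [Fin.lt_def]; omega)

/-- Decompose the finite sequence `V(t_0) → ⋯ → V(t_n)` and carry its bases to all other times by
the bijections `V(t_r) → V(x)`; before `t_0` the basis is empty. -/
theorem IsStep.nonempty_intervalDecomposition (hV : IsStep t V) :
    Nonempty (IntervalDecomposition V) := by
  let W : Fin (n + 1) ⥤ ModuleCat.{u} ℚ := t.monotone.functor ⋙ V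
  have hlt (γ : FinitePersistence.Index W) :
      ((t γ.1.1.1 : ℝ≥0) : WithTop ℝ≥0) < (deathIndex γ.1.1.2).map t := by
    rw [← not_le, StepExtension.exists_index rfl]
    rintro ⟨r, hr, h⟩
    rw [StepExtension.index_apply] at hr
    obtain rfl := WithBot.coe_injective hr
    exact not_lt.2 γ.1.2 (deathIndex_le.1 h)
  let I (γ : FinitePersistence.Index W) : PInterval := ⟨t γ.1.1.1, _, hlt γ⟩
  let v (γ : FinitePersistence.Index W) : V.obj (t γ.1.1.1) := FinitePersistence.elt W γ
  let e (γ : FinitePersistence.Index W) (x : ℝ≥0) : V.obj x :=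
    if h : t γ.1.1.1 ≤ x then (V.map (homOfLE h)).hom (v γ) else 0
  have he (γ : FinitePersistence.Index W) (x : ℝ≥0) (h : t γ.1.1.1 ≤ x) :
      e γ x = (V.map (homOfLE h)).hom (v γ) := dif_pos h
  have hcomp {x y z : ℝ≥0} (h : x ≤ y) (h' : y ≤ z) (v : V.obj x) :
      (V.map (homOfLE h')).hom ((V.map (homOfLE h)).hom v) =
        (V.map (homOfLE (h.trans h'))).hom v :=
    (congrArg (fun f => f.hom v) (V.map_comp (homOfLE h) (homOfLE h'))).symm
  have hmem (γ : FinitePersistence.Index W) {x : ℝ≥0} {r : Fin (n + 1)} (hr : StepExtension.index t x = r) :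
      γ.1.1.1 ≤ r ∧ r ≤ γ.1.1.2 ↔ (I γ).birth ≤ x ∧ (x : WithTop ℝ≥0) < (I γ).death := by
    refine and_congr ?_ ?_
    · rw [← StepExtension.coe_le_index t, hr, WithBot.coe_le_coe]
    · rw [← not_lt, ← deathIndex_le, ← not_le]
      refine not_congr ?_
      rw [StepExtension.exists_index rfl, hr]
      exact ⟨fun h => ⟨r, rfl, h⟩, fun ⟨s, hs, h⟩ => by rwa [WithBot.coe_injective hs]⟩
  refine IntervalDecomposition.nonempty_of_basis I e (fun γ x y h hx => ?_) (fun γ x hx => ?_)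
    fun x => ?_
  · rw [he γ x hx, he γ y (hx.trans h), hcomp]
  · obtain ⟨r, hr, h⟩ := (StepExtension.exists_index rfl).1 hx
    have hdr := deathIndex_le.1 h
    have hbr := γ.1.2.trans hdr.le
    have hrx := StepExtension.index_eq_coe t hr
    rw [he γ x ((t.monotone hbr).trans hrx), ← hcomp (t.monotone hbr) hrx]
    exact (congrArg _ (FinitePersistence.tr_elt_eq_zero W γ hbr hdr)).trans
      (map_zero (V.map (homOfLE hrx)).hom)
  · rcases hx : StepExtension.index t x with _ | r
    · have h0 := hV.eq_zero x hx
      have : Subsingleton (V.obj x) := ⟨fun y z => (h0 y).trans (h0 z).symm⟩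
      have : IsEmpty {γ // (I γ).birth ≤ x ∧ (x : WithTop ℝ≥0) < (I γ).death} := ⟨fun γ => by
        have := (StepExtension.coe_le_index t).2 γ.2.1
        rw [hx] at this
        exact WithBot.not_coe_le_bot _ this⟩
      exact ⟨Module.Basis.empty _, fun γ => isEmptyElim γ⟩
    · have hrx := StepExtension.index_eq_coe t hx
      refine ⟨((FinitePersistence.basis W r).map (LinearEquiv.ofBijective
        (V.map (homOfLE hrx)).hom (hV.bijective r x hrx hx))).reindex
          (Equiv.subtypeEquivRight fun γ => hmem γ hx), fun γ => ?_⟩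
      have hγ := (hmem γ.1 hx).2 γ.2
      rw [he γ.1 x γ.2.1, ← hcomp (t.monotone hγ.1) hrx, Module.Basis.reindex_apply]
      exact congrArg (V.map (homOfLE hrx)).hom (FinitePersistence.basis_apply W r ⟨γ.1, hγ⟩)

end Existence

end

/-! ### The interval surgery lemma -/

theorem mainTheorem2 {n : ℕ} (t : Fin (n + 1) ↪o ℝ≥0) (A : ℝ≥0 ⥤ CDGA.{u})
    (hA : Discretizes t A) (hA' : ∀ x, (A.obj x).IsSimplyConnected) (k : ℕ) (hk : 1 ≤ k)
    (m : TameMinimalModel t A (k - 1)) :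
    Nonempty (IntervalDecomposition (m.coneCohomology k)) ∧
      ∀ D : IntervalDecomposition (m.coneCohomology k),
        ∃ (m' : TameMinimalModel t A k) (e : m.Extension m'),
          IsPersistentHirschExtension e.persistent k D := by
  refine ⟨(m.isStep_coneCohomology k).nonempty_intervalDecomposition, fun D => ?_⟩
  obtain ⟨g, hb, hd⟩ := TameGenerators.exists_of_decomposition D
  exact ⟨g.extend hA' hk, g.extension hA' hk, g.isPersistentHirschExtension D hb hd hA' hk⟩
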